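/- **Setting.** Let $\rho$ be an $n$-qubit density matrix on a register $A$. A purified query oracle of $\rho$ is a unitary $U_\rho$ on $A$ and an $n'$-qubit register $B$ with $\operatorname{tr}_B |\Psi\rangle\langle\Psi| = \rho$ for $|\Psi\rangle = U_\rho|0\rangle_A|0\rangle_B$. For $\alpha\in(0,1)\cup(1,\infty)$ let $S_\alpha(\rho)=\frac1{1-\alpha}\log\operatorname{tr}(\rho^\alpha)$ (natural logarithm), and $\log^+ y=\max(\log y,0)$. Let $\widehat U_\rho=(\mathrm{REFL}\otimes I)(U_\rho^\dagger\otimes I)\,\mathrm{SWAP}\,(U_\rho\otimes I)$ be the qubitized block encoding of $\rho$, where $U_\rho$ acts on an ancilla pair $A'B'$, $\mathrm{SWAP}$ exchanges $A'$ and $A$, and $\mathrm{REFL}=2|0\rangle\langle 0|-I$ on $A'B'$. For a unitary $W$ and angles $\omega$, $\theta_0,\dots,\theta_L$, $\phi_0,\dots,\phi_L$, the QPP circuit with $L$ layers is $$V^L(W)=R_z(\omega)R_y(\theta_0)R_z(\phi_0)\prod_{l=1}^{L}G_l\,R_y(\theta_l)R_z(\phi_l),$$ with $G_l=\operatorname{diag}(W^\dagger,I)$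 for odd $l$ and $G_l=\operatorname{diag}(I,W)$ for even $l$, the rotations acting on one additional qubit. An estimator runs $V^L(\widehat U_\rho)$ on $|0\rangle|0\rangle_{A'B'}|\Psi\rangle_{AB}$ (with $|\Psi\rangle$ prepared by one query), measures the single QPP qubit, repeats this a number of times, and computes its output from the outcomes. An estimator with amplitude estimation may, in each repetition, precede the measurement by a number of Grover iterations of this circuit (flagged by the QPP qubit) that depends on the earlier outcomes. The cost is the total number of uses of $U_\rho$ and $U_\rho^\dagger$, in the worst case over the outcomes. **Statement.** For every $\delta\in(0,1)$ there is a constant $C>0$ that depends only on $\delta$, such that the following holds for all $n,n'\ge 0$, $1\le\kappa\le 2^n$, $\alpha\in(0,1)\cup(1,\infty)$, $\varepsilon>0$ and $t>0$. Put $\eta=\dfrac{t^{-1}}{|1-\alpha|}$. 1. There is an estimator without amplitude estimation, chosen from $\delta,n,n',\kappa,\alpha,\varepsilon,t$ alone, which for every $n$-qubit state $\rho$ of rank at most $\kappa$ with $\operatorname{tr}(\rho^\alpha)\ge t$ and every purified query oracle of $\rho$ outputs, with probability at least $1-\delta$, a number within $\varepsilon$ of $S_\alpha(\rho)$, and whose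 number of queries is at most $C$ times $$\begin{cases}\dfrac{2^{12/\alpha}\kappa^{3/\alpha-2}}{\alpha\,\varepsilon^{3/\alpha}}\Big[3+\log^+\dfrac{t\kappa}{|1-\alpha|\varepsilon}\Big]\eta^{3/\alpha}, & \alpha\in(0,1),\\[2ex] \dfrac{\kappa}{\varepsilon^3}\Big(\log^+\dfrac{t^{-1}\kappa}{|1-\alpha|\varepsilon}\Big)^2\Big[\dfrac{\alpha^2\varepsilon}{2\kappa}+\log^+\dfrac{t^{-1}\kappa}{|1-\alpha|\varepsilon}\,\log^+\dfrac{t^{-1}}{|1-\alpha|\varepsilon}\Big]\eta^3, & \alpha\in(1,\infty).\end{cases}$$ 2. There is an estimator with amplitude estimation with the same guarantee whose number of queries is at most $C$ times $$\begin{cases}\dfrac{2^{8/\alpha}\kappa^{2/\alpha-1}}{\alpha\,\varepsilon^{2/\alpha}}\Big[3+\log^+\dfrac{t\kappa}{|1-\alpha|\varepsilon}\Big]\eta^{2/\alpha}, & \alpha\in(0,1),\\[2ex] \dfrac{\kappa}{\varepsilon^2}\log^+\dfrac{t^{-1}\kappa}{|1-\alpha|\varepsilon}\Big[\dfrac{\alpha^2\varepsilon}{2\kappa}+\log^+\dfrac{t^{-1}\kappa}{|1-\alpha|\varepsilon}\,\log^+\dfrac{t^{-1}}{|1-\alpha|\varepsilon}\Big]\eta^2,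 & \alpha\in(1,\infty).\end{cases}$$ In particular, with $t=\operatorname{tr}(\rho^\alpha)$, these are bounds for $\rho$ in terms of $\eta=\operatorname{tr}(\rho^\alpha)^{-1}/|1-\alpha|$. -/

import Mathlib

open Matrix
open scoped Kronecker ComplexOrder

namespace QPP

/-! ### States, purified oracles, Renyi entropy -/

/-- Labels of the computational basis of `n` qubits; the label of `|0…0⟩` is `0`. -/
abbrev Qubits (n : ℕ) : Type := Fin n → Fin 2

/-- Basis labels of a pair of registers `A` (`n` qubits) and `B` (`m` qubits). -/
abbrev RegAB (n m : ℕ) : Type := Qubits n × Qubits m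

/-- Basis labels of the whole circuit: the QPP qubit, the ancilla pair `A'B'` of the block encoding,
and the pair `AB` that holds the purification. -/
abbrev Total (n m : ℕ) : Type := Fin 2 × (RegAB n m × RegAB n m)

/-- A density matrix of `n` qubits. -/
structure IsDensityMatrix {n : ℕ} (ρ : Matrix (Qubits n) (Qubits n) ℂ) : Prop where
  posSemidef : ρ.PosSemidef
  trace_eq_one : ρ.trace = 1

/-- `tr_B |ψ⟩⟨ψ|`. -/
def reducedState {n m : ℕ} (ψ : RegAB n m → ℂ) : Matrix (Qubits n) (Qubits n) ℂ :=
  Matrix.of fun a a' => ∑ b, ψ (a, b) * star (ψ (a', b))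

/-- `U` is a purified query oracle of `ρ`: a unitary such that `U |0⟩_A |0⟩_B` purifies `ρ`. -/
structure IsPurifiedOracle {n m : ℕ} (U : Matrix (RegAB n m) (RegAB n m) ℂ)
    (ρ : Matrix (Qubits n) (Qubits n) ℂ) : Prop where
  unitary : U ∈ Matrix.unitaryGroup (RegAB n m) ℂ
  reduced : reducedState (U *ᵥ Pi.single 0 1) = ρ

/-- `tr(ρ^α)`, the power being taken by functional calculus. -/
noncomputable def traceRpow {n : ℕ} (α : ℝ) (ρ : Matrix (Qubits n) (Qubits n) ℂ) : ℝ :=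
  (cfc (fun x : ℝ => x ^ α) ρ).trace.re

/-- The quantum `α`-Renyi entropy `S_α(ρ) = log tr(ρ^α) / (1 - α)`. -/
noncomputable def renyiEntropy {n : ℕ} (α : ℝ) (ρ : Matrix (Qubits n) (Qubits n) ℂ) : ℝ :=
  1 / (1 - α) * Real.log (traceRpow α ρ)

/-! ### Elementary gates -/

/-- `R_y(θ)`. -/
noncomputable def Ry (θ : ℝ) : Matrix (Fin 2) (Fin 2) ℂ :=
  !![(Real.cos (θ / 2) : ℂ), -(Real.sin (θ / 2) : ℂ);
     (Real.sin (θ / 2) : ℂ), (Real.cos (θ / 2) : ℂ)]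

/-- `R_z(φ)`. -/
noncomputable def Rz (φ : ℝ) : Matrix (Fin 2) (Fin 2) ℂ :=
  !![Complex.exp (-(Complex.I * φ / 2)), 0; 0, Complex.exp (Complex.I * φ / 2)]

/-- The Pauli matrix `Z`. -/
def pauliZ : Matrix (Fin 2) (Fin 2) ℂ := !![1, 0; 0, -1]

/-- The gate that applies `W` when the first qubit is `c` and does nothing otherwise. -/
def controlled {ι : Type} [DecidableEq ι] (c : Fin 2) (W : Matrix ι ι ℂ) :
    Matrix (Fin 2 × ι) (Fin 2 × ι) ℂ :=
  Matrix.diagonal (fun a => if a = c then 1 else 0) ⊗ₖ W +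
    Matrix.diagonal (fun a => if a = c then 0 else 1) ⊗ₖ 1

/-- `2 |0…0⟩⟨0…0| - I`. -/
def reflector (ι : Type) [DecidableEq ι] [Zero ι] : Matrix ι ι ℂ :=
  (2 : ℂ) • Matrix.single 0 0 1 - 1

/-- The gate that swaps the registers `A'` and `A`. -/
def swapGate (n m : ℕ) : Matrix (RegAB n m × RegAB n m) (RegAB n m × RegAB n m) ℂ :=
  Matrix.of fun x y => if x = ((y.2.1, y.1.2), (y.1.1, y.2.2)) then 1 else 0

/-- The reflector on `A'B'`. -/
def reflectorGate (n m : ℕ) : Matrix (RegAB n m × RegAB n m) (RegAB n m × RegAB n m) ℂ :=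
  reflector (RegAB n m) ⊗ₖ 1

/-! ### The qubitized block encoding and the quantum phase processor, as matrices -/

/-- The qubitized block encoding `(REFLECTOR ⊗ I) (U† ⊗ I) SWAP (U ⊗ I)` of `ρ` built from a
purified oracle `U` (and tensored with the identity of `B`). -/
def qubitized {n m : ℕ} (U : Matrix (RegAB n m) (RegAB n m) ℂ) :
    Matrix (RegAB n m × RegAB n m) (RegAB n m × RegAB n m) ℂ :=
  reflectorGate n m * (Uᴴ ⊗ₖ 1) * swapGate n m * (U ⊗ₖ 1)

/-- The quantum phase processor `V^L(W)` with angles `ω`, `θ 0, …, θ L`, `φ 0, …, φ L`: odd layers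
use `diag(W†, I)` and even layers use `diag(I, W)`. -/
noncomputable def processor {ι : Type} [Fintype ι] [DecidableEq ι] (ω : ℝ) (θ φ : ℕ → ℝ)
    (W : Matrix ι ι ℂ) : ℕ → Matrix (Fin 2 × ι) (Fin 2 × ι) ℂ
  | 0 => (Rz ω * Ry (θ 0) * Rz (φ 0)) ⊗ₖ 1
  | l + 1 => processor ω θ φ W l *
      (if Odd (l + 1) then controlled 0 Wᴴ else controlled 1 W) *
      ((Ry (θ (l + 1)) * Rz (φ (l + 1))) ⊗ₖ 1)

/-! ### Circuits with oracle queries -/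

/-- A gate is a matrix that does not refer to the oracle, or one query to the oracle `U` (to `U†` if
`inverse`) on the pair `AB` (if `onSystem`) or on the pair `A'B'`. -/
inductive Gate (n m : ℕ) : Type
  | free (G : Matrix (Total n m) (Total n m) ℂ) : Gate n m
  | query (onSystem inverse : Bool) : Gate n m

/-- A circuit; the first gate of the list acts first. -/
abbrev Circuit (n m : ℕ) : Type := List (Gate n m)

/-- The matrix of a gate once the oracle is `U`. -/
def Gate.eval {n m : ℕ} (U : Matrix (RegAB n m) (RegAB n m) ℂ) :
    Gate n m → Matrix (Total n m) (Total n m) ℂ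
  | .free G => G
  | .query onSystem inverse =>
      let W := if inverse then Uᴴ else U
      (1 : Matrix (Fin 2) (Fin 2) ℂ) ⊗ₖ (if onSystem then 1 ⊗ₖ W else W ⊗ₖ 1)

/-- The inverse of a (unitary) gate. -/
def Gate.inv {n m : ℕ} : Gate n m → Gate n m
  | .free G => .free Gᴴ
  | .query onSystem inverse => .query onSystem (!inverse)

/-- The number of queries made by a gate. -/
def Gate.queries {n m : ℕ} : Gate n m → ℕ
  | .free _ => 0
  | .query _ _ => 1

namespace Circuit

/-- The matrix of a circuit once the oracle is `U`. -/
def eval {n m : ℕ} (U : Matrix (RegAB n m) (RegAB n m) ℂ) :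
    Circuit n m → Matrix (Total n m) (Total n m) ℂ
  | [] => 1
  | g :: c => eval U c * g.eval U

/-- The inverse circuit. -/
def inv {n m : ℕ} (c : Circuit n m) : Circuit n m := (c.map Gate.inv).reverse

/-- The number of queries to the oracle and its inverse. -/
def queries {n m : ℕ} (c : Circuit n m) : ℕ := (c.map Gate.queries).sum

/-- The probability that measuring the first qubit in the computational basis yields `b` after the
circuit has been run on `|0…0⟩`. -/
noncomputable def firstQubitProb {n m : ℕ} (U : Matrix (RegAB n m) (RegAB n m) ℂ)
    (c : Circuit n m) (b : Fin 2) : ℝ :=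
  ∑ x, ‖(eval U c *ᵥ Pi.single 0 1) (b, x)‖ ^ 2

/-- A rotation of the first qubit. -/
def rotation (n m : ℕ) (R : Matrix (Fin 2) (Fin 2) ℂ) : Gate n m := .free (R ⊗ₖ 1)

/-- `diag(I, Û)` where `Û` is the qubitized block encoding: it suffices to control the swap and the
reflector. -/
def controlledQubitized (n m : ℕ) : Circuit n m :=
  [.query false false, .free (controlled 1 (swapGate n m)),
    .query false true, .free (controlled 1 (reflectorGate n m))]

/-- `diag(Û†, I)`. -/
def controlledQubitizedInv (n m : ℕ) : Circuit n m :=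
  [.free (controlled 0 (reflectorGate n m)), .query false false,
    .free (controlled 0 (swapGate n m)), .query false true]

/-- The QPP circuit `V^L(Û)` (see `eval_qpp`). -/
noncomputable def qpp (n m : ℕ) (ω : ℝ) (θ φ : ℕ → ℝ) : ℕ → Circuit n m
  | 0 => [rotation n m (Rz ω * Ry (θ 0) * Rz (φ 0))]
  | l + 1 => [rotation n m (Ry (θ (l + 1)) * Rz (φ (l + 1)))] ++
      (if Odd (l + 1) then controlledQubitizedInv n m else controlledQubitized n m) ++
      qpp n m ω θ φ l

/-- The QPP circuit run on the purification: one query on `AB` prepares `|Ψ_ρ⟩`, then `V^L(Û)` is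
applied to the QPP qubit, `A'B'` and `A`. -/
noncomputable def qppOnPurification (n m : ℕ) (ω : ℝ) (θ φ : ℕ → ℝ) (L : ℕ) : Circuit n m :=
  .query true false :: qpp n m ω θ φ L

/-- `Q^k 𝒜` where `Q = 𝒜 (2 |0⟩⟨0| - I) 𝒜† Z` is the Grover iterate of amplitude estimation for the
circuit `𝒜` and the flag "the first qubit is `1`". -/
def grover {n m : ℕ} (c : Circuit n m) : ℕ → Circuit n m
  | 0 => c
  | k + 1 => grover c k ++
      (.free (pauliZ ⊗ₖ 1) :: (inv c ++ (.free (reflector (Total n m)) :: c)))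

end Circuit

/-! ### Estimators -/

/-- An estimator that uses one QPP circuit `V^L(Û)`. In each of `rounds` rounds it runs the QPP circuit
amplified by a number of Grover iterations that may depend on the outcomes so far, and measures the
single QPP qubit; in the end it computes its output from the outcomes. Nothing in it refers to the
oracle or to the state. -/
structure Estimator (n m : ℕ) where
  layers : ℕ
  ω : ℝ
  θ : ℕ → ℝ
  φ : ℕ → ℝ
  rounds : ℕ
  iterations : List (Fin 2) → ℕ
  output : (Fin rounds → Fin 2) → ℝ

namespace Estimator

variable {n m : ℕ} (E : Estimator n m)

/-- The estimator only repeats the QPP circuit itself, without amplitude estimation. -/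
def IsPlain : Prop := ∀ h, E.iterations h = 0

/-- The circuit that is run in round `i` if the outcomes are `s`. -/
noncomputable def roundCircuit (s : Fin E.rounds → Fin 2) (i : Fin E.rounds) : Circuit n m :=
  (Circuit.qppOnPurification n m E.ω E.θ E.φ E.layers).grover
    (E.iterations ((List.ofFn s).take i))

/-- The number of queries to the oracle and its inverse in all rounds if the outcomes are `s`. -/
noncomputable def queries (s : Fin E.rounds → Fin 2) : ℕ :=
  ∑ i, (E.roundCircuit s i).queries

/-- The probability of the outcomes `s` when the oracle is `U`. -/
noncomputable def prob (U : Matrix (RegAB n m) (RegAB n m) ℂ) (s : Fin E.rounds → Fin 2) : ℝ :=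
  ∏ i, (E.roundCircuit s i).firstQubitProb U (s i)

open Classical in
/-- The probability that the output is within `ε` of `v` when the oracle is `U`. -/
noncomputable def successProb (U : Matrix (RegAB n m) (RegAB n m) ℂ) (v ε : ℝ) : ℝ :=
  ∑ s with |E.output s - v| ≤ ε, E.prob U s

/-- The estimator estimates `S_α(ρ)` to precision `ε` with probability at least `1 - δ`, for all states
`ρ` of rank at most `κ` with `tr(ρ^α) ≥ t`, given any purified oracle of `ρ`. -/
def EstimatesRenyi (α ε δ : ℝ) (κ : ℕ) (t : ℝ) : Prop :=
  ∀ (ρ : Matrix (Qubits n) (Qubits n) ℂ) (U : Matrix (RegAB n m) (RegAB n m) ℂ),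
    IsDensityMatrix ρ → ρ.rank ≤ κ → t ≤ traceRpow α ρ → IsPurifiedOracle U ρ →
      1 - δ ≤ E.successProb U (renyiEntropy α ρ) ε

end Estimator

/-! ### The bounds; `t` stands for `tr(ρ^α)` and `Real.posLog y = max (log y) 0` -/

/-- `η = t⁻¹ / |1 - α|`. -/
noncomputable def eta (α t : ℝ) : ℝ := t⁻¹ / |1 - α|

/-- The bound for repeated measurement. -/
noncomputable def plainBound (α ε : ℝ) (κ : ℕ) (t : ℝ) : ℝ :=
  if α < 1 then
    2 ^ (12 / α) * (κ : ℝ) ^ (3 / α - 2) / (α * ε ^ (3 / α)) *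
      (3 + Real.posLog (t * κ / (|1 - α| * ε))) * eta α t ^ (3 / α)
  else
    κ / ε ^ 3 * Real.posLog (t⁻¹ * κ / (|1 - α| * ε)) ^ 2 *
      (α ^ 2 * ε / (2 * κ) +
        Real.posLog (t⁻¹ * κ / (|1 - α| * ε)) * Real.posLog (t⁻¹ / (|1 - α| * ε))) *
      eta α t ^ 3

/-- The bound for amplitude estimation. -/
noncomputable def amplitudeBound (α ε : ℝ) (κ : ℕ) (t : ℝ) : ℝ :=
  if α < 1 then
    2 ^ (8 / α) * (κ : ℝ) ^ (2 / α - 1) / (α * ε ^ (2 / α)) *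
      (3 + Real.posLog (t * κ / (|1 - α| * ε))) * eta α t ^ (2 / α)
  else
    κ / ε ^ 2 * Real.posLog (t⁻¹ * κ / (|1 - α| * ε)) *
      (α ^ 2 * ε / (2 * κ) +
        Real.posLog (t⁻¹ * κ / (|1 - α| * ε)) * Real.posLog (t⁻¹ / (|1 - α| * ε))) *
      eta α t ^ 2

/-! ### The circuits mean what they should -/

lemma controlled_mul {ι : Type} [Fintype ι] [DecidableEq ι] (c : Fin 2) (W W' : Matrix ι ι ℂ) :
    controlled c (W * W') = controlled c W * controlled c W' := by
  have h1 : (Matrix.diagonal (fun a : Fin 2 => if a = c then (1 : ℂ) else 0)) *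
      Matrix.diagonal (fun a : Fin 2 => if a = c then (1 : ℂ) else 0) =
      Matrix.diagonal (fun a : Fin 2 => if a = c then (1 : ℂ) else 0) := by
    simp [Matrix.diagonal_mul_diagonal]
  have h2 : (Matrix.diagonal (fun a : Fin 2 => if a = c then (0 : ℂ) else 1)) *
      Matrix.diagonal (fun a : Fin 2 => if a = c then (0 : ℂ) else 1) =
      Matrix.diagonal (fun a : Fin 2 => if a = c then (0 : ℂ) else 1) := by
    simp [Matrix.diagonal_mul_diagonal]
  have h3 : (Matrix.diagonal (fun a : Fin 2 => if a = c then (1 : ℂ) else 0)) *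
      Matrix.diagonal (fun a : Fin 2 => if a = c then (0 : ℂ) else 1) = 0 := by
    rw [Matrix.diagonal_mul_diagonal]; ext i j; by_cases h : i = j <;> simp [h]
  have h4 : (Matrix.diagonal (fun a : Fin 2 => if a = c then (0 : ℂ) else 1)) *
      Matrix.diagonal (fun a : Fin 2 => if a = c then (1 : ℂ) else 0) = 0 := by
    rw [Matrix.diagonal_mul_diagonal]; ext i j; by_cases h : i = j <;> simp [h]
  simp only [controlled, Matrix.add_mul, Matrix.mul_add, ← Matrix.mul_kronecker_mul, h1, h2, h3, h4,
    Matrix.zero_kronecker, Matrix.mul_one, add_zero, zero_add]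

lemma controlled_conj {ι : Type} [Fintype ι] [DecidableEq ι] (c : Fin 2) (S W W' : Matrix ι ι ℂ)
    (h : W' * W = 1) :
    (1 ⊗ₖ W') * controlled c S * (1 ⊗ₖ W) = controlled c (W' * S * W) := by
  simp only [controlled, Matrix.add_mul, Matrix.mul_add, ← Matrix.mul_kronecker_mul, Matrix.one_mul,
    Matrix.mul_one, h]

namespace Circuit

variable {n m : ℕ}

lemma eval_append (U : Matrix (RegAB n m) (RegAB n m) ℂ) (c d : Circuit n m) :
    eval U (c ++ d) = eval U d * eval U c := by
  induction c with
  | nil => simp [eval]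
  | cons g c ih => simp [eval, ih, Matrix.mul_assoc]

lemma swapGate_conjTranspose : (swapGate n m)ᴴ = swapGate n m := by
  ext ⟨⟨a, b⟩, ⟨c, d⟩⟩ ⟨⟨a', b'⟩, ⟨c', d'⟩⟩
  simp only [swapGate, Matrix.conjTranspose_apply, Matrix.of_apply, Prod.mk.injEq, apply_ite star,
    star_one, star_zero]
  congr 1
  simp only [eq_iff_iff]
  tauto

lemma reflector_conjTranspose (ι : Type) [DecidableEq ι] [Zero ι] :
    (reflector ι)ᴴ = reflector ι := by
  simp [reflector, Matrix.conjTranspose_sub]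

lemma reflectorGate_conjTranspose : (reflectorGate n m)ᴴ = reflectorGate n m := by
  simp [reflectorGate, Matrix.conjTranspose_kronecker, reflector_conjTranspose]

lemma eval_controlledQubitized {U : Matrix (RegAB n m) (RegAB n m) ℂ}
    (hU : U ∈ Matrix.unitaryGroup (RegAB n m) ℂ) :
    eval U (controlledQubitized n m) = controlled 1 (qubitized U) := by
  have h : (Uᴴ ⊗ₖ (1 : Matrix (RegAB n m) (RegAB n m) ℂ)) * (U ⊗ₖ 1) = 1 := by
    rw [← Matrix.mul_kronecker_mul, ← Matrix.star_eq_conjTranspose,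
      Matrix.mem_unitaryGroup_iff'.mp hU]
    simp
  have := controlled_conj 1 (swapGate n m) _ _ h
  simp only [controlledQubitized, eval, Gate.eval, Matrix.one_mul]
  simp only [Bool.false_eq_true, if_false, if_true]
  rw [Matrix.mul_assoc, Matrix.mul_assoc, ← Matrix.mul_assoc (1 ⊗ₖ _), this, ← controlled_mul]
  simp only [qubitized, Matrix.mul_assoc]

lemma eval_controlledQubitizedInv {U : Matrix (RegAB n m) (RegAB n m) ℂ}
    (hU : U ∈ Matrix.unitaryGroup (RegAB n m) ℂ) :
    eval U (controlledQubitizedInv n m) = controlled 0 (qubitized U)ᴴ := by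
  have h : (Uᴴ ⊗ₖ (1 : Matrix (RegAB n m) (RegAB n m) ℂ)) * (U ⊗ₖ 1) = 1 := by
    rw [← Matrix.mul_kronecker_mul, ← Matrix.star_eq_conjTranspose,
      Matrix.mem_unitaryGroup_iff'.mp hU]
    simp
  have := controlled_conj 0 (swapGate n m) _ _ h
  simp only [controlledQubitizedInv, eval, Gate.eval, Matrix.one_mul]
  simp only [Bool.false_eq_true, if_false, if_true]
  rw [this, ← controlled_mul]
  simp only [qubitized, Matrix.conjTranspose_mul, swapGate_conjTranspose,
    reflectorGate_conjTranspose, Matrix.conjTranspose_kronecker, Matrix.conjTranspose_conjTranspose,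
    Matrix.conjTranspose_one, Matrix.mul_assoc]

/-- The QPP circuit implements the quantum phase processor of the qubitized block encoding. -/
theorem eval_qpp {U : Matrix (RegAB n m) (RegAB n m) ℂ}
    (hU : U ∈ Matrix.unitaryGroup (RegAB n m) ℂ) (ω : ℝ) (θ φ : ℕ → ℝ) (L : ℕ) :
    eval U (qpp n m ω θ φ L) = processor ω θ φ (qubitized U) L := by
  induction L with
  | zero => simp [qpp, eval, processor, rotation, Gate.eval]
  | succ l ih =>
    have h : eval U (if Odd (l + 1) then controlledQubitizedInv n m else controlledQubitized n m) =
        if Odd (l + 1) then controlled 0 (qubitized U)ᴴ else controlled 1 (qubitized U) := by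
      split_ifs
      · exact eval_controlledQubitizedInv hU
      · exact eval_controlledQubitized hU
    rw [qpp, eval_append, eval_append, ih, h, processor]
    simp [eval, rotation, Gate.eval, Matrix.mul_assoc]

/-- One run of the QPP circuit on the purification costs `2 L + 1` queries. -/
theorem queries_qppOnPurification (ω : ℝ) (θ φ : ℕ → ℝ) (L : ℕ) :
    (qppOnPurification n m ω θ φ L).queries = 2 * L + 1 := by
  have h : ∀ L, ((qpp n m ω θ φ L).map Gate.queries).sum = 2 * L := by
    intro L
    induction L with
    | zero => simp [qpp, rotation, Gate.queries]
    | succ l ih =>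
      rw [qpp, List.map_append, List.map_append, List.sum_append, List.sum_append, ih]
      split_ifs <;>
        simp [rotation, Gate.queries, controlledQubitized, controlledQubitizedInv] <;> omega
  simp only [qppOnPurification, queries, List.map_cons, List.sum_cons, h, Gate.queries]
  omega

end Circuit

/-- `tr(ρ^α)` is the sum of the powers of the eigenvalues. -/
theorem traceRpow_eq_sum {n : ℕ} (α : ℝ) {ρ : Matrix (Qubits n) (Qubits n) ℂ} (h : ρ.IsHermitian) :
    traceRpow α ρ = ∑ i, h.eigenvalues i ^ α := by
  rw [traceRpow, h.cfc_eq, Matrix.IsHermitian.cfc]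
  simp [Matrix.trace_mul_cycle, Unitary.conjStarAlgAut_apply, Matrix.trace_diagonal]

end QPP

namespace QPP

/-! Quantum signal processing turns polynomials into measurement probabilities. A pair of
polynomials (u, w) with |u|² + |w|² = 1 on the unit circle is peeled one degree at a time, which
reads off the angles of a processor with last row (u, w), up to a power of W†
(`exists_processor_angles`). If f maps [-1, 1] into (0, 1), the Fejér-Riesz theorem
(`exists_conjReflect_mul_self`) writes f(Re z) and 1 - f(Re z) as |u|² and |w|², so the flag block
squares to f((W + W†)/2), with no parity condition on f. For the qubitized block encoding, adjoining
|0⟩ intertwines (W + W†)/2 with ρ ⊗ I (`qubitized_add_mul_adjoinZero`). Hence deg f layers give the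
flag probability tr(ρ f(ρ)) (`exists_qpp_angles`), with angles that depend on f and the degree bound
only, never on the state.

Take f = 1/4 + h/8, where x h(x) approximates B x^α on (0, 1]. Zero eigenvalues contribute nothing,
so tr(ρ h(ρ)) is off from B tr(ρ^α) by at most κ times the uniform error. A relative error of |1 -
α| ε in tr(ρ^α) suffices for the entropy, so the flag probability is needed to precision e = B t |1
- α| ε / 16. With d layers this costs O(d/e²) queries by repeated measurement and O(d/e) by
amplitude estimation (`exists_estimators_of_polynomial`). The latter uses a fixed schedule: the
angle is measured through its odd multiples 4^(j+1) ± 1, and any angle consistent with all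
frequencies is accurate enough (`abs_sub_le_of_cos_close_pow`).

The polynomial h comes from a discrete Fejér-Korovkin operator (`korovkinPoly_eval`): it is an
average, so it preserves ranges, and it moves points by at most π/(d + 2) in the mean. Only the
error weighted by x matters, which tames the singularity of the power at 0. For α > 1 the integer
part of the exponent is an exact monomial, B = 1, and the degree is of order α + κη/ε. For α < 1 the
power is cut off at c = (16κη/ε)^(-1/α) and B = c^(1-α); then e = κc, the degree is of order 1/c,
and the powers of 1/c are the powers in the bound.

In the remaining regimes, where a logarithm in the bound could be small or e could exceed 1, the
entropy is already known to within ε, or no admissible state exists, and a constant output without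
queries is enough. -/

open Polynomial in
/-- `X^N` times the conjugate of `p` on the unit circle. -/
noncomputable def conjReflect (N : ℕ) (p : ℂ[X]) : ℂ[X] := (p.map (starRingEnd ℂ)).reflect N

/-! ### Conjugate reflection and the Fejér-Riesz theorem -/

section Polynomials

open Polynomial

lemma coeff_conjReflect {N k : ℕ} (h : k ≤ N) (p : ℂ[X]) :
    (conjReflect N p).coeff k = star (p.coeff (N - k)) := by
  simp [conjReflect, coeff_reflect, revAt_le h]

lemma conjReflect_mul {M N : ℕ} {p q : ℂ[X]} (hp : p.natDegree ≤ M) (hq : q.natDegree ≤ N) :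
    conjReflect (M + N) (p * q) = conjReflect M p * conjReflect N q := by
  rw [conjReflect, Polynomial.map_mul, reflect_mul] <;> simp [conjReflect, hp, hq]

lemma conjReflect_add (N : ℕ) (p q : ℂ[X]) :
    conjReflect N (p + q) = conjReflect N p + conjReflect N q := by
  simp [conjReflect]

lemma conjReflect_sum {κ : Type*} (N : ℕ) (s : Finset κ) (p : κ → ℂ[X]) :
    conjReflect N (∑ k ∈ s, p k) = ∑ k ∈ s, conjReflect N (p k) := by
  classical
  induction s using Finset.induction_on with
  | empty => simp [conjReflect]
  | insert a s ha ih => rw [Finset.sum_insert ha, Finset.sum_insert ha, conjReflect_add, ih]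

/-- Monomial by monomial, k factors `star W` cancel k of the N factors `W`. Stated in a star algebra
so that it serves both points of the unit circle and unitary matrices. -/
lemma aeval_conjReflect {A : Type*} [Ring A] [StarRing A] [Algebra ℂ A] [StarModule ℂ A] {W : A}
    (hW : W * star W = 1) {N : ℕ} {p : ℂ[X]} (hp : p.natDegree ≤ N) :
    aeval W (conjReflect N p) = W ^ N * star (aeval W p) := by
  have hpow : ∀ k, W ^ k * star W ^ k = 1 := by
    intro k
    induction k with
    | zero => simp
    | succ k ih =>
      rw [pow_succ, pow_succ', mul_assoc, ← mul_assoc W (star W), hW, one_mul, ih]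
  conv_lhs => rw [p.as_sum_range' (N + 1) (by omega)]
  conv_rhs => rw [p.as_sum_range' (N + 1) (by omega)]
  rw [conjReflect_sum, map_sum, map_sum, star_sum, Finset.mul_sum]
  refine Finset.sum_congr rfl fun k hk => ?_
  have hk' : k ≤ N := by simpa [Nat.lt_succ_iff] using hk
  have h1 : conjReflect N (monomial k (p.coeff k)) = C (star (p.coeff k)) * X ^ (N - k) := by
    simp [conjReflect, ← C_mul_X_pow_eq_monomial, revAt_le hk']
  rw [h1, ← C_mul_X_pow_eq_monomial]
  simp only [map_mul, map_pow, aeval_X, aeval_C, Algebra.algebraMap_eq_smul_one, smul_mul_assoc,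
    one_mul, star_smul, star_pow, mul_smul_comm]
  congr 1
  obtain ⟨j, rfl⟩ := Nat.exists_eq_add_of_le' hk'
  rw [Nat.add_sub_cancel, pow_add, mul_assoc, hpow, mul_one]

lemma eval_conjReflect {z : ℂ} (hz : ‖z‖ = 1) {N : ℕ} {p : ℂ[X]} (hp : p.natDegree ≤ N) :
    (conjReflect N p).eval z = z ^ N * star (p.eval z) := by
  have h : z * star z = 1 := by
    rw [Complex.star_def, Complex.mul_conj, Complex.normSq_eq_norm_sq, hz]; simp
  simpa [coe_aeval_eq_eval] using aeval_conjReflect h hp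

/-- Polynomials that agree on the unit circle are equal. -/
lemma eq_of_eval_eq_on_circle {p q : ℂ[X]} (h : ∀ z : ℂ, ‖z‖ = 1 → p.eval z = q.eval z) :
    p = q := by
  refine eq_of_infinite_eval_eq p q (Set.Infinite.mono (s := Metric.sphere (0 : ℂ) 1) ?_ ?_)
  · intro z hz
    exact h z (by simpa using hz)
  · refine IsPreconnected.infinite_of_nontrivial ?_ ⟨1, by simp, -1, by simp, ?_⟩
    · exact isPreconnected_sphere (by simp [Complex.rank_real_complex]) _ _
    · intro h
      have := congrArg Complex.re h
      norm_num at this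

/-- On the circle, a root paired with its mirror image contributes a nonnegative factor times z, so
dividing the pair out keeps the positivity needed for the Fejér-Riesz induction. -/
lemma norm_sub_sq_mul_eq {z : ℂ} (hz : ‖z‖ = 1) (l : ℂ) :
    (z - l) * (1 - star l * z) = (‖z - l‖ ^ 2 : ℝ) * z := by
  have h : z * star z = 1 := by
    rw [Complex.star_def, Complex.mul_conj, Complex.normSq_eq_norm_sq, hz]; simp
  have h2 : ((‖z - l‖ ^ 2 : ℝ) : ℂ) = (z - l) * (star z - star l) := by
    rw [← star_sub, Complex.star_def, Complex.mul_conj, Complex.normSq_eq_norm_sq]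
  rw [h2]
  linear_combination -(z - l) * h

lemma conjReflect_X_sub_C (l : ℂ) : conjReflect 1 (X - C l) = 1 - C (star l) * X := by
  have h1 : (X : ℂ[X]).reflect 1 = 1 := by
    simp
  simp only [conjReflect, Polynomial.map_sub, map_X, map_C, reflect_sub, reflect_C, h1, pow_one]
  rfl

/-- The Fejér-Riesz theorem for positive trigonometric polynomials. -/
theorem exists_conjReflect_mul_self (d : ℕ) (p : ℂ[X]) (hd : p.natDegree ≤ 2 * d)
    (hp : ∀ z : ℂ, ‖z‖ = 1 → ∃ r : ℝ, 0 < r ∧ p.eval z = r * z ^ d) :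
    ∃ q : ℂ[X], q.natDegree ≤ d ∧ conjReflect d q * q = p := by
  induction d generalizing p with
  | zero =>
    obtain ⟨r, hr, hr'⟩ := hp 1 (by simp)
    obtain ⟨a, rfl⟩ : ∃ a, p = C a := ⟨_, eq_C_of_natDegree_le_zero (by simpa using hd)⟩
    simp only [eval_C, one_pow, mul_one] at hr'
    refine ⟨C (Real.sqrt r : ℂ), by simp, ?_⟩
    have h : ((Real.sqrt r : ℝ) : ℂ) * (Real.sqrt r : ℝ) = r := by
      rw [← Complex.ofReal_mul, Real.mul_self_sqrt hr.le]
    rw [conjReflect, map_C, reflect_C, pow_zero, mul_one, ← C_mul, Complex.conj_ofReal, h, hr']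
  | succ d ih =>
    have hp0 : p ≠ 0 := by
      rintro rfl
      obtain ⟨r, hr, h⟩ := hp 1 (by simp)
      simp at h
      exact hr.ne (by exact_mod_cast h)
    -- p(z) / z^(d+1) is real on the circle, so p is its own conjugate reflection and its roots come
    -- in pairs l, 1/conj l.
    have hself : conjReflect (2 * (d + 1)) p = p := by
      refine eq_of_eval_eq_on_circle fun z hz => ?_
      obtain ⟨r, -, h⟩ := hp z hz
      have h1 : z * star z = 1 := by
        rw [Complex.star_def, Complex.mul_conj, Complex.normSq_eq_norm_sq, hz]; simp
      have h2 : z ^ (d + 1) * star z ^ (d + 1) = 1 := by rw [← mul_pow, h1, one_pow]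
      rw [eval_conjReflect hz hd, h, star_mul, star_pow,
        show star (r : ℂ) = r from Complex.conj_ofReal r]
      linear_combination (r : ℂ) * z ^ (d + 1) * h2
    -- A root at 0 is paired with one at infinity: the top coefficient is the conjugate of the
    -- constant one, so it vanishes too and the degree drops by two. Otherwise some nonzero root l
    -- and its mirror image are both divided out.
    obtain ⟨l, s, hs, hs'⟩ : ∃ (l : ℂ) (s : ℂ[X]), p = (X - C l) * (1 - C (star l) * X) * s ∧
        s.natDegree ≤ 2 * d := by
      by_cases h0 : p.coeff 0 = 0
      · obtain ⟨s, rfl⟩ := X_dvd_iff.mpr h0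
        refine ⟨0, s, by simp, ?_⟩
        have hs0 : s ≠ 0 := right_ne_zero_of_mul hp0
        rw [natDegree_X_mul hs0] at hd
        by_contra hlt
        have hdeg : s.natDegree = 2 * d + 1 := by omega
        have h1 := coeff_conjReflect (N := 2 * (d + 1)) le_rfl (X * s)
        rw [hself, Nat.sub_self, h0, star_zero, show 2 * (d + 1) = 2 * d + 1 + 1 by ring,
          coeff_X_mul, ← hdeg] at h1
        exact hs0 (leadingCoeff_eq_zero.mp h1)
      · have hdeg : 0 < p.natDegree := by
          by_contra hlt
          have h1 := coeff_conjReflect (N := 2 * (d + 1)) (Nat.zero_le _) p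
          rw [hself, Nat.sub_zero, coeff_eq_zero_of_natDegree_lt (n := 2 * (d + 1)) (by omega),
            star_zero] at h1
          exact h0 h1
        obtain ⟨l, hl⟩ := Complex.exists_root (natDegree_pos_iff_degree_pos.mp hdeg)
        have hl0 : l ≠ 0 := by
          rintro rfl
          exact h0 (by simpa [coeff_zero_eq_eval_zero] using hl)
        have hl1 : ‖l‖ ≠ 1 := by
          intro h1
          obtain ⟨r, hr, h⟩ := hp l h1
          rw [hl.eq_zero] at h
          exact mul_ne_zero (by exact_mod_cast hr.ne') (pow_ne_zero _ hl0) h.symm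
        have hd1 : (X - C l) ∣ p := dvd_iff_isRoot.mpr hl
        have hd2 : (1 - C (star l) * X) ∣ p := by
          obtain ⟨s, rfl⟩ := hd1
          have hs0 : s ≠ 0 := right_ne_zero_of_mul hp0
          have hsd : s.natDegree ≤ 2 * d + 1 := by
            rw [natDegree_mul (X_sub_C_ne_zero l) hs0, natDegree_X_sub_C] at hd
            omega
          rw [← hself, show 2 * (d + 1) = 1 + (2 * d + 1) by ring,
            conjReflect_mul (natDegree_X_sub_C_le l) hsd, conjReflect_X_sub_C]
          exact dvd_mul_right _ _
        -- Positivity excludes roots on the circle, so l differs from its mirror image and the two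
        -- linear factors are coprime.
        have hcop : IsCoprime (X - C l) (1 - C (star l) * X) := by
          have hne : (1 - star l * l) ≠ 0 := by
            rw [Complex.star_def, ← Complex.normSq_eq_conj_mul_self, Complex.normSq_eq_norm_sq]
            intro h
            have h3 : ‖l‖ ^ 2 = 1 := by exact_mod_cast (sub_eq_zero.mp h).symm
            exact hl1 ((pow_eq_one_iff_of_nonneg (norm_nonneg l) two_ne_zero).mp h3)
          refine ⟨C ((1 - star l * l)⁻¹ * star l), C ((1 - star l * l)⁻¹), ?_⟩
          have h4 : C ((1 - star l * l)⁻¹) * (1 - C (star l) * C l) = 1 := by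
            rw [← C_mul, ← C_1, ← C_sub, ← C_mul, inv_mul_cancel₀ hne]
          rw [C_mul]
          linear_combination h4
        obtain ⟨s, hs⟩ := hcop.mul_dvd hd1 hd2
        refine ⟨l, s, hs, ?_⟩
        have hne2 : (1 - C (star l) * X : ℂ[X]) ≠ 0 := fun h => by
          rw [h, mul_zero, zero_mul] at hs
          exact hp0 hs
        have hs0 : s ≠ 0 := by
          rintro rfl
          exact hp0 (by simpa using hs)
        have hdeg2 : (1 - C (star l) * X : ℂ[X]).natDegree = 1 := by
          have : (1 - C (star l) * X : ℂ[X]) = C (-star l) * X + C 1 := by simp; ring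
          rw [this, natDegree_linear (by simpa using hl0)]
        rw [hs, natDegree_mul (mul_ne_zero (X_sub_C_ne_zero l) hne2) hs0,
          natDegree_mul (X_sub_C_ne_zero l) hne2, natDegree_X_sub_C, hdeg2] at hd
        omega
    obtain ⟨q, hq, hq'⟩ := ih s hs' fun z hz => by
      obtain ⟨r, hr, h⟩ := hp z hz
      have hz0 : z ≠ 0 := by rintro rfl; simp at hz
      rw [hs, eval_mul, eval_mul] at h
      simp only [eval_sub, eval_mul, eval_X, eval_C, eval_one] at h
      rw [norm_sub_sq_mul_eq hz] at h
      have hne : ‖z - l‖ ≠ 0 := by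
        intro h0
        rw [h0] at h
        simp [hr.ne', hz0] at h
      refine ⟨r / ‖z - l‖ ^ 2, by positivity, ?_⟩
      have hne' : ((‖z - l‖ : ℝ) : ℂ) ≠ 0 := by exact_mod_cast hne
      push_cast at h ⊢
      field_simp
      apply mul_left_cancel₀ hz0
      linear_combination h
    refine ⟨(X - C l) * q, (natDegree_mul_le).trans (by rw [natDegree_X_sub_C]; omega), ?_⟩
    rw [add_comm d 1, conjReflect_mul (natDegree_X_sub_C_le l) hq, conjReflect_X_sub_C, hs, ← hq']
    ring

end Polynomials

/-! ### Rotation angles with prescribed matrix entries -/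

section Angles

lemma Ry_mul_Rz_apply (θ φ : ℝ) (a b : ℂ)
    (ha : a = Real.cos (θ / 2) * Complex.exp (-(Complex.I * φ / 2)))
    (hb : b = -(Real.sin (θ / 2) * Complex.exp (Complex.I * φ / 2))) :
    Ry θ * Rz φ = !![a, b; -star b, star a] := by
  have h1 : star (Complex.exp (Complex.I * φ / 2)) = Complex.exp (-(Complex.I * φ / 2)) := by
    rw [Complex.star_def, ← Complex.exp_conj]
    congr 1
    simp [neg_div, Complex.conj_ofNat]
  have h2 : star (Complex.exp (-(Complex.I * φ / 2))) = Complex.exp (Complex.I * φ / 2) := by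
    rw [← h1, star_star]
  have hc : star ((Real.cos (θ / 2) : ℝ) : ℂ) = (Real.cos (θ / 2) : ℝ) := Complex.conj_ofReal _
  have hs : star ((Real.sin (θ / 2) : ℝ) : ℂ) = (Real.sin (θ / 2) : ℝ) := Complex.conj_ofReal _
  rw [ha, hb, star_neg, star_mul', star_mul', h1, h2, hc, hs, neg_neg, Ry, Rz]
  ext i j
  fin_cases i <;> fin_cases j <;> simp [Matrix.mul_apply]

/-- The argument of ‖x‖ - i‖y‖ gives the moduli (the minus sign matches the one in the entry b), and
φ makes up for the phase difference of x and y. Degenerate x, y need no separate case. -/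
lemma exists_angles_mul_eq (x y : ℂ) : ∃ (θ φ : ℝ) (a b : ℂ),
    Ry θ * Rz φ = !![a, b; -star b, star a] ∧ star a * a + star b * b = 1 ∧ b * x = a * y := by
  set p : ℂ := ⟨‖x‖, -‖y‖⟩ with hp
  set φ : ℝ := y.arg - x.arg with hφ
  refine ⟨2 * p.arg, φ, _, _, Ry_mul_Rz_apply _ _ _ _ rfl rfl, ?_, ?_⟩
  · have h1 : ∀ t : ℂ, star t * t = ((‖t‖ ^ 2 : ℝ) : ℂ) := fun t => by
      rw [Complex.star_def, ← Complex.normSq_eq_conj_mul_self, Complex.normSq_eq_norm_sq]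
    have h2 : ‖Complex.exp (-(Complex.I * φ / 2))‖ = 1 := by
      rw [show -(Complex.I * φ / 2) = ((-φ / 2 : ℝ) : ℂ) * Complex.I by push_cast; ring]
      exact Complex.norm_exp_ofReal_mul_I _
    have h3 : ‖Complex.exp (Complex.I * φ / 2)‖ = 1 := by
      rw [show Complex.I * φ / 2 = ((φ / 2 : ℝ) : ℂ) * Complex.I by push_cast; ring]
      exact Complex.norm_exp_ofReal_mul_I _
    rw [h1, h1, norm_neg, norm_mul, norm_mul, h2, h3, Complex.norm_real, Complex.norm_real,
      Real.norm_eq_abs, Real.norm_eq_abs, mul_one, mul_one, sq_abs, sq_abs]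
    exact_mod_cast Real.cos_sq_add_sin_sq _
  · have hre : ‖p‖ * Real.cos p.arg = ‖x‖ := Complex.norm_mul_cos_arg p
    have him : ‖p‖ * Real.sin p.arg = -‖y‖ := Complex.norm_mul_sin_arg p
    have key : -(Real.sin p.arg * ‖x‖) = Real.cos p.arg * ‖y‖ := by
      rw [← hre, ← neg_eq_iff_eq_neg.mpr him]; ring
    rw [show 2 * p.arg / 2 = p.arg by ring]
    have key' : -((Real.sin p.arg : ℂ) * ‖x‖) = Real.cos p.arg * ‖y‖ := by exact_mod_cast key
    have h1 : Complex.exp (Complex.I * φ / 2) * Complex.exp (x.arg * Complex.I) =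
        Complex.exp (-(Complex.I * φ / 2)) * Complex.exp (y.arg * Complex.I) := by
      rw [← Complex.exp_add, ← Complex.exp_add, hφ]
      congr 1
      push_cast
      ring
    conv_lhs => rw [← Complex.norm_mul_exp_arg_mul_I x]
    conv_rhs => rw [← Complex.norm_mul_exp_arg_mul_I y]
    linear_combination (Complex.exp (Complex.I * φ / 2) * Complex.exp (x.arg * Complex.I)) * key' +
      (Real.cos p.arg * ‖y‖) * h1

/-- In ℂ² a rotation that aligns (u₀, w₀) with the first axis sends the orthogonal (u₁, w₁) to the
second. If the first vector vanishes, the second one determines the rotation instead. -/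
lemma exists_angles_of_orthogonal (u₀ w₀ u₁ w₁ : ℂ) (h : star u₁ * u₀ + star w₁ * w₀ = 0) :
    ∃ (θ φ : ℝ) (a b : ℂ), Ry θ * Rz φ = !![a, b; -star b, star a] ∧
      star a * a + star b * b = 1 ∧ star a * u₁ + star b * w₁ = 0 ∧ -b * u₀ + a * w₀ = 0 := by
  by_cases h0 : u₀ = 0 ∧ w₀ = 0
  · obtain ⟨θ, φ, a, b, h1, h2, h3⟩ := exists_angles_mul_eq (star w₁) (-star u₁)
    refine ⟨θ, φ, a, b, h1, h2, ?_, by rw [h0.1, h0.2]; simp⟩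
    have h4 := congrArg star h3
    simp only [star_mul', star_neg, star_star] at h4
    linear_combination h4
  · obtain ⟨θ, φ, a, b, h1, h2, h3⟩ := exists_angles_mul_eq u₀ w₀
    refine ⟨θ, φ, a, b, h1, h2, ?_, by linear_combination -h3⟩
    have h5 : star a * u₀ + star b * w₀ ≠ 0 := by
      intro h6
      exact h0 ⟨by linear_combination a * h6 - u₀ * h2 + star b * h3,
        by linear_combination b * h6 - w₀ * h2 - star a * h3⟩
    have h7 : (star a * u₀ + star b * w₀) * (star u₁ * a + star w₁ * b) = 0 := by
      linear_combination h + (star u₁ * u₀ + star w₁ * w₀) * h2 +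
        (star w₁ * star a - star u₁ * star b) * h3
    have h8 := congrArg star ((mul_eq_zero.mp h7).resolve_left h5)
    simp only [star_add, star_mul', star_star, star_zero] at h8
    linear_combination h8

lemma exists_angles_last_row (u w : ℂ) (h : star u * u + star w * w = 1) :
    ∃ ω θ φ : ℝ, (Rz ω * Ry θ * Rz φ) 1 0 = u ∧ (Rz ω * Ry θ * Rz φ) 1 1 = w := by
  have h1 : ∀ t : ℂ, star t * t = ((‖t‖ ^ 2 : ℝ) : ℂ) := fun t => by
    rw [Complex.star_def, ← Complex.normSq_eq_conj_mul_self, Complex.normSq_eq_norm_sq]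
  rw [h1, h1] at h
  have h2 : ‖u‖ ^ 2 + ‖w‖ ^ 2 = 1 := by exact_mod_cast h
  have hs : Real.sin (Real.arcsin ‖u‖) = ‖u‖ := by
    apply Real.sin_arcsin <;> nlinarith [norm_nonneg u, sq_nonneg ‖w‖]
  have hc : Real.cos (Real.arcsin ‖u‖) = ‖w‖ := by
    rw [Real.cos_arcsin, show 1 - ‖u‖ ^ 2 = ‖w‖ ^ 2 by linarith, Real.sqrt_sq (norm_nonneg _)]
  refine ⟨u.arg + w.arg, 2 * Real.arcsin ‖u‖, w.arg - u.arg, ?_, ?_⟩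
  · simp only [Rz, Ry, Matrix.mul_apply, Fin.sum_univ_two]
    simp [-Complex.ofReal_sin, -Complex.ofReal_cos]
    rw [hs]
    conv_rhs => rw [← Complex.norm_mul_exp_arg_mul_I u]
    rw [mul_comm (Complex.exp _), mul_assoc, ← Complex.exp_add]
    congr 2
    ring
  · simp only [Rz, Ry, Matrix.mul_apply, Fin.sum_univ_two]
    simp [-Complex.ofReal_sin, -Complex.ofReal_cos]
    rw [hc]
    conv_rhs => rw [← Complex.norm_mul_exp_arg_mul_I w]
    rw [mul_comm (Complex.exp _), mul_assoc, ← Complex.exp_add]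
    congr 2
    ring

end Angles

/-! ### Quantum signal processing: angles from a pair of polynomials -/

section Processor

open Polynomial

variable {ι : Type}

lemma processor_congr [Fintype ι] [DecidableEq ι] {ω : ℝ} {θ θ' φ φ' : ℕ → ℝ} (W : Matrix ι ι ℂ) {L : ℕ}
    (h : ∀ l ≤ L, θ l = θ' l ∧ φ l = φ' l) : processor ω θ φ W L = processor ω θ' φ' W L := by
  induction L with
  | zero => simp [processor, h]
  | succ l ih =>
    rw [processor, processor, ih fun k hk => h k (by omega), (h (l + 1) le_rfl).1,
      (h (l + 1) le_rfl).2]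

/-- The block of a matrix on a qubit and another register. -/
def block (a b : Fin 2) (M : Matrix (Fin 2 × ι) (Fin 2 × ι) ℂ) : Matrix ι ι ℂ :=
  Matrix.of fun i j => M (a, i) (b, j)

lemma block_mul [Fintype ι] (a b : Fin 2) (M N : Matrix (Fin 2 × ι) (Fin 2 × ι) ℂ) :
    block a b (M * N) = block a 0 M * block 0 b N + block a 1 M * block 1 b N := by
  ext i j
  simp [block, Matrix.mul_apply, Fintype.sum_prod_type]

lemma block_kronecker_one [DecidableEq ι] (a b : Fin 2) (R : Matrix (Fin 2) (Fin 2) ℂ) :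
    block a b (R ⊗ₖ (1 : Matrix ι ι ℂ)) = R a b • (1 : Matrix ι ι ℂ) := by
  ext i j
  simp [block]

lemma block_controlled [DecidableEq ι] (a b c : Fin 2) (W : Matrix ι ι ℂ) :
    block a b (controlled c W) = if a = b then (if a = c then W else 1) else 0 := by
  ext i j
  by_cases h : a = b <;> by_cases h' : a = c <;> simp_all [block, controlled]

/-- Quantum signal processing: the last row of the phase processor can be any normalized pair of
polynomials. -/
theorem exists_processor_angles (L : ℕ) (u w : ℂ[X]) (hu : u.natDegree ≤ L) (hw : w.natDegree ≤ L)
    (h : conjReflect L u * u + conjReflect L w * w = X ^ L) :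
    ∃ (ω : ℝ) (θ φ : ℕ → ℝ), ∀ {ι : Type} [Fintype ι] [DecidableEq ι] (W : Matrix ι ι ℂ),
      W ∈ Matrix.unitaryGroup ι ℂ →
        block 1 0 (processor ω θ φ W L) = aeval W u * Wᴴ ^ ((L + 1) / 2) ∧
        block 1 1 (processor ω θ φ W L) = aeval W w * Wᴴ ^ ((L + 1) / 2) := by
  induction L generalizing u w with
  | zero =>
    obtain ⟨x, rfl⟩ : ∃ x, u = C x := ⟨_, eq_C_of_natDegree_le_zero hu⟩
    obtain ⟨y, rfl⟩ : ∃ y, w = C y := ⟨_, eq_C_of_natDegree_le_zero hw⟩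
    obtain ⟨ω, θ, φ, h1, h2⟩ := exists_angles_last_row x y (by
      have h0 := congrArg (eval 1) h
      simpa [conjReflect, reflect_C] using h0)
    refine ⟨ω, fun _ => θ, fun _ => φ, fun {ι} _ _ W _ => ?_⟩
    simp [processor, block_kronecker_one, h1, h2, Algebra.algebraMap_eq_smul_one]
  | succ L ih =>
    -- The constant coefficient of the normalization says that the vectors of constant and of top
    -- coefficients are orthogonal. One rotation therefore kills the top coefficient of the first
    -- polynomial and the constant coefficient of the second, and X can be split off from the
    -- latter.
    obtain ⟨θ', φ', a, b, hR, hab, htop, hbot⟩ := exists_angles_of_orthogonal (u.coeff 0)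
      (w.coeff 0) (u.coeff (L + 1)) (w.coeff (L + 1)) (by
        have h0 := congrArg (fun p => coeff p 0) h
        simpa [mul_coeff_zero, coeff_conjReflect, coeff_X_pow] using h0)
    have hab' : C (star a) * C a + C (star b) * C b = (1 : ℂ[X]) := by
      rw [← C_mul, ← C_mul, ← C_add, hab, C_1]
    have hv0 : (C (-b) * u + C a * w).coeff 0 = 0 := by simpa using hbot
    obtain ⟨w', hw'⟩ := X_dvd_iff.mpr hv0
    set u' := C (star a) * u + C (star b) * w with hu'
    have hconj : ∀ x y : ℂ, conjReflect (L + 1) (C x * u + C y * w) =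
        C (star x) * conjReflect (L + 1) u + C (star y) * conjReflect (L + 1) w := by
      intro x y
      simp [conjReflect, reflect_C_mul]
    have hdeg : ∀ x y : ℂ, (C x * u + C y * w).natDegree ≤ L + 1 := fun x y =>
      natDegree_add_le_of_degree_le ((natDegree_C_mul_le _ _).trans hu)
        ((natDegree_C_mul_le _ _).trans hw)
    have hu'd : u'.natDegree ≤ L := by
      have h1 : u'.natDegree ≤ L + 1 := hdeg _ _
      rcases Nat.lt_or_ge u'.natDegree (L + 1) with h2 | h2
      · omega
      · have h3 : u'.natDegree = L + 1 := le_antisymm h1 h2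
        have h4 : u'.leadingCoeff = 0 := by
          rw [leadingCoeff, h3]
          simpa [hu'] using htop
        rw [leadingCoeff_eq_zero.mp h4] at h3
        simp at h3
    have hw'd : w'.natDegree ≤ L := by
      by_cases h0 : w' = 0
      · simp [h0]
      · have h1 := hdeg (-b) a
        rw [hw', natDegree_X_mul h0] at h1
        omega
    obtain ⟨ω, θ, φ, hang⟩ := ih u' w' hu'd hw'd (by
      have e1 : conjReflect (L + 1) u' = X * conjReflect L u' := by
        have : conjReflect (1 + L) (1 * u') = conjReflect 1 1 * conjReflect L u' :=
          conjReflect_mul (by simp) hu'd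
        rw [one_mul, add_comm] at this
        rw [this]
        congr 1
        rw [conjReflect, ← C_1, map_C, reflect_C]
        simp
      have e2 : conjReflect (L + 1) (X * w') = conjReflect L w' := by
        rw [add_comm, conjReflect_mul (by simp) hw'd]
        simp [conjReflect]
      apply mul_left_cancel₀ (X_ne_zero (R := ℂ))
      have e3 : conjReflect (L + 1) u' * u' + conjReflect (L + 1) (X * w') * (X * w') =
          X ^ (L + 1) := by
        rw [← h, ← hw', hconj, hu', hconj]
        simp only [star_star, star_neg, C_neg]
        linear_combination
          (conjReflect (L + 1) u * u + conjReflect (L + 1) w * w) * hab'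
      rw [e1, e2] at e3
      rw [pow_succ'] at e3
      linear_combination e3)
    refine ⟨ω, Function.update θ (L + 1) θ', Function.update φ (L + 1) φ', fun {ι} _ _ W hW => ?_⟩
    obtain ⟨h1, h2⟩ := hang W hW
    have hWW : W * Wᴴ = 1 := Matrix.mem_unitaryGroup_iff.mp hW
    have hWW' : Wᴴ * W = 1 := Matrix.mem_unitaryGroup_iff'.mp hW
    have hcomm : Commute W Wᴴ := by rw [Commute, SemiconjBy, hWW, hWW']
    have hcw : ∀ p : ℂ[X], Commute W (aeval W p) := fun p => by
      simpa using (Commute.all X p).map (aeval W)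
    have hprev : processor ω (Function.update θ (L + 1) θ') (Function.update φ (L + 1) φ') W L =
        processor ω θ φ W L := processor_congr W fun l hl => by
      simp [Function.update_of_ne (show l ≠ L + 1 by omega)]
    -- An odd layer multiplies the first entry by W†, an even one the second by W. Both turn (u',
    -- w') into (u', X w') once the odd layers are accounted for by the power of W†, whose exponent
    -- (L + 1) / 2 counts them.
    have hlayer : block 1 0 (processor ω θ φ W L *
          (if Odd (L + 1) then controlled 0 Wᴴ else controlled 1 W)) =
          aeval W u' * Wᴴ ^ ((L + 1 + 1) / 2) ∧
        block 1 1 (processor ω θ φ W L *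
          (if Odd (L + 1) then controlled 0 Wᴴ else controlled 1 W)) =
          aeval W (X * w') * Wᴴ ^ ((L + 1 + 1) / 2) := by
      simp only [block_mul, h1, h2]
      by_cases hodd : Odd (L + 1)
      · have hdiv : (L + 1 + 1) / 2 = (L + 1) / 2 + 1 := by
          obtain ⟨k, hk⟩ := hodd
          omega
        simp [hodd, block_controlled, hdiv, pow_succ', mul_assoc]
        refine ⟨by rw [← pow_succ, ← pow_succ'], ?_⟩
        rw [← mul_assoc W, (hcw w').eq, mul_assoc, ← mul_assoc W, hWW, one_mul]
      · have hdiv : (L + 1 + 1) / 2 = (L + 1) / 2 := by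
          obtain ⟨k, hk⟩ := Nat.not_odd_iff_even.mp hodd
          omega
        simp [hodd, block_controlled, hdiv]
        rw [(hcw w').eq, mul_assoc, mul_assoc, (hcomm.pow_right _).eq]
    have hu_eq : u = C a * u' + C (-star b) * (X * w') := by
      rw [← hw', hu', C_neg, C_neg]
      linear_combination -u * hab'
    have hw_eq : w = C b * u' + C (star a) * (X * w') := by
      rw [← hw', hu', C_neg]
      linear_combination -w * hab'
    rw [processor, hprev, Function.update_self, Function.update_self, hR]
    constructor
    · rw [block_mul, hlayer.1, hlayer.2, block_kronecker_one, block_kronecker_one]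
      conv_rhs => rw [hu_eq]
      simp [Algebra.algebraMap_eq_smul_one, add_mul]
    · rw [block_mul, hlayer.1, hlayer.2, block_kronecker_one, block_kronecker_one]
      conv_rhs => rw [hw_eq]
      simp [Algebra.algebraMap_eq_smul_one, add_mul]

end Processor

/-! ### From trigonometric polynomials to polynomials of the cosine -/

section CosineSubstitution

open Polynomial

/-- `X^d f((X + X⁻¹) / 2)`. -/
noncomputable def joukowsky (d : ℕ) (f : ℂ[X]) : ℂ[X] :=
  ∑ k ∈ Finset.range (d + 1), C (f.coeff k) * ((C (1 / 2) * (X ^ 2 + 1)) ^ k * X ^ (d - k))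

lemma natDegree_joukowsky_le (d : ℕ) (f : ℂ[X]) : (joukowsky d f).natDegree ≤ 2 * d := by
  refine natDegree_sum_le_of_forall_le _ _ fun k hk => ?_
  have hk' : k ≤ d := by simpa [Nat.lt_succ_iff] using hk
  have h1 : (C (1 / 2 : ℂ) * (X ^ 2 + 1)).natDegree ≤ 2 :=
    (natDegree_C_mul_le _ _).trans (by compute_degree)
  have h2 : ((C (1 / 2 : ℂ) * (X ^ 2 + 1)) ^ k).natDegree ≤ k * 2 := natDegree_pow_le_of_le k h1
  refine (natDegree_C_mul_le _ _).trans (natDegree_mul_le.trans ?_)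
  rw [natDegree_X_pow]
  omega

/-- At W, the polynomial (X² + 1)/2 becomes ((W + W*)/2) W, and W commutes with W*, so the powers of
W collect to the same exponent d in each term. -/
lemma aeval_joukowsky {A : Type*} [Ring A] [StarRing A] [Algebra ℂ A] {W : A}
    (hW : W * star W = 1) (hW' : star W * W = 1) {d : ℕ} {f : ℂ[X]} (hf : f.natDegree ≤ d) :
    aeval W (joukowsky d f) = aeval ((1 / 2 : ℂ) • (W + star W)) f * W ^ d := by
  conv_rhs => rw [aeval_eq_sum_range' (show f.natDegree < d + 1 by omega)]
  rw [joukowsky, map_sum, Finset.sum_mul]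
  refine Finset.sum_congr rfl fun k hk => ?_
  have hk' : k ≤ d := by simpa [Nat.lt_succ_iff] using hk
  obtain ⟨j, rfl⟩ := Nat.exists_eq_add_of_le hk'
  have hc : Commute W (star W) := by rw [Commute, SemiconjBy, hW, hW']
  have h1 : (1 / 2 : ℂ) • (W ^ 2 + 1) = ((1 / 2 : ℂ) • (W + star W)) * W := by
    rw [smul_mul_assoc, add_mul, hW', sq]
  have h2 : Commute ((1 / 2 : ℂ) • (W + star W)) W :=
    (((Commute.refl W).add_right hc).smul_right _).symm
  simp only [map_mul, map_pow, aeval_X, aeval_C, map_add, map_one, Nat.add_sub_cancel_left,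
    Algebra.algebraMap_eq_smul_one, smul_mul_assoc, one_mul]
  rw [h1, h2.mul_pow, mul_assoc, pow_add]

/-- For |z| = 1 the mean of z and its inverse is Re z. The result is a real number times z^d, the
shape that the Fejér-Riesz theorem asks for. -/
lemma eval_joukowsky {z : ℂ} (hz : ‖z‖ = 1) {d : ℕ} {f : ℝ[X]} (hf : f.natDegree ≤ d) :
    (joukowsky d (f.map (algebraMap ℝ ℂ))).eval z = (f.eval z.re : ℝ) * z ^ d := by
  have h : z * star z = 1 := by
    rw [Complex.star_def, Complex.mul_conj, Complex.normSq_eq_norm_sq, hz]; simp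
  have h1 : (1 / 2 : ℂ) • (z + star z) = (z.re : ℝ) := by
    rw [Complex.star_def, Complex.add_conj, smul_eq_mul]; push_cast; ring
  have h2 := aeval_joukowsky h (by rw [mul_comm]; exact h) (f := f.map (algebraMap ℝ ℂ)) (d := d)
    ((natDegree_map_le).trans hf)
  rw [coe_aeval_eq_eval, h1, aeval_map_algebraMap] at h2
  rw [h2]
  congr 1
  exact aeval_algebraMap_apply_eq_algebraMap_eval z.re f

/-- The flag probability of the phase processor can be any polynomial of the cosine of the
eigenphase. -/
theorem exists_processor_angles_of_polynomial (d : ℕ) (f : ℝ[X]) (hd : f.natDegree ≤ d)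
    (hf : ∀ x ∈ Set.Icc (-1 : ℝ) 1, 0 < f.eval x ∧ f.eval x < 1) :
    ∃ (ω : ℝ) (θ φ : ℕ → ℝ), ∀ {ι : Type} [Fintype ι] [DecidableEq ι] (W : Matrix ι ι ℂ),
      W ∈ Matrix.unitaryGroup ι ℂ →
        (block 1 0 (processor ω θ φ W d))ᴴ * block 1 0 (processor ω θ φ W d) =
          aeval ((1 / 2 : ℂ) • (W + Wᴴ)) (f.map (algebraMap ℝ ℂ)) := by
  have hre : ∀ z : ℂ, ‖z‖ = 1 → z.re ∈ Set.Icc (-1 : ℝ) 1 := fun z hz =>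
    abs_le.mp ((Complex.abs_re_le_norm z).trans hz.le)
  have hd' : (1 - f).natDegree ≤ d := (natDegree_sub_le _ _).trans (by simp [hd])
  obtain ⟨u, hu, hu'⟩ := exists_conjReflect_mul_self d (joukowsky d (f.map (algebraMap ℝ ℂ)))
    (natDegree_joukowsky_le _ _) fun z hz => ⟨_, (hf _ (hre z hz)).1, eval_joukowsky hz hd⟩
  obtain ⟨w, hw, hw'⟩ := exists_conjReflect_mul_self d
    (joukowsky d ((1 - f).map (algebraMap ℝ ℂ))) (natDegree_joukowsky_le _ _) fun z hz =>
    ⟨(1 - f).eval z.re, by simpa using (hf _ (hre z hz)).2, eval_joukowsky hz hd'⟩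
  obtain ⟨ω, θ, φ, h⟩ := exists_processor_angles d u w hu hw <| by
    rw [hu', hw']
    refine eq_of_eval_eq_on_circle fun z hz => ?_
    rw [eval_add, eval_joukowsky hz hd, eval_joukowsky hz hd']
    simp
    ring
  refine ⟨ω, θ, φ, fun {ι} _ _ W hW => ?_⟩
  have hWW : W * Wᴴ = 1 := Matrix.mem_unitaryGroup_iff.mp hW
  have hWW' : Wᴴ * W = 1 := Matrix.mem_unitaryGroup_iff'.mp hW
  have hpow : ∀ k, W ^ k * Wᴴ ^ k = 1 := fun k => by
    rw [← Commute.mul_pow (by rw [Commute, SemiconjBy, hWW, hWW']), hWW, one_pow]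
  have hpow' : ∀ k, Wᴴ ^ k * W ^ k = 1 := fun k => by
    rw [← Commute.mul_pow (by rw [Commute, SemiconjBy, hWW, hWW']), hWW', one_pow]
  set F := aeval ((1 / 2 : ℂ) • (W + Wᴴ)) (f.map (algebraMap ℝ ℂ)) with hF
  have hcF : Commute W F := by
    have h0 : Commute W ((1 / 2 : ℂ) • (W + Wᴴ)) :=
      ((Commute.refl W).add_right (by rw [Commute, SemiconjBy, hWW, hWW'])).smul_right _
    rw [hF]
    induction (f.map (algebraMap ℝ ℂ)) using Polynomial.induction_on' with
    | add p q hp hq => rw [map_add]; exact hp.add_right hq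
    | monomial n x =>
      rw [aeval_monomial]
      exact Commute.mul_right (Algebra.commutes _ _).symm (h0.pow_right _)
  have h1 : aeval W (conjReflect d u * u) = F * W ^ d := by
    rw [hu']
    exact aeval_joukowsky hWW hWW' ((natDegree_map_le).trans hd)
  rw [map_mul, aeval_conjReflect hWW hu, Matrix.star_eq_conjTranspose, mul_assoc,
    ← (hcF.pow_left d).eq] at h1
  have h2 : (aeval W u)ᴴ * aeval W u = F := by
    have h3 := congrArg (fun M => Wᴴ ^ d * M) h1
    simpa only [← mul_assoc, hpow', one_mul] using h3
  -- The extra power of W† is unitary and commutes with F, so it drops out of the square.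
  rw [(h W hW).1, conjTranspose_mul, conjTranspose_pow, conjTranspose_conjTranspose, mul_assoc,
    ← mul_assoc _ (aeval W u), h2, ← mul_assoc, (hcF.pow_left _).eq, mul_assoc, hpow, mul_one]

end CosineSubstitution

/-! ### The qubitized block encoding and its flag probability -/

section Qubitization

variable {n m : ℕ}

/-- The isometry that adjoins `|0⟩` on `A'B'`. -/
def adjoinZero (n m : ℕ) : Matrix (RegAB n m × RegAB n m) (RegAB n m) ℂ :=
  Matrix.of fun x y => if x = (0, y) then 1 else 0

lemma adjoinZero_isometry : (adjoinZero n m)ᴴ * adjoinZero n m = 1 := by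
  ext y y'
  simp [adjoinZero, Matrix.mul_apply, Matrix.one_apply, eq_comm]

lemma reflectorGate_eq :
    reflectorGate n m = (2 : ℂ) • (adjoinZero n m * (adjoinZero n m)ᴴ) - 1 := by
  ext ⟨x, x'⟩ ⟨y, y'⟩
  simp only [reflectorGate, reflector, adjoinZero, kroneckerMap_apply, Matrix.sub_apply,
    Matrix.smul_apply, Matrix.single_apply, Matrix.one_apply, Matrix.mul_apply, conjTranspose_apply,
    Matrix.of_apply, Prod.mk.injEq]
  by_cases h1 : x = 0 <;> by_cases h2 : x' = y' <;> by_cases h3 : y = 0 <;>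
    simp [h1, h2, h3, eq_comm]

lemma reflectorGate_mul_adjoinZero : reflectorGate n m * adjoinZero n m = adjoinZero n m := by
  rw [reflectorGate_eq, Matrix.sub_mul, Matrix.one_mul, Matrix.smul_mul, Matrix.mul_assoc, adjoinZero_isometry, Matrix.mul_one,
    two_smul, add_sub_cancel_right]

lemma kronecker_mul_adjoinZero (U : Matrix (RegAB n m) (RegAB n m) ℂ) :
    (U ⊗ₖ (1 : Matrix (RegAB n m) (RegAB n m) ℂ)) * adjoinZero n m =
      Matrix.of fun x y => if x.2 = y then U x.1 0 else 0 := by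
  ext ⟨x, x'⟩ y
  simp [adjoinZero, Matrix.mul_apply, Matrix.one_apply]

/-- With A'B' in the state Ψ, the expectation of the swap over A'B' is an operator on A: contracting
the two copies of Ψ over B' leaves exactly their reduced state. -/
lemma swap_sandwich {U : Matrix (RegAB n m) (RegAB n m) ℂ} {ρ : Matrix (Qubits n) (Qubits n) ℂ}
    (h : reducedState (U *ᵥ Pi.single 0 1) = ρ) :
    (adjoinZero n m)ᴴ * ((Uᴴ ⊗ₖ 1) * swapGate n m * (U ⊗ₖ 1)) * adjoinZero n m =
      ρ ⊗ₖ (1 : Matrix (Qubits m) (Qubits m) ℂ) := by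
  have h1 : (adjoinZero n m)ᴴ * (Uᴴ ⊗ₖ (1 : Matrix (RegAB n m) (RegAB n m) ℂ)) =
      ((U ⊗ₖ (1 : Matrix (RegAB n m) (RegAB n m) ℂ)) * adjoinZero n m)ᴴ := by
    rw [conjTranspose_mul, conjTranspose_kronecker, conjTranspose_one]
  rw [← Matrix.mul_assoc, ← Matrix.mul_assoc, h1, Matrix.mul_assoc, kronecker_mul_adjoinZero]
  ext ⟨a, b⟩ ⟨a', b'⟩
  rw [← h]
  simp [Matrix.mul_apply, swapGate, reducedState, Matrix.one_apply, Fintype.sum_prod_type]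
  by_cases hb : b = b'
  · simp only [hb, and_true, if_true]
    rw [Finset.sum_eq_single a (fun x _ hx => by simp [hx]) (by simp)]
    simp [mul_comm]
  · simp [hb, Ne.symm hb]

/-- Write W = R S with S Hermitian and R = 2JJ† - 1, where J adjoins |0⟩. Since RJ = J, W J + W† J =
(R + 1) S J = 2J (J† S J), and the sandwich is ρ ⊗ I. This replaces the usual splitting into
two-dimensional invariant subspaces. -/
lemma qubitized_add_mul_adjoinZero {U : Matrix (RegAB n m) (RegAB n m) ℂ}
    {ρ : Matrix (Qubits n) (Qubits n) ℂ} (h : reducedState (U *ᵥ Pi.single 0 1) = ρ) :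
    ((1 / 2 : ℂ) • (qubitized U + (qubitized U)ᴴ)) * adjoinZero n m =
      adjoinZero n m * (ρ ⊗ₖ (1 : Matrix (Qubits m) (Qubits m) ℂ)) := by
  set S := (Uᴴ ⊗ₖ (1 : Matrix (RegAB n m) (RegAB n m) ℂ)) * swapGate n m * (U ⊗ₖ 1) with hS
  have hS' : Sᴴ = S := by
    simp only [hS, conjTranspose_mul, conjTranspose_kronecker, conjTranspose_one,
      conjTranspose_conjTranspose, Circuit.swapGate_conjTranspose, Matrix.mul_assoc]
  have hq : qubitized U = reflectorGate n m * S := by simp only [qubitized, hS, Matrix.mul_assoc]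
  rw [hq, conjTranspose_mul, hS', Circuit.reflectorGate_conjTranspose, Matrix.smul_mul, Matrix.add_mul,
    Matrix.mul_assoc S, reflectorGate_mul_adjoinZero, reflectorGate_eq, ← swap_sandwich h, ← hS]
  rw [Matrix.sub_mul, Matrix.one_mul, Matrix.sub_mul, sub_add_cancel, Matrix.smul_mul, Matrix.smul_mul, smul_smul]
  norm_num [Matrix.mul_assoc]

lemma qubitized_mem_unitaryGroup {U : Matrix (RegAB n m) (RegAB n m) ℂ}
    (hU : U ∈ Matrix.unitaryGroup (RegAB n m) ℂ) :
    qubitized U ∈ Matrix.unitaryGroup (RegAB n m × RegAB n m) ℂ := by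
  have h1 : U ⊗ₖ (1 : Matrix (RegAB n m) (RegAB n m) ℂ) ∈
      Matrix.unitaryGroup (RegAB n m × RegAB n m) ℂ := kronecker_mem_unitary hU (one_mem _)
  have h2 : Uᴴ ⊗ₖ (1 : Matrix (RegAB n m) (RegAB n m) ℂ) ∈
      Matrix.unitaryGroup (RegAB n m × RegAB n m) ℂ :=
    kronecker_mem_unitary (Unitary.star_mem hU) (one_mem _)
  have h3 : swapGate n m ∈ Matrix.unitaryGroup (RegAB n m × RegAB n m) ℂ := by
    rw [Matrix.mem_unitaryGroup_iff, Matrix.star_eq_conjTranspose, Circuit.swapGate_conjTranspose]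
    ext ⟨⟨a, b⟩, c, d⟩ ⟨⟨a', b'⟩, c', d'⟩
    simp [swapGate, Matrix.mul_apply, Matrix.one_apply]
  have h4 : reflectorGate n m ∈ Matrix.unitaryGroup (RegAB n m × RegAB n m) ℂ := by
    rw [Matrix.mem_unitaryGroup_iff, Matrix.star_eq_conjTranspose,
      Circuit.reflectorGate_conjTranspose]
    conv_lhs => rw [reflectorGate_eq, Matrix.mul_sub, Matrix.mul_smul, ← Matrix.mul_assoc,
      ← reflectorGate_eq, reflectorGate_mul_adjoinZero, Matrix.mul_one, reflectorGate_eq]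
    exact sub_sub_cancel _ _
  exact mul_mem (mul_mem (mul_mem h4 h2) h3) h1

open Polynomial in
lemma aeval_mul_of_intertwines {ι κ : Type*} [Fintype ι] [Fintype κ] [DecidableEq ι] [DecidableEq κ]
    {A : Matrix ι ι ℂ} {B : Matrix κ κ ℂ} {J : Matrix ι κ ℂ} (h : A * J = J * B) (p : ℂ[X]) :
    aeval A p * J = J * aeval B p := by
  induction p using Polynomial.induction_on' with
  | add p q hp hq => rw [map_add, map_add, Matrix.add_mul, Matrix.mul_add, hp, hq]
  | monomial k x =>
    have hk : A ^ k * J = J * B ^ k := by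
      induction k with
      | zero => simp
      | succ k ih => rw [pow_succ, pow_succ, Matrix.mul_assoc, h, ← Matrix.mul_assoc, ih, Matrix.mul_assoc]
    simp [aeval_monomial, Algebra.algebraMap_eq_smul_one, hk]

open Polynomial in
lemma aeval_kronecker_one {ι κ : Type*} [Fintype ι] [Fintype κ] [DecidableEq ι] [DecidableEq κ]
    (A : Matrix ι ι ℂ) (p : ℂ[X]) :
    aeval (A ⊗ₖ (1 : Matrix κ κ ℂ)) p = aeval A p ⊗ₖ (1 : Matrix κ κ ℂ) := by
  induction p using Polynomial.induction_on' with
  | add p q hp hq => rw [map_add, map_add, add_kronecker, hp, hq]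
  | monomial k x =>
    have hk : (A ⊗ₖ (1 : Matrix κ κ ℂ)) ^ k = (A ^ k) ⊗ₖ (1 : Matrix κ κ ℂ) := by
      induction k with
      | zero => simp
      | succ k ih => rw [pow_succ, pow_succ, ih, ← mul_kronecker_mul, Matrix.mul_one]
    simp [aeval_monomial, Algebra.algebraMap_eq_smul_one, hk, smul_kronecker]

lemma expectation_kronecker_one (M : Matrix (Qubits n) (Qubits n) ℂ) (ψ : RegAB n m → ℂ) :
    star ψ ⬝ᵥ ((M ⊗ₖ (1 : Matrix (Qubits m) (Qubits m) ℂ)) *ᵥ ψ) =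
      (M * reducedState ψ).trace := by
  simp only [dotProduct, mulVec, Matrix.trace, Matrix.diag_apply, Matrix.mul_apply, reducedState,
    Fintype.sum_prod_type, kroneckerMap_apply, Matrix.one_apply, Matrix.of_apply, Pi.star_apply,
    mul_ite, ite_mul, mul_zero, zero_mul, mul_one, Finset.sum_ite_eq, Finset.mem_univ, if_true,
    Finset.mul_sum]
  refine Finset.sum_congr rfl fun a _ => ?_
  rw [Finset.sum_comm]
  refine Finset.sum_congr rfl fun a' _ => Finset.sum_congr rfl fun b _ => ?_
  ring

lemma Ry_mem_unitaryGroup (θ : ℝ) : Ry θ ∈ Matrix.unitaryGroup (Fin 2) ℂ := by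
  have h : (Complex.cos (θ / 2)) ^ 2 + Complex.sin (θ / 2) ^ 2 = 1 := Complex.cos_sq_add_sin_sq _
  have hc : (starRingEnd ℂ) (Complex.cos (θ / 2)) = Complex.cos (θ / 2) := by
    rw [← Complex.cos_conj]; simp [Complex.conj_ofNat]
  have hs : (starRingEnd ℂ) (Complex.sin (θ / 2)) = Complex.sin (θ / 2) := by
    rw [← Complex.sin_conj]; simp [Complex.conj_ofNat]
  rw [Matrix.mem_unitaryGroup_iff]
  ext i j
  fin_cases i <;> fin_cases j <;>
    simp [Ry, Matrix.mul_apply, Matrix.star_eq_conjTranspose, hc, hs] <;>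
    first | linear_combination h | ring

lemma Rz_mem_unitaryGroup (φ : ℝ) : Rz φ ∈ Matrix.unitaryGroup (Fin 2) ℂ := by
  rw [Matrix.mem_unitaryGroup_iff]
  ext i j
  fin_cases i <;> fin_cases j <;>
    simp [Rz, Matrix.mul_apply, Matrix.star_eq_conjTranspose, ← Complex.exp_conj,
      ← Complex.exp_add, Complex.conj_ofNat, neg_div]

lemma controlled_mem_unitaryGroup {ι : Type} [Fintype ι] [DecidableEq ι] (c : Fin 2)
    {W : Matrix ι ι ℂ} (hW : W ∈ Matrix.unitaryGroup ι ℂ) :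
    controlled c W ∈ Matrix.unitaryGroup (Fin 2 × ι) ℂ := by
  have h1 : star (controlled c W) = controlled c (star W) := by
    ext ⟨a, i⟩ ⟨b, j⟩
    fin_cases a <;> fin_cases b <;> fin_cases c <;>
      simp [controlled, Matrix.star_eq_conjTranspose, Matrix.one_apply, eq_comm]
  rw [Matrix.mem_unitaryGroup_iff, h1, ← controlled_mul, Matrix.mem_unitaryGroup_iff.mp hW]
  ext ⟨a, i⟩ ⟨b, j⟩
  fin_cases a <;> fin_cases b <;> fin_cases c <;>
    simp [controlled, Matrix.one_apply]

lemma processor_mem_unitaryGroup {ι : Type} [Fintype ι] [DecidableEq ι] (ω : ℝ) (θ φ : ℕ → ℝ)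
    {W : Matrix ι ι ℂ} (hW : W ∈ Matrix.unitaryGroup ι ℂ) (L : ℕ) :
    processor ω θ φ W L ∈ Matrix.unitaryGroup (Fin 2 × ι) ℂ := by
  induction L with
  | zero =>
    exact kronecker_mem_unitary (mul_mem (mul_mem (Rz_mem_unitaryGroup _) (Ry_mem_unitaryGroup _))
      (Rz_mem_unitaryGroup _)) (one_mem _)
  | succ L ih =>
    refine mul_mem (mul_mem ih ?_) (kronecker_mem_unitary
      (mul_mem (Ry_mem_unitaryGroup _) (Rz_mem_unitaryGroup _)) (one_mem _))
    split_ifs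
    · exact controlled_mem_unitaryGroup _ (Unitary.star_mem hW)
    · exact controlled_mem_unitaryGroup _ hW

lemma query_mem_unitaryGroup {U : Matrix (RegAB n m) (RegAB n m) ℂ}
    (hU : U ∈ Matrix.unitaryGroup (RegAB n m) ℂ) (s i : Bool) :
    (Gate.query s i : Gate n m).eval U ∈ Matrix.unitaryGroup (Total n m) ℂ := by
  have h1 : (if i then Uᴴ else U) ∈ Matrix.unitaryGroup (RegAB n m) ℂ := by
    split_ifs
    · exact Unitary.star_mem hU
    · exact hU
  refine kronecker_mem_unitary (one_mem _) ?_
  by_cases hs : s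
  · simpa only [hs, if_true] using kronecker_mem_unitary (one_mem _) h1
  · simpa only [hs, if_false, Bool.false_eq_true] using kronecker_mem_unitary h1 (one_mem _)

lemma qppOnPurification_mem_unitaryGroup {U : Matrix (RegAB n m) (RegAB n m) ℂ}
    (hU : U ∈ Matrix.unitaryGroup (RegAB n m) ℂ) (ω : ℝ) (θ φ : ℕ → ℝ) (L : ℕ) :
    (Circuit.qppOnPurification n m ω θ φ L).eval U ∈ Matrix.unitaryGroup (Total n m) ℂ := by
  rw [Circuit.qppOnPurification, Circuit.eval, Circuit.eval_qpp hU]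
  exact mul_mem (processor_mem_unitaryGroup _ _ _ (qubitized_mem_unitaryGroup hU) _)
    (query_mem_unitaryGroup hU _ _)

open Polynomial in
/-- The QPP circuit can be given the flag probability `tr(ρ f(ρ))` for any polynomial `f` with
values in `(0, 1)`. -/
theorem exists_qpp_angles (d : ℕ) (f : ℝ[X]) (hd : f.natDegree ≤ d)
    (hf : ∀ x ∈ Set.Icc (-1 : ℝ) 1, 0 < f.eval x ∧ f.eval x < 1) :
    ∃ (ω : ℝ) (θ φ : ℕ → ℝ), ∀ (n m : ℕ) (U : Matrix (RegAB n m) (RegAB n m) ℂ)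
      (ρ : Matrix (Qubits n) (Qubits n) ℂ), IsPurifiedOracle U ρ →
      ((Circuit.qppOnPurification n m ω θ φ d).firstQubitProb U 1 : ℂ) =
        (aeval ρ (f.map (algebraMap ℝ ℂ)) * ρ).trace := by
  obtain ⟨ω, θ, φ, h⟩ := exists_processor_angles_of_polynomial d f hd hf
  refine ⟨ω, θ, φ, fun n m U ρ hU => ?_⟩
  obtain ⟨ψ, hψ⟩ : ∃ ψ : RegAB n m → ℂ, ψ = U *ᵥ Pi.single 0 1 := ⟨_, rfl⟩
  set V := processor ω θ φ (qubitized U) d with hV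
  -- The QPP qubit and A'B' start in |0⟩, so only the first block column of the processor acts, on J
  -- ψ.
  have hstate : ∀ b x, ((Circuit.qppOnPurification n m ω θ φ d).eval U *ᵥ Pi.single 0 1) (b, x) =
      (block b 0 V *ᵥ (adjoinZero n m *ᵥ ψ)) x := by
    intro b x
    rw [Circuit.qppOnPurification, Circuit.eval, Circuit.eval_qpp hU.unitary, ← hV,
      ← Matrix.mulVec_mulVec]
    have h1 : (Gate.query true false : Gate n m).eval U *ᵥ Pi.single 0 1 =
        fun y => if y.1 = 0 then (adjoinZero n m *ᵥ ψ) y.2 else 0 := by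
      ext ⟨a, y, z⟩
      simp [Gate.eval, adjoinZero, hψ, Matrix.mulVec, dotProduct, Matrix.one_apply]
      rw [Finset.sum_eq_single (0 : Total n m) (fun x _ hx => by simp [hx]) (by simp),
        Finset.sum_eq_single z (fun x _ hx => by simp [Ne.symm hx]) (by simp)]
      by_cases hy : y = 0 <;> by_cases ha : a = 0 <;> simp [hy, ha]
    rw [h1]
    simp [Matrix.mulVec, dotProduct, block, Fintype.sum_prod_type]
  have h2 : ((Circuit.qppOnPurification n m ω θ φ d).firstQubitProb U 1 : ℂ) =
      star (block 1 0 V *ᵥ (adjoinZero n m *ᵥ ψ)) ⬝ᵥ (block 1 0 V *ᵥ (adjoinZero n m *ᵥ ψ)) := by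
    simp only [Circuit.firstQubitProb, hstate, dotProduct]
    push_cast
    refine Finset.sum_congr rfl fun x _ => ?_
    rw [Pi.star_apply, Complex.star_def, ← Complex.normSq_eq_conj_mul_self,
      Complex.normSq_eq_norm_sq]
    push_cast
    rfl
  rw [h2, Matrix.star_mulVec, ← Matrix.dotProduct_mulVec, Matrix.mulVec_mulVec,
    hV, h _ (qubitized_mem_unitaryGroup hU.unitary), Matrix.mulVec_mulVec,
    aeval_mul_of_intertwines (qubitized_add_mul_adjoinZero hU.reduced), Matrix.star_mulVec,
    ← Matrix.dotProduct_mulVec, Matrix.mulVec_mulVec, ← Matrix.mul_assoc, adjoinZero_isometry,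
    Matrix.one_mul, aeval_kronecker_one, expectation_kronecker_one, hψ, hU.reduced]

end Qubitization

/-! ### The discrete Fejér-Korovkin operator -/

section Approximation

/-- The real part of a geometric sum over the powers of an N-th root of unity other than 1. -/
lemma sum_cos_add_eq_zero {N : ℕ} {j : ℤ} (hN : 0 < N) (hj : ¬ (N : ℤ) ∣ j) (c : ℝ) :
    ∑ m ∈ Finset.range N, Real.cos (c + j * (2 * Real.pi * m / N)) = 0 := by
  have hN' : (N : ℂ) ≠ 0 := by exact_mod_cast hN.ne'
  have hπ : (Real.pi : ℂ) ≠ 0 := by exact_mod_cast Real.pi_ne_zero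
  set ζ : ℂ := Complex.exp (j * (2 * Real.pi / N) * Complex.I) with hζ
  have h1 : ζ ^ N = 1 := by
    rw [hζ, ← Complex.exp_nat_mul, Complex.exp_eq_one_iff]
    exact ⟨j, by field_simp⟩
  have h2 : ζ ≠ 1 := by
    rw [hζ, Ne, Complex.exp_eq_one_iff]
    rintro ⟨k, hk⟩
    apply hj
    refine ⟨k, ?_⟩
    have h3 : (j : ℂ) = N * k := by
      have hI := Complex.I_ne_zero
      field_simp at hk
      linear_combination hk
    exact_mod_cast h3
  have h3 : ∑ m ∈ Finset.range N, ζ ^ m = 0 := by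
    rw [geom_sum_eq h2, h1, sub_self, zero_div]
  have h4 : ∀ m : ℕ, Real.cos (c + j * (2 * Real.pi * m / N)) =
      (Complex.exp (c * Complex.I) * ζ ^ m).re := by
    intro m
    rw [hζ, ← Complex.exp_nat_mul, ← Complex.exp_add,
      show (c : ℂ) * Complex.I + m * (j * (2 * Real.pi / N) * Complex.I) =
        ((c + j * (2 * Real.pi * m / N) : ℝ) : ℂ) * Complex.I by push_cast; ring,
      Complex.exp_ofReal_mul_I_re]
  rw [Finset.sum_congr rfl fun m _ => h4 m, ← Complex.re_sum, ← Finset.mul_sum, h3]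
  simp

lemma sum_cos_int_mul {N : ℕ} {k : ℤ} (hk : |k| < N) (e : ℤ) (he : e = 1 ∨ e = -1) (τ : ℝ) :
    ∑ m ∈ Finset.range N, Real.cos (k * (τ + e * (2 * Real.pi * m / N))) =
      if k = 0 then (N : ℝ) else 0 := by
  split_ifs with h
  · simp [h]
  · have hN : 0 < N := by
      have := abs_nonneg k
      omega
    rw [← sum_cos_add_eq_zero (N := N) (j := k * e) hN ?_ (k * τ)]
    · refine Finset.sum_congr rfl fun m _ => ?_
      push_cast
      ring_nf
    · intro hd
      have hd' : (N : ℤ) ∣ k := by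
        rcases he with rfl | rfl
        · simpa using hd
        · simpa using hd
      exact h (Int.eq_zero_of_abs_lt_dvd hd' hk)

/-- The coefficients of the Fejér-Korovkin kernel. -/
noncomputable def korovkinCoeff (d l : ℕ) : ℝ := Real.sin (Real.pi / (d + 2) * (l + 1))

/-- The Fejér-Korovkin kernel, not normalized. -/
noncomputable def korovkinKernel (d : ℕ) (t : ℝ) : ℝ :=
  ∑ l ∈ Finset.range (d + 1), ∑ k ∈ Finset.range (d + 1),
    korovkinCoeff d l * korovkinCoeff d k * Real.cos (((l : ℤ) - (k : ℤ) : ℤ) * t)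

/-- The squared norm of the coefficients of the Fejér-Korovkin kernel. -/
noncomputable def korovkinNorm (d : ℕ) : ℝ := ∑ l ∈ Finset.range (d + 1), korovkinCoeff d l ^ 2

/-- The kernel is |∑ a_l e^(ilt)|², split here into real and imaginary parts. -/
lemma korovkinKernel_nonneg (d : ℕ) (t : ℝ) : 0 ≤ korovkinKernel d t := by
  have h : korovkinKernel d t =
      (∑ l ∈ Finset.range (d + 1), korovkinCoeff d l * Real.cos (l * t)) ^ 2 +
      (∑ l ∈ Finset.range (d + 1), korovkinCoeff d l * Real.sin (l * t)) ^ 2 := by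
    rw [sq, sq, Finset.sum_mul_sum, Finset.sum_mul_sum, ← Finset.sum_add_distrib]
    refine Finset.sum_congr rfl fun l _ => ?_
    rw [← Finset.sum_add_distrib]
    refine Finset.sum_congr rfl fun k _ => ?_
    push_cast
    rw [sub_mul, Real.cos_sub]
    ring
  rw [h]
  positivity

lemma korovkinNorm_pos (d : ℕ) : 0 < korovkinNorm d := by
  refine Finset.sum_pos' (fun _ _ => sq_nonneg _) ⟨0, by simp, ?_⟩
  have h : 0 < korovkinCoeff d 0 := by
    apply Real.sin_pos_of_pos_of_lt_pi
    · have := Real.pi_pos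
      positivity
    · rw [Nat.cast_zero, zero_add, mul_one]
      exact div_lt_self Real.pi_pos (by have : (0 : ℝ) ≤ d := by positivity
                                        linarith)
  positivity

/-- The frequencies l - k are at most d in absolute value, so d + 2 equispaced nodes annihilate all
but the diagonal terms. -/
lemma sum_korovkinKernel (d : ℕ) (e : ℤ) (he : e = 1 ∨ e = -1) (τ : ℝ) :
    ∑ m ∈ Finset.range (d + 2), korovkinKernel d (τ + e * (2 * Real.pi * m / (d + 2 : ℕ))) =
      (d + 2) * korovkinNorm d := by
  simp only [korovkinKernel]
  rw [Finset.sum_comm, korovkinNorm, Finset.mul_sum]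
  refine Finset.sum_congr rfl fun l hl => ?_
  rw [Finset.sum_comm]
  have hl' := Finset.mem_range.mp hl
  have h : ∀ k ∈ Finset.range (d + 1), ∑ m ∈ Finset.range (d + 2),
      korovkinCoeff d l * korovkinCoeff d k *
        Real.cos (((l : ℤ) - (k : ℤ) : ℤ) * (τ + e * (2 * Real.pi * m / (d + 2 : ℕ)))) =
      if k = l then (d + 2) * korovkinCoeff d l ^ 2 else 0 := by
    intro k hk
    have hk' := Finset.mem_range.mp hk
    rw [← Finset.mul_sum, sum_cos_int_mul (by rw [abs_lt]; push_cast; omega) e he]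
    by_cases hkl : k = l
    · subst hkl
      simp
      ring
    · have : ¬ ((l : ℤ) - k = 0) := by omega
      simp [hkl, this]
  rw [Finset.sum_congr rfl h, Finset.sum_ite_eq' _ _ _, if_pos hl]

/-- The coefficients form an eigenvector of the adjacency matrix of a path: the sine also vanishes
at the positions -1 and d + 1, so the boundary rows obey the same addition formula. -/
lemma sum_korovkinCoeff_neighbours {d l : ℕ} (hl : l < d + 1) :
    ∑ k ∈ Finset.range (d + 1), korovkinCoeff d k *
      ((if (l : ℤ) - k + 1 = 0 then 1 else 0) + (if (l : ℤ) - k - 1 = 0 then 1 else 0)) =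
      2 * Real.cos (Real.pi / (d + 2)) * korovkinCoeff d l := by
  have h1 : ∑ k ∈ Finset.range (d + 1), korovkinCoeff d k *
      (if (l : ℤ) - k + 1 = 0 then 1 else 0) = Real.sin (Real.pi / (d + 2) * (l + 2)) := by
    by_cases h : l + 1 < d + 1
    · rw [Finset.sum_eq_single (l + 1)]
      · simp [korovkinCoeff]
        ring_nf
      · intro k _ hk
        rw [if_neg (by omega), mul_zero]
      · intro h'
        simp at h'
        omega
    · have hld : l = d := by omega
      rw [Finset.sum_eq_zero, hld]
      · rw [div_mul_cancel₀ _ (by positivity), Real.sin_pi]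
      · intro k hk
        have hk' := Finset.mem_range.mp hk
        rw [if_neg (by omega), mul_zero]
  have h2 : ∑ k ∈ Finset.range (d + 1), korovkinCoeff d k *
      (if (l : ℤ) - k - 1 = 0 then 1 else 0) = Real.sin (Real.pi / (d + 2) * l) := by
    rcases Nat.eq_zero_or_pos l with rfl | h
    · rw [Finset.sum_eq_zero]
      · simp
      · intro k _
        rw [if_neg (by omega), mul_zero]
    · obtain ⟨l, rfl⟩ := Nat.exists_eq_succ_of_ne_zero h.ne'
      rw [Finset.sum_eq_single l]
      · simp [korovkinCoeff]
      · intro k _ hk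
        rw [if_neg (by push_cast; omega), mul_zero]
      · intro h'
        simp at h'
        omega
  simp only [mul_add] at h1 h2 ⊢
  rw [Finset.sum_add_distrib, h1, h2, korovkinCoeff]
  set h := Real.pi / (d + 2)
  rw [show h * l + h * 2 = h * (l + 1) + h by ring, show h * l = h * (l + 1) - h by ring,
    Real.sin_add, Real.sin_sub]
  ring

/-- The extra cosine shifts frequencies by ±1, hence up to d + 1, which d + 2 nodes still resolve.
Only neighbouring l, k survive, and the eigenvector property evaluates the sum; this is what makes
the kernel concentrate. -/
lemma sum_korovkinKernel_mul_cos (d : ℕ) (e : ℤ) (he : e = 1 ∨ e = -1) (τ : ℝ) :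
    ∑ m ∈ Finset.range (d + 2), korovkinKernel d (τ + e * (2 * Real.pi * m / (d + 2 : ℕ))) *
        Real.cos (τ + e * (2 * Real.pi * m / (d + 2 : ℕ))) =
      (d + 2) * korovkinNorm d * Real.cos (Real.pi / (d + 2)) := by
  simp only [korovkinKernel, Finset.sum_mul]
  rw [Finset.sum_comm, korovkinNorm, Finset.mul_sum, Finset.sum_mul]
  refine Finset.sum_congr rfl fun l hl => ?_
  rw [Finset.sum_comm]
  have hl' := Finset.mem_range.mp hl
  have h : ∀ k ∈ Finset.range (d + 1), ∑ m ∈ Finset.range (d + 2),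
      korovkinCoeff d l * korovkinCoeff d k *
        Real.cos (((l : ℤ) - (k : ℤ) : ℤ) * (τ + e * (2 * Real.pi * m / (d + 2 : ℕ)))) *
        Real.cos (τ + e * (2 * Real.pi * m / (d + 2 : ℕ))) =
      (d + 2) / 2 * korovkinCoeff d l * (korovkinCoeff d k *
        ((if (l : ℤ) - k + 1 = 0 then 1 else 0) + (if (l : ℤ) - k - 1 = 0 then 1 else 0))) := by
    intro k hk
    have hk' := Finset.mem_range.mp hk
    have h1 : ∀ m : ℕ, korovkinCoeff d l * korovkinCoeff d k *
        Real.cos (((l : ℤ) - (k : ℤ) : ℤ) * (τ + e * (2 * Real.pi * m / (d + 2 : ℕ)))) *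
        Real.cos (τ + e * (2 * Real.pi * m / (d + 2 : ℕ))) =
        korovkinCoeff d l * korovkinCoeff d k / 2 *
        (Real.cos (((l : ℤ) - (k : ℤ) + 1 : ℤ) * (τ + e * (2 * Real.pi * m / (d + 2 : ℕ)))) +
        Real.cos (((l : ℤ) - (k : ℤ) - 1 : ℤ) *
          (τ + e * (2 * Real.pi * m / (d + 2 : ℕ))))) := by
      intro m
      generalize τ + e * (2 * Real.pi * m / (d + 2 : ℕ)) = t
      push_cast
      rw [add_mul _ 1 t, sub_mul _ 1 t, one_mul, Real.cos_add _ t, Real.cos_sub _ t]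
      ring
    rw [Finset.sum_congr rfl fun m _ => h1 m, ← Finset.mul_sum, Finset.sum_add_distrib,
      sum_cos_int_mul (by rw [abs_lt]; push_cast; omega) e he,
      sum_cos_int_mul (by rw [abs_lt]; push_cast; omega) e he]
    push_cast
    split_ifs <;> ring
  rw [Finset.sum_congr rfl h, ← Finset.mul_sum, sum_korovkinCoeff_neighbours hl']
  ring

/-- The right side is the squared chord between two points of the circle; the left side is its
horizontal part. -/
lemma cos_sub_cos_sq_le (a b : ℝ) : (Real.cos a - Real.cos b) ^ 2 ≤ 2 * (1 - Real.cos (a - b)) := by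
  rw [Real.cos_sub]
  nlinarith [sq_nonneg (Real.sin a - Real.sin b), Real.sin_sq_add_cos_sq a, Real.sin_sq_add_cos_sq b]

open Polynomial in
/-- The image of `F` under the Fejér-Korovkin operator. -/
noncomputable def korovkinPoly (d : ℕ) (F : ℝ → ℝ) : ℝ[X] :=
  ∑ m ∈ Finset.range (d + 2), ∑ l ∈ Finset.range (d + 1), ∑ k ∈ Finset.range (d + 1),
    C (F (Real.cos (2 * Real.pi * m / (d + 2 : ℕ))) / ((d + 2) * korovkinNorm d) *
      (korovkinCoeff d l * korovkinCoeff d k *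
        Real.cos (((l : ℤ) - (k : ℤ) : ℤ) * (2 * Real.pi * m / (d + 2 : ℕ))))) *
      Polynomial.Chebyshev.T ℝ ((l : ℤ) - (k : ℤ))

lemma natDegree_korovkinPoly_le (d : ℕ) (F : ℝ → ℝ) : (korovkinPoly d F).natDegree ≤ d := by
  refine Polynomial.natDegree_sum_le_of_forall_le _ _ fun m _ =>
    Polynomial.natDegree_sum_le_of_forall_le _ _ fun l hl =>
    Polynomial.natDegree_sum_le_of_forall_le _ _ fun k hk =>
    (Polynomial.natDegree_C_mul_le _ _).trans ?_
  have hl' := Finset.mem_range.mp hl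
  have hk' := Finset.mem_range.mp hk
  rw [Polynomial.Chebyshev.natDegree_T]
  omega

/-- The Fejér-Korovkin operator averages `F` over points that are close to `x`. -/
theorem korovkinPoly_eval (d : ℕ) (F : ℝ → ℝ) {x : ℝ} (hx : x ∈ Set.Icc (-1 : ℝ) 1) :
    ∃ w p : ℕ × Bool → ℝ, (∀ i, 0 ≤ w i) ∧ (∀ i, p i ∈ Set.Icc (-1 : ℝ) 1) ∧
      ∑ i ∈ Finset.range (d + 2) ×ˢ Finset.univ, w i = 1 ∧
      ∑ i ∈ Finset.range (d + 2) ×ˢ Finset.univ, w i * F (p i) = (korovkinPoly d F).eval x ∧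
      ∑ i ∈ Finset.range (d + 2) ×ˢ Finset.univ, w i * |x - p i| ≤ Real.pi / (d + 2) := by
  obtain ⟨τ, rfl⟩ : ∃ τ, x = Real.cos τ := ⟨_, (Real.cos_arccos hx.1 hx.2).symm⟩
  set c := (2 * (d + 2) * korovkinNorm d)⁻¹ with hc
  have hnorm := korovkinNorm_pos d
  have hc0 : 0 < c := by positivity
  have hcn : c * ((d + 2) * korovkinNorm d) = 1 / 2 := by
    rw [hc]
    field_simp
  set h := Real.pi / (d + 2) with hh
  have hh0 : 0 < h := by have := Real.pi_pos; positivity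
  set node : ℕ → ℝ := fun m => 2 * Real.pi * m / (d + 2 : ℕ) with hnode
  -- Each node is used with both signs. In the sum of the two kernels the terms odd in τ cancel,
  -- which leaves a polynomial in cos τ.
  set ang : ℕ × Bool → ℝ := fun i => τ + (if i.2 then (1 : ℤ) else -1 : ℤ) * node i.1 with hang
  set w : ℕ × Bool → ℝ := fun i => c * korovkinKernel d (ang i) with hw
  have hw0 : ∀ i, 0 ≤ w i := fun i => mul_nonneg hc0.le (korovkinKernel_nonneg _ _)
  have hw1 : ∑ i ∈ Finset.range (d + 2) ×ˢ Finset.univ, w i = 1 := by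
    rw [Finset.sum_product_right, Fintype.sum_bool]
    simp only [hw, hang, ← Finset.mul_sum]
    simp only [if_true, Bool.false_eq_true, if_false]
    rw [sum_korovkinKernel d 1 (Or.inl rfl), sum_korovkinKernel d (-1) (Or.inr rfl), hcn]
    norm_num
  have hw2 : ∑ i ∈ Finset.range (d + 2) ×ˢ Finset.univ, w i * Real.cos (ang i) = Real.cos h := by
    rw [Finset.sum_product_right, Fintype.sum_bool]
    simp only [hw, hang, mul_assoc, ← Finset.mul_sum]
    simp only [if_true, Bool.false_eq_true, if_false]
    have e1 := sum_korovkinKernel_mul_cos d 1 (Or.inl rfl) τ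
    have e2 := sum_korovkinKernel_mul_cos d (-1) (Or.inr rfl) τ
    simp only [hnode]
    rw [e1, e2]
    linear_combination 2 * Real.cos h * hcn
  refine ⟨w, fun i => Real.cos (node i.1), hw0, fun i => ⟨Real.neg_one_le_cos _, Real.cos_le_one _⟩,
    hw1, ?_, ?_⟩
  · rw [Finset.sum_product, korovkinPoly, Polynomial.eval_finsetSum]
    refine Finset.sum_congr rfl fun m _ => ?_
    simp only [Polynomial.eval_finsetSum, Polynomial.eval_mul, Polynomial.eval_C,
      Polynomial.Chebyshev.T_real_cos, Fintype.sum_bool]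
    have e : ∀ l k : ℕ, Real.cos (((l : ℤ) - (k : ℤ) : ℤ) * (2 * Real.pi * m / (d + 2 : ℕ))) *
        Real.cos (((l : ℤ) - (k : ℤ) : ℤ) * τ) =
        (Real.cos (((l : ℤ) - (k : ℤ) : ℤ) * ang (m, true)) +
          Real.cos (((l : ℤ) - (k : ℤ) : ℤ) * ang (m, false))) / 2 := by
      intro l k
      simp only [hang, hnode, if_true, Bool.false_eq_true, if_false]
      push_cast
      rw [mul_add, mul_add, Real.cos_add, Real.cos_add, one_mul, neg_one_mul, mul_neg, Real.cos_neg,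
        Real.sin_neg]
      ring
    rw [← add_mul, mul_comm (w _ + w _), hw]
    simp only [korovkinKernel, ← mul_add, ← Finset.sum_add_distrib]
    rw [Finset.mul_sum, Finset.mul_sum]
    refine Finset.sum_congr rfl fun l _ => ?_
    rw [Finset.mul_sum, Finset.mul_sum]
    refine Finset.sum_congr rfl fun k _ => ?_
    have e' := e l k
    have hc2 : ((d + 2) * korovkinNorm d)⁻¹ = 2 * c := by
      rw [hc]; field_simp
    rw [div_eq_mul_inv, hc2]
    simp only [hnode]
    linear_combination (-(F (Real.cos (2 * Real.pi * m / (d + 2 : ℕ))) * 2 * c *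
      korovkinCoeff d l * korovkinCoeff d k)) * e'
  -- With y the distance, y ≤ y²/(2h) + h/2 turns the quadratic chord bound into a linear one. Its
  -- average is (1 - cos h)/h + h/2 ≤ h, which explains the choice h = π/(d + 2).
  · have e : ∀ i, |Real.cos τ - Real.cos (node i.1)| ≤ (1 - Real.cos (ang i)) / h + h / 2 := by
      intro i
      have h1 : (Real.cos τ - Real.cos (node i.1)) ^ 2 ≤ 2 * (1 - Real.cos (ang i)) := by
        rcases hi : i.2
        · simpa [hang, hi, sub_eq_add_neg] using cos_sub_cos_sq_le τ (node i.1)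
        · simpa [hang, hi] using cos_sub_cos_sq_le τ (-node i.1)
      rw [← sq_abs] at h1
      set y := |Real.cos τ - Real.cos (node i.1)|
      rw [div_add_div _ _ hh0.ne' two_ne_zero, le_div_iff₀ (by positivity)]
      nlinarith [sq_nonneg (y - h)]
    calc _ ≤ ∑ i ∈ Finset.range (d + 2) ×ˢ Finset.univ,
          (w i * (1 / h + h / 2) - (w i * Real.cos (ang i)) * (1 / h)) := by
          refine Finset.sum_le_sum fun i _ => ?_
          refine (mul_le_mul_of_nonneg_left (e i) (hw0 i)).trans (le_of_eq ?_)
          ring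
      _ = (1 - Real.cos h) / h + h / 2 := by
          rw [Finset.sum_sub_distrib, ← Finset.sum_mul, ← Finset.sum_mul, hw1, hw2]
          ring
      _ ≤ h := by
          have := Real.one_sub_sq_div_two_le_cos (x := h)
          rw [div_add_div _ _ hh0.ne' two_ne_zero, div_le_iff₀ (by positivity)]
          nlinarith

lemma korovkinPoly_mem_Icc (d : ℕ) {F : ℝ → ℝ} {lo hi : ℝ}
    (hF : ∀ x ∈ Set.Icc (-1 : ℝ) 1, F x ∈ Set.Icc lo hi) {x : ℝ} (hx : x ∈ Set.Icc (-1 : ℝ) 1) :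
    (korovkinPoly d F).eval x ∈ Set.Icc lo hi := by
  obtain ⟨w, p, hw, hp, h1, h2, -⟩ := korovkinPoly_eval d F hx
  rw [← h2]
  constructor
  · calc lo = ∑ i ∈ Finset.range (d + 2) ×ˢ Finset.univ, w i * lo := by
          rw [← Finset.sum_mul, h1, one_mul]
      _ ≤ _ := Finset.sum_le_sum fun i _ => mul_le_mul_of_nonneg_left (hF _ (hp i)).1 (hw i)
  · calc _ ≤ ∑ i ∈ Finset.range (d + 2) ×ˢ Finset.univ, w i * hi :=
          Finset.sum_le_sum fun i _ => mul_le_mul_of_nonneg_left (hF _ (hp i)).2 (hw i)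
      _ = hi := by rw [← Finset.sum_mul, h1, one_mul]

/-- The weight b stands for the eigenvalue (or its cutoff) in front of the power: F itself need not
be Lipschitz near 0, only after weighting at x. -/
lemma abs_korovkinPoly_sub_le (d : ℕ) {F : ℝ → ℝ} {x b K : ℝ} (hx : x ∈ Set.Icc (-1 : ℝ) 1)
    (hb : 0 ≤ b) (hK : 0 ≤ K)
    (hF : ∀ y ∈ Set.Icc (-1 : ℝ) 1, b * |F y - F x| ≤ K * |x - y|) :
    b * |(korovkinPoly d F).eval x - F x| ≤ K * (Real.pi / (d + 2)) := by
  obtain ⟨w, p, hw, hp, h1, h2, h3⟩ := korovkinPoly_eval d F hx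
  have h4 : (korovkinPoly d F).eval x - F x =
      ∑ i ∈ Finset.range (d + 2) ×ˢ Finset.univ, w i * (F (p i) - F x) := by
    simp only [mul_sub]
    rw [Finset.sum_sub_distrib, ← Finset.sum_mul, h1, h2, one_mul]
  calc b * |(korovkinPoly d F).eval x - F x|
      ≤ b * ∑ i ∈ Finset.range (d + 2) ×ˢ Finset.univ, |w i * (F (p i) - F x)| := by
        rw [h4]
        exact mul_le_mul_of_nonneg_left (Finset.abs_sum_le_sum_abs _ _) hb
    _ = ∑ i ∈ Finset.range (d + 2) ×ˢ Finset.univ, w i * (b * |F (p i) - F x|) := by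
        rw [Finset.mul_sum]
        refine Finset.sum_congr rfl fun i _ => ?_
        rw [abs_mul, abs_of_nonneg (hw i)]
        ring
    _ ≤ ∑ i ∈ Finset.range (d + 2) ×ˢ Finset.univ, K * (w i * |x - p i|) := by
        refine Finset.sum_le_sum fun i _ => ?_
        refine (mul_le_mul_of_nonneg_left (hF _ (hp i)) (hw i)).trans (le_of_eq ?_)
        ring
    _ ≤ _ := by
        rw [← Finset.mul_sum]
        exact mul_le_mul_of_nonneg_left h3 hK

end Approximation

/-! ### Grover iterations rotate the flag amplitude -/

section Grover

variable {n m : ℕ}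

lemma Gate.eval_inv (U : Matrix (RegAB n m) (RegAB n m) ℂ) (g : Gate n m) :
    g.inv.eval U = (g.eval U)ᴴ := by
  cases g with
  | free G => rfl
  | query s i =>
    cases s <;> cases i <;> simp [Gate.inv, Gate.eval, conjTranspose_kronecker]

lemma Circuit.eval_inv (U : Matrix (RegAB n m) (RegAB n m) ℂ) (c : Circuit n m) :
    Circuit.eval U (Circuit.inv c) = (Circuit.eval U c)ᴴ := by
  induction c with
  | nil => simp [Circuit.inv, Circuit.eval]
  | cons g c ih =>
    rw [Circuit.inv, List.map_cons, List.reverse_cons, Circuit.eval_append]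
    change Circuit.eval U [g.inv] * Circuit.eval U (Circuit.inv c) = _
    rw [ih]
    simp [Circuit.eval, Gate.eval_inv]

lemma Circuit.queries_append (c d : Circuit n m) :
    Circuit.queries (c ++ d) = c.queries + d.queries := by
  simp [Circuit.queries]

lemma Circuit.queries_inv (c : Circuit n m) : (Circuit.inv c).queries = c.queries := by
  have h : Gate.queries ∘ Gate.inv = (Gate.queries : Gate n m → ℕ) := by
    ext g
    cases g <;> rfl
  simp only [Circuit.queries, Circuit.inv, List.map_reverse, List.sum_reverse, List.map_map, h]

lemma Circuit.queries_grover (c : Circuit n m) (k : ℕ) :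
    (c.grover k).queries = (2 * k + 1) * c.queries := by
  induction k with
  | zero => simp [Circuit.grover]
  | succ k ih =>
    rw [Circuit.grover, Circuit.queries_append, ih]
    have h : ∀ (G G' : Matrix (Total n m) (Total n m) ℂ), Circuit.queries
        (Gate.free G :: (Circuit.inv c ++ (Gate.free G' :: c))) = 2 * c.queries := by
      intro G G'
      have h1 : ∀ (G : Matrix (Total n m) (Total n m) ℂ) (d : Circuit n m),
          Circuit.queries (Gate.free G :: d) = d.queries := fun G d => by
        simp [Circuit.queries, Gate.queries]
      rw [h1, Circuit.queries_append, h1, Circuit.queries_inv, two_mul]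
    rw [h]
    ring

lemma firstQubitProb_nonneg (U : Matrix (RegAB n m) (RegAB n m) ℂ) (c : Circuit n m) (b : Fin 2) :
    0 ≤ c.firstQubitProb U b := Finset.sum_nonneg fun _ _ => by positivity

lemma firstQubitProb_add {U : Matrix (RegAB n m) (RegAB n m) ℂ} {c : Circuit n m}
    (hc : c.eval U ∈ Matrix.unitaryGroup (Total n m) ℂ) :
    c.firstQubitProb U 0 + c.firstQubitProb U 1 = 1 := by
  have h1 : star (c.eval U *ᵥ Pi.single 0 1) ⬝ᵥ (c.eval U *ᵥ Pi.single 0 1) = 1 := by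
    rw [Matrix.star_mulVec, ← Matrix.dotProduct_mulVec, Matrix.mulVec_mulVec,
      ← Matrix.star_eq_conjTranspose, Matrix.mem_unitaryGroup_iff'.mp hc, Matrix.one_mulVec]
    simp
  have h2 : ((c.firstQubitProb U 0 + c.firstQubitProb U 1 : ℝ) : ℂ) = 1 := by
    rw [← h1, dotProduct, Fintype.sum_prod_type, Fin.sum_univ_two]
    simp only [Circuit.firstQubitProb]
    push_cast
    congr 1 <;>
    · refine Finset.sum_congr rfl fun x _ => ?_
      rw [Pi.star_apply, Complex.star_def, ← Complex.normSq_eq_conj_mul_self,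
        Complex.normSq_eq_norm_sq]
      push_cast
      rfl
  exact_mod_cast h2

lemma reflector_mem_unitaryGroup (ι : Type) [Fintype ι] [DecidableEq ι] [Zero ι] :
    reflector ι ∈ Matrix.unitaryGroup ι ℂ := by
  rw [Matrix.mem_unitaryGroup_iff, Matrix.star_eq_conjTranspose, Circuit.reflector_conjTranspose,
    reflector, sub_mul, mul_sub, mul_sub, smul_mul_smul_comm, Matrix.single_mul_single_same,
    mul_one, mul_one, one_mul, one_mul, mul_smul]
  simp [two_smul]

lemma Circuit.grover_mem_unitaryGroup {U : Matrix (RegAB n m) (RegAB n m) ℂ} {c : Circuit n m}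
    (hc : c.eval U ∈ Matrix.unitaryGroup (Total n m) ℂ) (k : ℕ) :
    (c.grover k).eval U ∈ Matrix.unitaryGroup (Total n m) ℂ := by
  induction k with
  | zero => exact hc
  | succ k ih =>
    have hZ : pauliZ ∈ Matrix.unitaryGroup (Fin 2) ℂ := by
      rw [Matrix.mem_unitaryGroup_iff]
      ext i j
      fin_cases i <;> fin_cases j <;> simp [pauliZ, Matrix.mul_apply, Matrix.star_eq_conjTranspose]
    rw [Circuit.grover, Circuit.eval_append, Circuit.eval, Circuit.eval_append, Circuit.eval,
      Circuit.eval_inv]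
    exact mul_mem (mul_mem (mul_mem (mul_mem hc (reflector_mem_unitaryGroup _))
      (Unitary.star_mem hc)) (kronecker_mem_unitary hZ (one_mem _))) ih

/-- The iterates stay in the plane spanned by the two flag components of the initial state, where
the iterate is a rotation by 2θ; each component is only rescaled. The nonvanishing sine and cosine
allow division by the initial amplitudes. -/
lemma eval_grover_apply {U : Matrix (RegAB n m) (RegAB n m) ℂ} {c : Circuit n m}
    (hc : c.eval U ∈ Matrix.unitaryGroup (Total n m) ℂ) {θ : ℝ}
    (hθ : c.firstQubitProb U 1 = Real.sin θ ^ 2) (hs : Real.sin θ ≠ 0) (hcos : Real.cos θ ≠ 0)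
    (k : ℕ) (b : Fin 2) (x : RegAB n m × RegAB n m) :
    ((c.grover k).eval U *ᵥ Pi.single 0 1) (b, x) =
      ((if b = 0 then Real.cos ((2 * k + 1) * θ) / Real.cos θ
        else Real.sin ((2 * k + 1) * θ) / Real.sin θ : ℝ) : ℂ) *
      (c.eval U *ᵥ Pi.single 0 1) (b, x) := by
  have hs' : Complex.sin θ ≠ 0 := by exact_mod_cast hs
  have hcos' : Complex.cos θ ≠ 0 := by exact_mod_cast hcos
  induction k generalizing b x with
  | zero =>
    fin_cases b <;> simp [Circuit.grover, hs', hcos']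
  | succ k ih =>
    set v := c.eval U *ᵥ Pi.single 0 1 with hv
    set y : Total n m → ℂ := (pauliZ ⊗ₖ (1 : Matrix (RegAB n m × RegAB n m) _ ℂ)) *ᵥ
      ((c.grover k).eval U *ᵥ Pi.single 0 1) with hy
    have hyval : ∀ b x, y (b, x) = ((if b = 0 then Real.cos ((2 * k + 1) * θ) / Real.cos θ
        else -(Real.sin ((2 * k + 1) * θ) / Real.sin θ) : ℝ) : ℂ) * v (b, x) := by
      intro b x
      have h1 : y (b, x) = (if b = 0 then 1 else -1) *
          ((c.grover k).eval U *ᵥ Pi.single 0 1) (b, x) := by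
        simp only [hy]
        generalize (c.grover k).eval U *ᵥ Pi.single 0 1 = z
        fin_cases b <;>
          simp [Matrix.mulVec, dotProduct, pauliZ, Fintype.sum_prod_type, Matrix.one_apply]
      rw [h1, ih]
      fin_cases b <;> simp
    have hinner : star v ⬝ᵥ y = ((Real.cos ((2 * k + 2) * θ) : ℝ) : ℂ) := by
      have hp0 : c.firstQubitProb U 0 = Real.cos θ ^ 2 := by
        have := firstQubitProb_add hc
        rw [hθ] at this
        linarith [Real.sin_sq_add_cos_sq θ]
      have h3 : ∀ b, ∑ x, star v (b, x) * v (b, x) = ((c.firstQubitProb U b : ℝ) : ℂ) := by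
        intro b
        simp only [Circuit.firstQubitProb]
        push_cast
        refine Finset.sum_congr rfl fun x _ => ?_
        rw [Pi.star_apply, Complex.star_def, ← Complex.normSq_eq_conj_mul_self,
          Complex.normSq_eq_norm_sq]
        push_cast
        rfl
      rw [dotProduct, Fintype.sum_prod_type, Fin.sum_univ_two]
      simp only [hyval, mul_left_comm (star v _), ← Finset.mul_sum, h3, hp0, hθ]
      rw [← Complex.ofReal_mul, ← Complex.ofReal_mul, ← Complex.ofReal_add]
      congr 1
      rw [show (2 * (k : ℝ) + 2) * θ = (2 * k + 1) * θ + θ by ring, Real.cos_add]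
      simp
      field_simp
      ring
    -- Conjugated by the circuit, the reflection about |0⟩ becomes the reflection about v.
    have hstep : (c.grover (k + 1)).eval U *ᵥ Pi.single 0 1 =
        fun i => 2 * (star v ⬝ᵥ y) * v i - y i := by
      rw [Circuit.grover, Circuit.eval_append, Circuit.eval, Circuit.eval_append, Circuit.eval,
        Circuit.eval_inv, ← Matrix.mulVec_mulVec, ← Matrix.mulVec_mulVec]
      simp only [Gate.eval]
      rw [← hy, ← Matrix.mulVec_mulVec, ← Matrix.mulVec_mulVec]
      have h4 : reflector (Total n m) *ᵥ ((c.eval U)ᴴ *ᵥ y) =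
          (2 * (star v ⬝ᵥ y)) • Pi.single 0 1 - (c.eval U)ᴴ *ᵥ y := by
        have h5 : ((c.eval U)ᴴ *ᵥ y) 0 = star v ⬝ᵥ y := by
          rw [hv, Matrix.star_mulVec, ← Matrix.dotProduct_mulVec]
          simp [dotProduct, Pi.single_apply]
        rw [reflector, Matrix.sub_mulVec, Matrix.one_mulVec, Matrix.smul_mulVec, ← h5, mul_smul]
        congr 2
        ext i
        simp [Matrix.mulVec, dotProduct, Matrix.single_apply, Pi.single_apply, eq_comm]
        by_cases hi : i = 0 <;> simp [hi]
      rw [h4, Matrix.mulVec_sub, Matrix.mulVec_smul, ← hv, Matrix.mulVec_mulVec,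
        show c.eval U * (c.eval U)ᴴ = 1 from Matrix.mem_unitaryGroup_iff.mp hc, Matrix.one_mulVec]
      ext i
      simp
    rw [hstep]
    simp only
    rw [hinner, hyval, ← sub_mul]
    congr 1
    have e1 : Real.cos ((2 * k + 2) * θ) = Real.cos ((2 * k + 1) * θ) * Real.cos θ -
        Real.sin ((2 * k + 1) * θ) * Real.sin θ := by
      rw [← Real.cos_add]; ring_nf
    have e2 : Real.cos ((2 * (k + 1 : ℕ) + 1) * θ) = Real.cos ((2 * k + 2) * θ) * Real.cos θ -
        Real.sin ((2 * k + 2) * θ) * Real.sin θ := by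
      rw [← Real.cos_add]; push_cast; ring_nf
    have e3 : Real.sin ((2 * (k + 1 : ℕ) + 1) * θ) = Real.sin ((2 * k + 2) * θ) * Real.cos θ +
        Real.cos ((2 * k + 2) * θ) * Real.sin θ := by
      rw [← Real.sin_add]; push_cast; ring_nf
    have e4 : Real.sin ((2 * k + 2) * θ) = Real.sin ((2 * k + 1) * θ) * Real.cos θ +
        Real.cos ((2 * k + 1) * θ) * Real.sin θ := by
      rw [← Real.sin_add]; ring_nf
    have e5 := Real.sin_sq_add_cos_sq θ
    have e6 : ∀ r : ℝ, (2 : ℂ) * (r : ℂ) = ((2 * r : ℝ) : ℂ) := fun r => by push_cast; ring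
    rw [e6, ← Complex.ofReal_sub]
    congr 1
    fin_cases b
    · simp only [Fin.zero_eta, if_true]
      rw [e2, e4, e1]
      field_simp
      linear_combination Real.cos ((2 * k + 1) * θ) * e5
    · simp only [Fin.mk_one, one_ne_zero, if_false]
      rw [e3, e4, e1]
      field_simp
      linear_combination (-Real.sin ((2 * k + 1) * θ)) * e5

/-- Grover iterations multiply the angle of the flag amplitude. -/
theorem firstQubitProb_grover {U : Matrix (RegAB n m) (RegAB n m) ℂ} {c : Circuit n m}
    (hc : c.eval U ∈ Matrix.unitaryGroup (Total n m) ℂ) {φ : ℝ}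
    (hφ : c.firstQubitProb U 1 = (1 - Real.cos φ) / 2) (h0 : 0 < c.firstQubitProb U 1)
    (h1 : c.firstQubitProb U 1 < 1) (k : ℕ) :
    (c.grover k).firstQubitProb U 1 = (1 - Real.cos ((2 * k + 1) * φ)) / 2 := by
  have hsq : ∀ t : ℝ, (1 - Real.cos t) / 2 = Real.sin (t / 2) ^ 2 := fun t => by
    rw [Real.sin_sq_eq_half_sub, mul_div_cancel₀ _ two_ne_zero]
    ring
  rw [hsq] at hφ ⊢
  have hs : Real.sin (φ / 2) ≠ 0 := by
    intro h
    rw [hφ, h] at h0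
    norm_num at h0
  have hcos : Real.cos (φ / 2) ≠ 0 := by
    intro h
    have := Real.sin_sq_add_cos_sq (φ / 2)
    rw [h] at this
    rw [hφ] at h1
    nlinarith
  rw [Circuit.firstQubitProb]
  simp only [eval_grover_apply hc hφ hs hcos, one_ne_zero, if_false, norm_mul, mul_pow,
    ← Finset.mul_sum]
  rw [show ∑ x, ‖(Circuit.eval U c *ᵥ Pi.single 0 1) ((1 : Fin 2), x)‖ ^ 2 =
    c.firstQubitProb U 1 from rfl, hφ, Complex.norm_real, Real.norm_eq_abs, sq_abs,
    mul_div_assoc]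
  field_simp

end Grover

/-! ### Moments under a product measure on outcomes -/

section ProductMeasure

variable {σ : Type*} [Fintype σ] [DecidableEq σ]

lemma sum_prod_weights (w : σ → Fin 2 → ℝ) :
    ∑ s : σ → Fin 2, ∏ i, w i (s i) = ∏ i, ∑ b, w i b := by
  rw [Finset.prod_univ_sum, Fintype.piFinset_univ]

/-- The second moment of a sum of independent centred variables. -/
lemma sum_prod_weights_mul_sq {w : σ → Fin 2 → ℝ} (hw : ∀ i, ∑ b, w i b = 1) (S : Finset σ)
    (x : σ → Fin 2 → ℝ) (hx : ∀ i ∈ S, ∑ b, w i b * x i b = 0) :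
    ∑ s : σ → Fin 2, (∏ i, w i (s i)) * (∑ i ∈ S, x i (s i)) ^ 2 =
      ∑ i ∈ S, ∑ b, w i b * x i b ^ 2 := by
  have h1 : ∀ i ∈ S, ∀ j ∈ S, ∑ s : σ → Fin 2, (∏ i, w i (s i)) * (x i (s i) * x j (s j)) =
      if j = i then ∑ b, w i b * x i b ^ 2 else 0 := by
    intro i hi j hj
    -- The two observables are absorbed into the factors at i and j, so the sum over all outcomes
    -- factorizes again.
    have h2 : ∀ s : σ → Fin 2, (∏ i, w i (s i)) * (x i (s i) * x j (s j)) =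
        ∏ k, (w k (s k) * ((if k = i then x k (s k) else 1) * if k = j then x k (s k) else 1)) := by
      intro s
      rw [Finset.prod_mul_distrib, Finset.prod_mul_distrib]
      simp
    rw [Finset.sum_congr rfl fun s _ => h2 s,
      sum_prod_weights fun k b => w k b * ((if k = i then x k b else 1) * if k = j then x k b else 1)]
    split_ifs with hij
    · subst hij
      rw [Finset.prod_eq_single j]
      · simp [sq]
      · intro k _ hk
        simp [hk, hw k]
      · simp
    · refine Finset.prod_eq_zero (Finset.mem_univ i) ?_
      simpa [Ne.symm hij] using hx i hi
  have h3 : ∀ s : σ → Fin 2, (∏ i, w i (s i)) * (∑ i ∈ S, x i (s i)) ^ 2 =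
      ∑ i ∈ S, ∑ j ∈ S, (∏ i, w i (s i)) * (x i (s i) * x j (s j)) := by
    intro s
    rw [sq, Finset.sum_mul_sum]
    simp only [Finset.mul_sum]
  rw [Finset.sum_congr rfl fun s _ => h3 s, Finset.sum_comm]
  refine Finset.sum_congr rfl fun i hi => ?_
  rw [Finset.sum_comm, Finset.sum_congr rfl fun j hj => h1 i hi j hj, Finset.sum_ite_eq' _ _ _,
    if_pos hi]

end ProductMeasure

/-! ### Estimators with a fixed schedule, and Chebyshev's inequality -/

section Sampling

variable {n m : ℕ} {Λ : Type} [Fintype Λ]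

/-- The fractions of ones in each group of outcomes. -/
noncomputable def frequencies (N : Λ → ℕ) (s : (Σ l, Fin (N l)) → Fin 2) (l : Λ) : ℝ :=
  (∑ i : Fin (N l), if s ⟨l, i⟩ = 1 then (1 : ℝ) else 0) / N l

/-- The estimator that makes `N l` measurements after `k l` Grover iterations for each `l` and
computes its output from the frequencies. -/
noncomputable def samplingEstimator (n m L : ℕ) (ω : ℝ) (θ φ : ℕ → ℝ) (N k : Λ → ℕ)
    (g : (Λ → ℝ) → ℝ) : Estimator n m where
  layers := L
  ω := ω
  θ := θ
  φ := φ
  rounds := Fintype.card (Σ l, Fin (N l))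
  iterations h := if hl : h.length < Fintype.card (Σ l, Fin (N l)) then
    k ((Fintype.equivFin _).symm ⟨h.length, hl⟩).1 else 0
  output s := g (frequencies N fun i => s (Fintype.equivFin _ i))

/-- Only the number of earlier outcomes is used: it identifies the round, hence the group it belongs
to. The fallback value for longer histories is never reached. -/
lemma samplingEstimator_roundCircuit (L : ℕ) (ω : ℝ) (θ φ : ℕ → ℝ) (N k : Λ → ℕ)
    (g : (Λ → ℝ) → ℝ) (s) (i : Σ l, Fin (N l)) :
    (samplingEstimator n m L ω θ φ N k g).roundCircuit s (Fintype.equivFin _ i) =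
      (Circuit.qppOnPurification n m ω θ φ L).grover (k i.1) := by
  have hlen : ((List.ofFn s).take (Fintype.equivFin _ i : Fin (Fintype.card (Σ l, Fin (N l))))).length =
      (Fintype.equivFin _ i : Fin (Fintype.card (Σ l, Fin (N l)))) := by
    rw [List.length_take, List.length_ofFn]
    exact min_eq_left (Fin.is_lt _).le
  have hk : ∀ len : ℕ, len = (Fintype.equivFin _ i : Fin (Fintype.card (Σ l, Fin (N l)))) →
      (if hl : len < Fintype.card (Σ l, Fin (N l)) then
        k ((Fintype.equivFin _).symm ⟨len, hl⟩).1 else 0) = k i.1 := by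
    rintro _ rfl
    rw [dif_pos (Fin.is_lt _)]
    simp only [Fin.eta, Equiv.symm_apply_apply]
  exact congrArg _ (hk _ hlen)

lemma samplingEstimator_queries (L : ℕ) (ω : ℝ) (θ φ : ℕ → ℝ) (N k : Λ → ℕ)
    (g : (Λ → ℝ) → ℝ) (s) :
    (samplingEstimator n m L ω θ φ N k g).queries s =
      (∑ l, N l * (2 * k l + 1)) * (2 * L + 1) := by
  have h := Equiv.sum_comp (Fintype.equivFin (Σ l, Fin (N l)))
    (fun i => ((samplingEstimator n m L ω θ φ N k g).roundCircuit s i).queries)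
  rw [Estimator.queries]
  refine h.symm.trans ?_
  simp only [samplingEstimator_roundCircuit, Circuit.queries_grover,
    Circuit.queries_qppOnPurification]
  rw [Fintype.sum_sigma, Finset.sum_mul]
  refine Finset.sum_congr rfl fun l _ => ?_
  simp [mul_assoc]

lemma samplingEstimator_isPlain (L : ℕ) (ω : ℝ) (θ φ : ℕ → ℝ) (N : Λ → ℕ) (g : (Λ → ℝ) → ℝ) :
    (samplingEstimator n m L ω θ φ N (fun _ => 0) g).IsPlain := fun h => by
  simp [samplingEstimator]

/-- If the output is accurate whenever all frequencies are close to the probabilities, then the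
estimator succeeds with the probability that Chebyshev's inequality guarantees. -/
theorem samplingEstimator_successProb {L : ℕ} {ω : ℝ} {θ φ : ℕ → ℝ} {N k : Λ → ℕ}
    {g : (Λ → ℝ) → ℝ} {U : Matrix (RegAB n m) (RegAB n m) ℂ}
    (hU : U ∈ Matrix.unitaryGroup (RegAB n m) ℂ) {c v ε δ : ℝ} (hc : 0 < c) (hN : ∀ l, 0 < N l)
    (hδ : ∑ l, 1 / (4 * c ^ 2 * N l) ≤ δ)
    (hg : ∀ f : Λ → ℝ, (∀ l, |f l - ((Circuit.qppOnPurification n m ω θ φ L).grover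
      (k l)).firstQubitProb U 1| ≤ c) → |g f - v| ≤ ε) :
    1 - δ ≤ (samplingEstimator n m L ω θ φ N k g).successProb U v ε := by
  classical
  set E := samplingEstimator n m L ω θ φ N k g with hE
  set e : (Σ l, Fin (N l)) ≃ Fin E.rounds := Fintype.equivFin _ with he
  set P : Λ → Fin 2 → ℝ := fun l b => ((Circuit.qppOnPurification n m ω θ φ L).grover
      (k l)).firstQubitProb U b with hP
  set w : (Σ l, Fin (N l)) → Fin 2 → ℝ := fun i b => P i.1 b with hw
  have hP0 : ∀ l b, 0 ≤ P l b := fun l b => firstQubitProb_nonneg _ _ _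
  have hP1 : ∀ l, P l 0 + P l 1 = 1 := fun l => firstQubitProb_add
    (Circuit.grover_mem_unitaryGroup (qppOnPurification_mem_unitaryGroup hU _ _ _ _) _)
  have hw1 : ∀ i, ∑ b, w i b = 1 := fun i => by rw [Fin.sum_univ_two]; exact hP1 _
  have hprob : ∀ s : Fin E.rounds → Fin 2, E.prob U s = ∏ i, w i (s (e i)) := by
    intro s
    rw [Estimator.prob, ← Equiv.prod_comp e]
    refine Finset.prod_congr rfl fun i _ => ?_
    rw [show E.roundCircuit s (e i) = _ from samplingEstimator_roundCircuit L ω θ φ N k g s i]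
  have hsum : E.successProb U v ε = ∑ s : (Σ l, Fin (N l)) → Fin 2,
      if |g (frequencies N s) - v| ≤ ε then ∏ i, w i (s i) else 0 := by
    rw [Estimator.successProb, Finset.sum_filter,
      ← Equiv.sum_comp (Equiv.arrowCongr e (Equiv.refl (Fin 2)))]
    refine Finset.sum_congr rfl fun s _ => ?_
    have h1 : ∀ i, (Equiv.arrowCongr e (Equiv.refl (Fin 2))) s (e i) = s i := fun i => by simp
    have h2 : E.output ((Equiv.arrowCongr e (Equiv.refl (Fin 2))) s) = g (frequencies N s) :=
      congrArg g (congrArg (frequencies N) (funext h1))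
    rw [hprob, h2]
    simp only [h1]
  have hcheb : ∀ l, ∑ s : (Σ l, Fin (N l)) → Fin 2, (∏ i, w i (s i)) * ((frequencies N s l - P l 1) ^ 2 / c ^ 2) ≤
      1 / (4 * c ^ 2 * N l) := by
    intro l
    have hNl : (0 : ℝ) < N l := by exact_mod_cast hN l
    set x : (Σ l, Fin (N l)) → Fin 2 → ℝ := fun _ b => (if b = 1 then 1 else 0) - P l 1 with hx
    set S : Finset (Σ l, Fin (N l)) := Finset.univ.map (Function.Embedding.sigmaMk l) with hS
    have h1 : ∀ s : (Σ l, Fin (N l)) → Fin 2, (frequencies N s l - P l 1) ^ 2 / c ^ 2 =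
        (∑ i ∈ S, x i (s i)) ^ 2 * (1 / (c ^ 2 * (N l : ℝ) ^ 2)) := by
      intro s
      have h2 : ∑ i ∈ S, x i (s i) = N l * (frequencies N s l - P l 1) := by
        rw [hS, Finset.sum_map]
        simp only [hx, Function.Embedding.sigmaMk_apply, Finset.sum_sub_distrib, frequencies]
        rw [mul_sub, mul_div_cancel₀ _ hNl.ne']
        simp
      rw [h2]
      field_simp
    simp only [h1, ← mul_assoc]
    rw [← Finset.sum_mul, sum_prod_weights_mul_sq hw1 S x]
    · have h3 : ∀ i ∈ S, ∑ b, w i b * x i b ^ 2 ≤ 1 / 4 := by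
        intro i hi
        obtain ⟨j, -, rfl⟩ := Finset.mem_map.mp hi
        have h4 : P l 0 = 1 - P l 1 := by linarith [hP1 l]
        simp only [Function.Embedding.sigmaMk_apply, Fin.sum_univ_two, hx, hw, h4]
        norm_num
        nlinarith [sq_nonneg (P l 1 - 1 / 2)]
      calc _ ≤ (∑ i ∈ S, (1 / 4 : ℝ)) * (1 / (c ^ 2 * (N l : ℝ) ^ 2)) :=
            mul_le_mul_of_nonneg_right (Finset.sum_le_sum h3) (by positivity)
        _ = 1 / (4 * c ^ 2 * N l) := by
            simp [hS]
            field_simp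
    · intro i hi
      obtain ⟨j, -, rfl⟩ := Finset.mem_map.mp hi
      have h4 : P l 0 = 1 - P l 1 := by linarith [hP1 l]
      simp only [Function.Embedding.sigmaMk_apply, Fin.sum_univ_two, hx, hw, h4]
      norm_num
      ring
  -- Markov and union bound at once, pointwise: a failing outcome has some frequency further than c
  -- from its probability, so the subtracted sum is at least the weight of the outcome.
  have hpt : ∀ s : (Σ l, Fin (N l)) → Fin 2, (∏ i, w i (s i)) -
      ∑ l, (∏ i, w i (s i)) * ((frequencies N s l - P l 1) ^ 2 / c ^ 2) ≤
      if |g (frequencies N s) - v| ≤ ε then ∏ i, w i (s i) else 0 := by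
    intro s
    have hpos : 0 ≤ ∏ i, w i (s i) := Finset.prod_nonneg fun i _ => hP0 _ _
    have hsn : ∀ l, 0 ≤ (∏ i, w i (s i)) * ((frequencies N s l - P l 1) ^ 2 / c ^ 2) :=
      fun l => by positivity
    split_ifs with hs
    · linarith [Finset.sum_nonneg fun l (_ : l ∈ Finset.univ) => hsn l]
    · obtain ⟨l, hl⟩ : ∃ l, c < |frequencies N s l - P l 1| := by
        by_contra! hcon
        exact hs (hg _ hcon)
      have h5 : 1 ≤ (frequencies N s l - P l 1) ^ 2 / c ^ 2 := by
        rw [le_div_iff₀ (by positivity), one_mul, ← sq_abs (frequencies N s l - P l 1)]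
        exact pow_le_pow_left₀ hc.le hl.le 2
      have h6 := Finset.single_le_sum (fun l _ => hsn l) (Finset.mem_univ l)
      nlinarith [mul_le_mul_of_nonneg_left h5 hpos]
  calc 1 - δ ≤ 1 - ∑ l, ∑ s : (Σ l, Fin (N l)) → Fin 2,
        (∏ i, w i (s i)) * ((frequencies N s l - P l 1) ^ 2 / c ^ 2) := by
        linarith [Finset.sum_le_sum fun l (_ : l ∈ Finset.univ) => hcheb l]
    _ = ∑ s : (Σ l, Fin (N l)) → Fin 2, ((∏ i, w i (s i)) -
        ∑ l, (∏ i, w i (s i)) * ((frequencies N s l - P l 1) ^ 2 / c ^ 2)) := by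
        rw [Finset.sum_sub_distrib, sum_prod_weights, Finset.prod_congr rfl fun i _ => hw1 i,
          Finset.prod_const_one, Finset.sum_comm]
    _ ≤ _ := by
        rw [hsum]
        exact Finset.sum_le_sum fun s _ => hpt s

/-- Repeated measurement estimates the flag probability to precision `e` with `O(1/e²)` uses of the
circuit. -/
theorem exists_plain_estimator {δ : ℝ} (hδ : 0 < δ) : ∃ C : ℝ, 0 < C ∧
    ∀ (n m L : ℕ) (ω : ℝ) (θ φ : ℕ → ℝ) (e : ℝ) (g : ℝ → ℝ), 0 < e → e ≤ 1 →
      ∃ E : Estimator n m, E.IsPlain ∧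
        (∀ U ∈ Matrix.unitaryGroup (RegAB n m) ℂ, ∀ v ε : ℝ,
          (∀ p, |p - (Circuit.qppOnPurification n m ω θ φ L).firstQubitProb U 1| ≤ e →
            |g p - v| ≤ ε) → 1 - δ ≤ E.successProb U v ε) ∧
        ∀ s, (E.queries s : ℝ) ≤ C * (2 * L + 1) / e ^ 2 := by
  -- The first term is Chebyshev's sample size with variance at most 1/4; the second pays for
  -- rounding up, using e ≤ 1.
  refine ⟨1 / (4 * δ) + 1, by positivity, fun n m L ω θ φ e g he he1 => ?_⟩
  set N := ⌈1 / (4 * δ * e ^ 2)⌉₊ with hN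
  have hNpos : 0 < N := Nat.ceil_pos.mpr (by positivity)
  refine ⟨samplingEstimator n m L ω θ φ (Λ := Unit) (fun _ => N) (fun _ => 0) (fun f => g (f ())),
    samplingEstimator_isPlain _ _ _ _ _ _, fun U hU v ε h => ?_, fun s => ?_⟩
  · refine samplingEstimator_successProb hU he (fun _ => hNpos) ?_ fun f hf => h _ (hf ())
    have h1 : 1 / (4 * δ * e ^ 2) ≤ N := Nat.le_ceil _
    have h2 : (0 : ℝ) < N := by exact_mod_cast hNpos
    rw [div_le_iff₀ (by positivity)] at h1
    simp only [Finset.univ_unique, Finset.sum_const, Finset.card_singleton, one_smul]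
    rw [div_le_iff₀ (by positivity)]
    linarith
  · rw [samplingEstimator_queries]
    have h1 : (N : ℝ) ≤ 1 / (4 * δ * e ^ 2) + 1 := (Nat.ceil_lt_add_one (by positivity)).le
    have h2 : (1 : ℝ) ≤ 1 / e ^ 2 := by
      rw [le_div_iff₀ (by positivity), one_mul]
      exact pow_le_one₀ he.le he1
    have h3 : (N : ℝ) ≤ (1 / (4 * δ) + 1) * (1 / e ^ 2) := by
      refine h1.trans ?_
      rw [add_mul, one_mul]
      refine add_le_add (le_of_eq ?_) h2
      field_simp
    have h4 := mul_le_mul_of_nonneg_right h3 (by positivity : (0 : ℝ) ≤ 2 * L + 1)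
    simp
    refine h4.trans (le_of_eq ?_)
    simp
    ring

end Sampling

/-! ### Amplitude estimation from odd multiples of the angle -/

section AmplitudeEstimation

/-- Under p = (1 - cos φ)/2 this window is that of flag probabilities in [1/4, 3/8]. -/
lemma mem_Icc_of_cos_mem {φ : ℝ} (h0 : φ ∈ Set.Icc 0 Real.pi)
    (h : Real.cos φ ∈ Set.Icc (1 / 4 : ℝ) (1 / 2)) : φ ∈ Set.Icc (Real.pi / 3) (Real.pi / 2) := by
  have hπ := Real.pi_pos
  constructor
  · by_contra! hlt
    have := Real.cos_lt_cos_of_nonneg_of_le_pi h0.1 (by linarith) hlt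
    rw [Real.cos_pi_div_three] at this
    linarith [h.2]
  · by_contra! hlt
    have := Real.cos_lt_cos_of_nonneg_of_le_pi (by positivity) h0.2 hlt
    rw [Real.cos_pi_div_two] at this
    linarith [h.1]

lemma sin_ge_of_cos_le_half {φ : ℝ} (h0 : φ ∈ Set.Icc 0 Real.pi)
    (h : Real.cos φ ∈ Set.Icc (1 / 4 : ℝ) (1 / 2)) : 4 / 5 ≤ Real.sin φ := by
  have h1 := Real.sin_nonneg_of_mem_Icc h0
  have h2 := Real.sin_sq_add_cos_sq φ
  nlinarith [h.1, h.2]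

/-- If the cosines of two neighbouring odd multiples of two close angles agree roughly, then the
angles are even closer. -/
lemma abs_sub_le_of_cos_close {x y M : ℝ} (hM : 1 < M) (hx : x ∈ Set.Icc 0 Real.pi)
    (hy : y ∈ Set.Icc 0 Real.pi) (hx' : Real.cos x ∈ Set.Icc (1 / 4 : ℝ) (1 / 2))
    (hy' : Real.cos y ∈ Set.Icc (1 / 4 : ℝ) (1 / 2)) (hxy : |x - y| ≤ Real.pi / (M + 1))
    (h1 : |Real.cos ((M + 1) * x) - Real.cos ((M + 1) * y)| ≤ 1 / 16)
    (h2 : |Real.cos ((M - 1) * x) - Real.cos ((M - 1) * y)| ≤ 1 / 16) :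
    |x - y| ≤ Real.pi * (5 / 32) / (M - 1) := by
  have hπ := Real.pi_pos
  -- The difference of cosines is 2 |sin(r(x+y)/2) sin(r(x-y)/2)|. If the first sine is at least
  -- 1/5, the second is at most 5/32; its argument is at most π/2 in absolute value, so Jordan's
  -- inequality bounds the argument itself.
  have key : ∀ r : ℝ, M - 1 ≤ r → r ≤ M + 1 → 1 / 5 ≤ |Real.sin (r * ((x + y) / 2))| →
      |Real.cos (r * x) - Real.cos (r * y)| ≤ 1 / 16 → |x - y| ≤ Real.pi * (5 / 32) / (M - 1) := by
    intro r hr hr' hs hc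
    have hr0 : 0 < r := by linarith
    rw [Real.cos_sub_cos, show (r * x + r * y) / 2 = r * ((x + y) / 2) by ring,
      show (r * x - r * y) / 2 = r * ((x - y) / 2) by ring, abs_mul, abs_mul, abs_neg,
      abs_of_pos (two_pos)] at hc
    set t := |r * ((x - y) / 2)| with ht
    have ht0 : 0 ≤ t := abs_nonneg _
    have htv : t = r * |x - y| / 2 := by
      rw [ht, abs_mul, abs_div, abs_of_pos hr0, abs_of_pos (two_pos : (0 : ℝ) < 2)]; ring
    have htπ : t ≤ Real.pi / 2 := by
      rw [htv]
      rw [le_div_iff₀ (by linarith)] at hxy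
      nlinarith [abs_nonneg (x - y)]
    have hsin : |Real.sin (r * ((x - y) / 2))| = Real.sin t := by
      rw [ht, Real.abs_sin_eq_sin_abs_of_abs_le_pi (by rw [← ht]; linarith)]
    have h3 : 2 / Real.pi * t ≤ Real.sin t := Real.mul_le_sin ht0 htπ
    rw [hsin] at hc
    have h4 : 2 / Real.pi * t ≤ 5 / 32 := by nlinarith
    rw [htv, div_mul_eq_mul_div, div_le_iff₀ hπ] at h4
    rw [le_div_iff₀ (by linarith)]
    nlinarith [abs_nonneg (x - y)]
  have hsin2 : 2 / 5 ≤ Real.sin (x + y) := by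
    rw [Real.sin_add]
    nlinarith [sin_ge_of_cos_le_half hx hx', sin_ge_of_cos_le_half hy hy', hx'.1, hy'.1]
  -- x + y is the difference of the two half-multiples, so their sines cannot both be below 1/5
  -- while sin(x + y) ≥ 2/5. This is why two neighbouring multiples are measured.
  have hsum : Real.sin (x + y) ≤ |Real.sin ((M + 1) * ((x + y) / 2))| +
      |Real.sin ((M - 1) * ((x + y) / 2))| := by
    set a := (M + 1) * ((x + y) / 2) with ha
    set b := (M - 1) * ((x + y) / 2) with hb
    rw [show x + y = a - b by rw [ha, hb]; ring, Real.sin_sub]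
    refine (le_abs_self _).trans ((abs_sub _ _).trans ?_)
    rw [abs_mul, abs_mul]
    exact add_le_add (mul_le_of_le_one_right (abs_nonneg _) (Real.abs_cos_le_one _))
      (mul_le_of_le_one_left (abs_nonneg _) (Real.abs_cos_le_one _))
  rcases le_or_gt (1 / 5) |Real.sin ((M + 1) * ((x + y) / 2))| with h | h
  · exact key (M + 1) (by linarith) le_rfl h h1
  · exact key (M - 1) le_rfl (by linarith) (by linarith) h2

/-- Rough values of the cosines of the odd multiples `4 ^ (j + 1) ± 1` of an angle determine it. -/
lemma abs_sub_le_of_cos_close_pow {x y : ℝ} (J : ℕ) (hx : x ∈ Set.Icc 0 Real.pi)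
    (hy : y ∈ Set.Icc 0 Real.pi) (hx' : Real.cos x ∈ Set.Icc (1 / 4 : ℝ) (1 / 2))
    (hy' : Real.cos y ∈ Set.Icc (1 / 4 : ℝ) (1 / 2))
    (h : ∀ j ≤ J, |Real.cos ((4 ^ (j + 1) + 1) * x) - Real.cos ((4 ^ (j + 1) + 1) * y)| ≤ 1 / 16 ∧
      |Real.cos ((4 ^ (j + 1) - 1) * x) - Real.cos ((4 ^ (j + 1) - 1) * y)| ≤ 1 / 16) :
    |x - y| ≤ 1 / 4 ^ (J + 1) := by
  have hπ := Real.pi_pos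
  have hpow : ∀ j : ℕ, (4 : ℝ) ≤ 4 ^ (j + 1) := fun j => by
    rw [pow_succ]
    nlinarith [one_le_pow₀ (show (1 : ℝ) ≤ 4 by norm_num) (n := j)]
  have hstep : ∀ j ≤ J, |x - y| ≤ Real.pi / (4 ^ (j + 1) + 1) →
      |x - y| ≤ Real.pi * (5 / 32) / (4 ^ (j + 1) - 1) := fun j hj hxy =>
    abs_sub_le_of_cos_close (by linarith [hpow j]) hx hy hx' hy' hxy (h j hj).1 (h j hj).2
  have hind : ∀ j ≤ J, |x - y| ≤ Real.pi / (4 ^ (j + 1) + 1) := by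
    intro j
    induction j with
    | zero =>
      intro _
      have h1 := mem_Icc_of_cos_mem hx hx'
      have h2 := mem_Icc_of_cos_mem hy hy'
      rw [abs_le]
      constructor <;> norm_num <;> linarith [h1.1, h1.2, h2.1, h2.2]
    | succ j ih =>
      intro hj
      refine (hstep j (by omega) (ih (by omega))).trans ?_
      have h4 := hpow j
      -- With M = 4^(j+1) this is 5(4M + 1) ≤ 32(M - 1), true for M ≥ 4: the gain at one level is
      -- enough to enter the next.
      rw [pow_succ (4 : ℝ) (j + 1), div_le_div_iff₀ (by linarith) (by linarith)]
      nlinarith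
  refine (hstep J le_rfl (hind J le_rfl)).trans ?_
  have h4 := hpow J
  rw [div_le_div_iff₀ (by linarith) (by linarith)]
  nlinarith [Real.pi_lt_d2]

/-- Amplitude estimation estimates the flag probability to precision `e` with `O(1/e)` uses of the
circuit. -/
theorem exists_amplitude_estimator {δ : ℝ} (hδ : 0 < δ) : ∃ C : ℝ, 0 < C ∧
    ∀ (n m L : ℕ) (ω : ℝ) (θ φ : ℕ → ℝ) (e : ℝ) (g : ℝ → ℝ), 0 < e → e ≤ 1 →
      ∃ E : Estimator n m,
        (∀ U ∈ Matrix.unitaryGroup (RegAB n m) ℂ,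
          (Circuit.qppOnPurification n m ω θ φ L).firstQubitProb U 1 ∈
            Set.Icc (1 / 4 : ℝ) (3 / 8) → ∀ v ε : ℝ,
          (∀ p, |p - (Circuit.qppOnPurification n m ω θ φ L).firstQubitProb U 1| ≤ e →
            |g p - v| ≤ ε) → 1 - δ ≤ E.successProb U v ε) ∧
        ∀ s, (E.queries s : ℝ) ≤ C * (2 * L + 1) / e := by
  classical
  -- With tolerance 1/64, level j fails with probability at most 2 · 1024 / (K 2^(J-j)); the
  -- geometric sum is at most 4096 / K.
  set K := ⌈4096 / δ⌉₊ with hK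
  have hKpos : 0 < K := Nat.ceil_pos.mpr (by positivity)
  have hKδ : 4096 / δ ≤ K := Nat.le_ceil _
  refine ⟨16 * K, by positivity, fun n m L ω θ φ e g he he1 => ?_⟩
  obtain ⟨J, hJ, hJ'⟩ := exists_nat_pow_near (x := 1 / e) (y := (4 : ℝ))
    ((one_le_div he).mpr he1) (by norm_num)
  -- Cheap low levels are repeated more often. The failure probabilities stay summable, and the cost
  -- ∑ 2^(J-j) 4^j remains of order 4^J, without a logarithm.
  set N : Fin (J + 1) × Bool → ℕ := fun l => K * 2 ^ (J - l.1) with hN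
  set k : Fin (J + 1) × Bool → ℕ := fun l =>
    if l.2 then 4 ^ (l.1 : ℕ) * 2 else 4 ^ (l.1 : ℕ) * 2 - 1 with hk
  have hkr : ∀ l, (2 * (k l : ℝ) + 1) = if l.2 then 4 ^ ((l.1 : ℕ) + 1) + 1
      else 4 ^ ((l.1 : ℕ) + 1) - 1 := by
    rintro ⟨j, b⟩
    have h1 : 1 ≤ 4 ^ (j : ℕ) * 2 := Nat.succ_le_of_lt (by positivity)
    cases b
    · simp only [hk, Bool.false_eq_true, if_false, Nat.cast_sub h1]
      push_cast
      ring
    · simp only [hk, if_true]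
      push_cast
      ring
  -- Any angle consistent with all frequencies will do; the fallback 0 is irrelevant, since the true
  -- angle is consistent whenever the frequencies are accurate.
  set good : (Fin (J + 1) × Bool → ℝ) → ℝ → Prop := fun f x =>
    x ∈ Set.Icc 0 Real.pi ∧ Real.cos x ∈ Set.Icc (1 / 4 : ℝ) (1 / 2) ∧
      ∀ l, |f l - (1 - Real.cos ((2 * k l + 1) * x)) / 2| ≤ 1 / 64 with hgood
  set est : (Fin (J + 1) × Bool → ℝ) → ℝ := fun f =>
    if h : ∃ x, good f x then (1 - Real.cos h.choose) / 2 else 0 with hest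
  refine ⟨samplingEstimator n m L ω θ φ N k (fun f => g (est f)), fun U hU hP v ε h => ?_,
    fun s => ?_⟩
  · refine samplingEstimator_successProb hU (c := 1 / 64) (by norm_num)
      (fun l => by positivity) ?_ fun f hf => h _ ?_
    · rw [Fintype.sum_prod_type, Finset.sum_congr rfl fun j _ => Fintype.sum_bool _]
      simp only [hN]
      rw [Fin.sum_univ_eq_sum_range (fun j => (1 : ℝ) / (4 * (1 / 64) ^ 2 * (K * 2 ^ (J - j) : ℕ)) +
        1 / (4 * (1 / 64) ^ 2 * (K * 2 ^ (J - j) : ℕ))) (J + 1), ← Finset.sum_range_reflect]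
      have hK' : (0 : ℝ) < K := by exact_mod_cast hKpos
      have h1 : ∀ j ∈ Finset.range (J + 1),
          (1 : ℝ) / (4 * (1 / 64) ^ 2 * (K * 2 ^ (J - (J + 1 - 1 - j)) : ℕ)) +
          1 / (4 * (1 / 64) ^ 2 * (K * 2 ^ (J - (J + 1 - 1 - j)) : ℕ)) =
          2048 / K * (1 / 2) ^ j := by
        intro j hj
        have hj' := Finset.mem_range.mp hj
        rw [show J - (J + 1 - 1 - j) = j by omega]
        push_cast
        rw [show ((1 : ℝ) / 2) ^ j = ((2 : ℝ) ^ j)⁻¹ by simp]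
        field_simp
        norm_num
      rw [Finset.sum_congr rfl h1, ← Finset.mul_sum]
      have h2 : ∑ j ∈ Finset.range (J + 1), (1 / 2 : ℝ) ^ j ≤ 2 := by
        rw [geom_sum_eq (by norm_num)]
        have : (0 : ℝ) < (1 / 2) ^ (J + 1) := by positivity
        rw [div_le_iff_of_neg (by norm_num)]
        linarith
      rw [div_le_iff₀ hδ] at hKδ
      refine (mul_le_mul_of_nonneg_left h2 (by positivity)).trans ?_
      rw [div_mul_eq_mul_div, div_le_iff₀ hK']
      linarith
    · set p := (Circuit.qppOnPurification n m ω θ φ L).firstQubitProb U 1 with hp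
      have hcos : Real.cos (Real.arccos (1 - 2 * p)) = 1 - 2 * p :=
        Real.cos_arccos (by linarith [hP.2]) (by linarith [hP.1])
      set x := Real.arccos (1 - 2 * p) with hx
      have hpx : p = (1 - Real.cos x) / 2 := by rw [hcos]; ring
      have hgr := fun l => firstQubitProb_grover
        (qppOnPurification_mem_unitaryGroup hU ω θ φ L) hpx (by linarith [hP.1])
        (by linarith [hP.2]) (k l)
      have hxgood : good f x := by
        refine ⟨⟨Real.arccos_nonneg _, Real.arccos_le_pi _⟩, ?_, fun l => ?_⟩
        · rw [hcos]
          constructor <;> linarith [hP.1, hP.2]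
        · rw [← hgr l]
          exact hf l
      have hex : ∃ x, good f x := ⟨x, hxgood⟩
      have hy := hex.choose_spec
      simp only [hest, dif_pos hex]
      set y := hex.choose
      -- Two consistent angles give probabilities within 2/64 of each other, hence cosines within
      -- 4/64.
      have hclose : ∀ l, |Real.cos ((2 * k l + 1) * x) - Real.cos ((2 * k l + 1) * y)| ≤ 1 / 16 := by
        intro l
        have h1 := abs_le.mp (hxgood.2.2 l)
        have h2 := abs_le.mp (hy.2.2 l)
        rw [abs_le]
        constructor <;> linarith [h1.1, h1.2, h2.1, h2.2]
      have hxy : |x - y| ≤ 1 / 4 ^ (J + 1) := by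
        refine abs_sub_le_of_cos_close_pow J hxgood.1 hy.1 hxgood.2.1 hy.2.1 fun j hj => ?_
        have h1 := hclose (⟨j, by omega⟩, true)
        have h2 := hclose (⟨j, by omega⟩, false)
        rw [hkr] at h1 h2
        exact ⟨by simpa using h1, by simpa using h2⟩
      have hlip : |Real.cos x - Real.cos y| ≤ |x - y| := by
        simpa [Real.dist_eq] using Real.lipschitzWith_cos.dist_le_mul x y
      have he4 : 1 / 4 ^ (J + 1) ≤ e := by
        rw [div_le_iff₀ (by positivity)]
        rw [div_lt_iff₀ he] at hJ'
        linarith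
      rw [hpx, show (1 - Real.cos y) / 2 - (1 - Real.cos x) / 2 = (Real.cos x - Real.cos y) / 2 by
        ring, abs_div, abs_of_pos (two_pos : (0 : ℝ) < 2)]
      linarith [abs_nonneg (x - y)]
  · rw [samplingEstimator_queries]
    push_cast
    have h1 : ∑ l, (N l : ℝ) * (2 * k l + 1) ≤ 16 * K * 4 ^ J := by
      simp only [hkr]
      rw [Fintype.sum_prod_type, Finset.sum_congr rfl fun j _ => Fintype.sum_bool _]
      simp only [hN, if_true, Bool.false_eq_true, if_false]
      rw [Fin.sum_univ_eq_sum_range (fun j => ((K * 2 ^ (J - j) : ℕ) : ℝ) * (4 ^ (j + 1) + 1) +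
        ((K * 2 ^ (J - j) : ℕ) : ℝ) * (4 ^ (j + 1) - 1)) (J + 1)]
      have h2 : ∀ j ∈ Finset.range (J + 1),
          ((K * 2 ^ (J - j) : ℕ) : ℝ) * (4 ^ (j + 1) + 1) +
          ((K * 2 ^ (J - j) : ℕ) : ℝ) * (4 ^ (j + 1) - 1) = 8 * K * 2 ^ J * 2 ^ j := by
        intro j hj
        obtain ⟨i, rfl⟩ := Nat.exists_eq_add_of_le (Nat.lt_succ_iff.mp (Finset.mem_range.mp hj))
        rw [Nat.add_sub_cancel_left]
        push_cast
        rw [show (4 : ℝ) ^ (j + 1) = 4 * (2 ^ j * 2 ^ j) by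
          rw [pow_succ, ← mul_pow]; norm_num; ring, pow_add]
        ring
      rw [Finset.sum_congr rfl h2, ← Finset.mul_sum, geom_sum_eq (by norm_num),
        show (4 : ℝ) ^ J = 2 ^ J * 2 ^ J by rw [← mul_pow]; norm_num, pow_succ]
      have h3 : (0 : ℝ) < K * 2 ^ J := by positivity
      nlinarith
    have h2 : (0 : ℝ) ≤ 2 * L + 1 := by positivity
    calc _ ≤ 16 * K * 4 ^ J * (2 * (L : ℝ) + 1) := mul_le_mul_of_nonneg_right h1 h2
      _ ≤ 16 * K * (1 / e) * (2 * (L : ℝ) + 1) := by gcongr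
      _ = _ := by ring

end AmplitudeEstimation

/-! ### Traces as sums over eigenvalues -/

section Spectrum

open Polynomial

variable {n : ℕ} {ρ : Matrix (Qubits n) (Qubits n) ℂ}

lemma trace_aeval_mul (h : ρ.IsHermitian) (f : ℝ[X]) :
    (aeval ρ (f.map (algebraMap ℝ ℂ)) * ρ).trace =
      ((∑ i, h.eigenvalues i * f.eval (h.eigenvalues i) : ℝ) : ℂ) := by
  have h1 : aeval ρ (f.map (algebraMap ℝ ℂ)) * ρ = cfc (fun x : ℝ => (X * f).eval x) ρ := by
    have h2 : cfc (fun x : ℝ => (X * f).eval x) ρ = aeval ρ (X * f) := cfc_polynomial (X * f) ρ h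
    rw [h2, aeval_map_algebraMap, mul_comm X f, map_mul, aeval_X]
  rw [h1, h.cfc_eq, Matrix.IsHermitian.cfc]
  simp [Matrix.trace_mul_cycle, Unitary.conjStarAlgAut_apply, Matrix.trace_diagonal]

lemma IsDensityMatrix.sum_eigenvalues (h : IsDensityMatrix ρ) :
    ∑ i, h.posSemidef.isHermitian.eigenvalues i = 1 := by
  have h1 := h.posSemidef.isHermitian.trace_eq_sum_eigenvalues
  rw [h.trace_eq_one] at h1
  exact Complex.ofReal_injective (by simpa using h1.symm)

lemma IsDensityMatrix.eigenvalues_mem_Icc (h : IsDensityMatrix ρ) (i : Qubits n) :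
    h.posSemidef.isHermitian.eigenvalues i ∈ Set.Icc (0 : ℝ) 1 := by
  refine ⟨h.posSemidef.eigenvalues_nonneg i, ?_⟩
  rw [← h.sum_eigenvalues]
  exact Finset.single_le_sum (fun j _ => h.posSemidef.eigenvalues_nonneg j) (Finset.mem_univ i)

lemma IsDensityMatrix.card_eigenvalues_ne_zero (h : IsDensityMatrix ρ) {κ : ℕ} (hκ : ρ.rank ≤ κ) :
    ((Finset.univ.filter fun i => h.posSemidef.isHermitian.eigenvalues i ≠ 0).card : ℝ) ≤ κ := by
  rw [h.posSemidef.isHermitian.rank_eq_card_non_zero_eigs, Fintype.card_subtype] at hκ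
  exact_mod_cast hκ

lemma IsDensityMatrix.traceRpow_le_one (h : IsDensityMatrix ρ) {α : ℝ} (hα : 1 < α) :
    traceRpow α ρ ≤ 1 := by
  rw [traceRpow_eq_sum α h.posSemidef.isHermitian, ← h.sum_eigenvalues]
  refine Finset.sum_le_sum fun i _ => ?_
  obtain ⟨h0, h1⟩ := h.eigenvalues_mem_Icc i
  simpa using Real.rpow_le_rpow_of_exponent_ge_of_imp h0 h1 hα.le (by intros; linarith)

/-- Concavity: x^α lies below its tangent at 1/κ (Bernoulli's inequality). Summed over the at most κ
nonzero eigenvalues, whose total is 1, the tangent gives the value of the maximally mixed state of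
rank κ. -/
lemma IsDensityMatrix.traceRpow_le_rpow (h : IsDensityMatrix ρ) {κ : ℕ} (hκ1 : 1 ≤ κ)
    (hκ : ρ.rank ≤ κ) {α : ℝ} (hα : 0 < α) (hα1 : α < 1) :
    traceRpow α ρ ≤ (κ : ℝ) ^ (1 - α) := by
  have hκ0 : (0 : ℝ) < κ := by exact_mod_cast hκ1
  rw [traceRpow_eq_sum α h.posSemidef.isHermitian]
  set l := h.posSemidef.isHermitian.eigenvalues with hl
  have h1 : ∀ i, l i ^ α ≤ (κ : ℝ) ^ (-α) * ((if l i ≠ 0 then (1 - α) else 0) + α * κ * l i) := by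
    intro i
    obtain ⟨h0, -⟩ := h.eigenvalues_mem_Icc i
    by_cases hz : l i = 0
    · rw [hz, Real.zero_rpow hα.ne']
      simp
    · rw [if_pos hz]
      have h2 := rpow_one_add_le_one_add_mul_self (s := κ * l i - 1)
        (by have : 0 ≤ κ * l i := by positivity
            linarith) hα.le hα1.le
      rw [show 1 + (κ * l i - 1) = κ * l i by ring, Real.mul_rpow hκ0.le h0] at h2
      calc l i ^ α = (κ : ℝ) ^ (-α) * ((κ : ℝ) ^ α * l i ^ α) := by
            rw [← mul_assoc, ← Real.rpow_add hκ0, neg_add_cancel, Real.rpow_zero, one_mul]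
        _ ≤ _ := by
            refine mul_le_mul_of_nonneg_left (h2.trans (le_of_eq ?_)) (by positivity)
            ring
  calc ∑ i, l i ^ α ≤ _ := Finset.sum_le_sum fun i _ => h1 i
    _ = (κ : ℝ) ^ (-α) * ((Finset.univ.filter fun i => l i ≠ 0).card * (1 - α) + α * κ) := by
        rw [← Finset.mul_sum, Finset.sum_add_distrib, ← Finset.mul_sum, h.sum_eigenvalues,
          ← Finset.sum_filter, Finset.sum_const, nsmul_eq_mul, mul_one]
    _ ≤ (κ : ℝ) ^ (-α) * (κ * (1 - α) + α * κ) := by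
        have := h.card_eigenvalues_ne_zero hκ
        have h3 : 0 ≤ 1 - α := by linarith
        gcongr
    _ = (κ : ℝ) ^ (1 - α) := by
        rw [show 1 - α = -α + 1 by ring, Real.rpow_add hκ0, Real.rpow_one]
        ring

/-- A zero eigenvalue contributes 0 to both sums, so the error is counted with the rank rather than
with the dimension. -/
lemma IsDensityMatrix.abs_sum_sub_traceRpow_le (h : IsDensityMatrix ρ) {κ : ℕ} (hκ : ρ.rank ≤ κ)
    {α : ℝ} (hα : 0 < α) {f : ℝ → ℝ} {B τ : ℝ} (hτ : 0 ≤ τ)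
    (hf : ∀ x, 0 < x → x ≤ 1 → |x * f x - B * x ^ α| ≤ τ) :
    |∑ i, h.posSemidef.isHermitian.eigenvalues i * f (h.posSemidef.isHermitian.eigenvalues i) -
      B * traceRpow α ρ| ≤ κ * τ := by
  rw [traceRpow_eq_sum α h.posSemidef.isHermitian, Finset.mul_sum, ← Finset.sum_sub_distrib]
  set l := h.posSemidef.isHermitian.eigenvalues with hl
  calc _ ≤ ∑ i, |l i * f (l i) - B * l i ^ α| := Finset.abs_sum_le_sum_abs _ _
    _ ≤ ∑ i, if l i ≠ 0 then τ else 0 := by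
        refine Finset.sum_le_sum fun i _ => ?_
        obtain ⟨h0, h1⟩ := h.eigenvalues_mem_Icc i
        split_ifs with hz
        · exact hf _ (lt_of_le_of_ne h0 (Ne.symm hz)) h1
        · rw [not_not.mp hz, Real.zero_rpow hα.ne']
          simp
    _ = (Finset.univ.filter fun i => l i ≠ 0).card * τ := by
        rw [← Finset.sum_filter, Finset.sum_const, nsmul_eq_mul]
    _ ≤ κ * τ := mul_le_mul_of_nonneg_right (h.card_eigenvalues_ne_zero hκ) hτ

end Spectrum

/-! ### From approximating polynomials to entropy estimators -/

section Reduction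

open Polynomial

/-- Angles for which the flag probability is an affine function of `tr(ρ h(ρ))`. -/
lemma exists_qpp_angles_affine {d : ℕ} {h : ℝ[X]} (hd : h.natDegree ≤ d)
    (hh : ∀ x ∈ Set.Icc (-1 : ℝ) 1, h.eval x ∈ Set.Icc (-1 : ℝ) 1)
    (hh0 : ∀ x ∈ Set.Icc (0 : ℝ) 1, 0 ≤ h.eval x) :
    ∃ (ω : ℝ) (θ φ : ℕ → ℝ), ∀ (n m : ℕ) (U : Matrix (RegAB n m) (RegAB n m) ℂ)
      (ρ : Matrix (Qubits n) (Qubits n) ℂ) (hρ : IsDensityMatrix ρ), IsPurifiedOracle U ρ →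
      (Circuit.qppOnPurification n m ω θ φ d).firstQubitProb U 1 =
        1 / 4 + (∑ i, hρ.posSemidef.isHermitian.eigenvalues i *
          h.eval (hρ.posSemidef.isHermitian.eigenvalues i)) / 8 ∧
      (Circuit.qppOnPurification n m ω θ φ d).firstQubitProb U 1 ∈ Set.Icc (1 / 4 : ℝ) (3 / 8) := by
  -- The affine map keeps the values strictly inside (0, 1) even where h is negative, and h ≥ 0 on
  -- the spectrum places the probability in the window that amplitude estimation needs.
  obtain ⟨ω, θ, φ, H⟩ := exists_qpp_angles d (C (1 / 4) + C (1 / 8) * h)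
    (natDegree_add_le_of_degree_le (by simp) ((natDegree_C_mul_le _ _).trans hd)) fun x hx => by
      have := hh x hx
      simp only [eval_add, eval_mul, eval_C]
      constructor <;> linarith [this.1, this.2]
  refine ⟨ω, θ, φ, fun n m U ρ hρ hU => ?_⟩
  have h1 := H n m U ρ hU
  rw [trace_aeval_mul hρ.posSemidef.isHermitian] at h1
  have h2 := Complex.ofReal_injective h1
  set l := hρ.posSemidef.isHermitian.eigenvalues with hl
  have h3 : (Circuit.qppOnPurification n m ω θ φ d).firstQubitProb U 1 =
      1 / 4 + (∑ i, l i * h.eval (l i)) / 8 := by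
    rw [h2]
    simp only [eval_add, eval_mul, eval_C, mul_add]
    rw [Finset.sum_add_distrib, ← Finset.sum_mul, hρ.sum_eigenvalues, Finset.sum_div]
    congr 1
    · ring
    · exact Finset.sum_congr rfl fun i _ => by ring
  have hl0 := fun i => hρ.eigenvalues_mem_Icc i
  have h4 : 0 ≤ ∑ i, l i * h.eval (l i) :=
    Finset.sum_nonneg fun i _ => mul_nonneg (hl0 i).1 (hh0 _ (hl0 i))
  have h5 : ∑ i, l i * h.eval (l i) ≤ 1 := by
    rw [← hρ.sum_eigenvalues]
    refine Finset.sum_le_sum fun i _ => mul_le_of_le_one_right (hl0 i).1 (hh _ ?_).2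
    exact ⟨by linarith [(hl0 i).1], (hl0 i).2⟩
  refine ⟨h3, ?_⟩
  rw [h3]
  constructor <;> linarith

lemma abs_log_sub_log_le {a b t : ℝ} (ht : 0 < t) (ha : t ≤ a) (hb : t ≤ b) :
    |Real.log a - Real.log b| ≤ |a - b| / t := by
  have key : ∀ a b : ℝ, t ≤ a → t ≤ b → Real.log a - Real.log b ≤ |a - b| / t := by
    intro a b ha hb
    have ha0 := ht.trans_le ha
    have hb0 := ht.trans_le hb
    rw [← Real.log_div ha0.ne' hb0.ne']
    calc Real.log (a / b) ≤ a / b - 1 := Real.log_le_sub_one_of_pos (by positivity)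
      _ = (a - b) / b := by field_simp
      _ ≤ |a - b| / b := by gcongr; exact le_abs_self _
      _ ≤ |a - b| / t := by gcongr
  refine abs_le'.mpr ⟨key a b ha hb, ?_⟩
  rw [neg_sub, abs_sub_comm]
  exact key b a hb ha

/-- Rescaling the flag probability and taking the logarithm gives an accurate entropy. -/
lemma abs_log_max_sub_renyiEntropy_le {n : ℕ} {ρ : Matrix (Qubits n) (Qubits n) ℂ}
    {α ε t B p P s : ℝ} (hα : α ≠ 1) (ht : 0 < t) (hB : 0 < B) (hT : t ≤ traceRpow α ρ)
    (hs : |s - B * traceRpow α ρ| ≤ B * t * |1 - α| * ε / 2) (hP : P = 1 / 4 + s / 8)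
    (hp : |p - P| ≤ B * t * |1 - α| * ε / 16) :
    |1 / (1 - α) * Real.log (max t (8 * (p - 1 / 4) / B)) - renyiEntropy α ρ| ≤ ε := by
  have hα' : 0 < |1 - α| := abs_pos.mpr (sub_ne_zero.mpr hα.symm)
  set T := traceRpow α ρ
  have h1 : |8 * (p - 1 / 4) / B - T| ≤ t * |1 - α| * ε := by
    have h2 : 8 * (p - 1 / 4) / B - T = (8 * (p - P) + (s - B * T)) / B := by
      rw [hP]; field_simp; ring
    rw [h2, abs_div, abs_of_pos hB, div_le_iff₀ hB]
    refine (abs_add_le _ _).trans ?_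
    rw [abs_mul, abs_of_pos (by norm_num : (0 : ℝ) < 8)]
    linarith
  -- Truncation at t is a contraction and fixes the true trace, and it makes the logarithm
  -- (1/t)-Lipschitz.
  have h3 : |max t (8 * (p - 1 / 4) / B) - T| ≤ t * |1 - α| * ε := by
    rw [show T = max t T from (max_eq_right hT).symm]
    exact (abs_max_sub_max_le_max _ _ _ _).trans
      (by rw [sub_self, abs_zero]; exact max_le ((abs_nonneg _).trans h1) h1)
  have h4 := abs_log_sub_log_le ht (le_max_left t (8 * (p - 1 / 4) / B)) hT
  rw [renyiEntropy, ← mul_sub, abs_mul, abs_div, abs_one, one_div_mul_eq_div, div_le_iff₀ hα']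
  refine h4.trans ?_
  rw [div_le_iff₀ ht]
  linarith

/-- A polynomial that approximates `B x ^ α / x` yields estimators of the entropy. -/
theorem exists_estimators_of_polynomial {δ : ℝ} (hδ : 0 < δ) : ∃ C : ℝ, 0 < C ∧
    ∀ (n m κ d : ℕ) (α ε t B τ : ℝ) (h : ℝ[X]), 0 < α → α ≠ 1 → 0 < ε → 0 < t → 0 < B →
      h.natDegree ≤ d → (∀ x ∈ Set.Icc (-1 : ℝ) 1, h.eval x ∈ Set.Icc (-1 : ℝ) 1) →
      (∀ x ∈ Set.Icc (0 : ℝ) 1, 0 ≤ h.eval x) → 0 ≤ τ →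
      (∀ x, 0 < x → x ≤ 1 → |x * h.eval x - B * x ^ α| ≤ τ) →
      κ * τ ≤ B * t * |1 - α| * ε / 2 → B * t * |1 - α| * ε / 16 ≤ 1 →
      (∃ E : Estimator n m, E.IsPlain ∧ E.EstimatesRenyi α ε δ κ t ∧
        ∀ s, (E.queries s : ℝ) ≤ C * (2 * d + 1) / (B * t * |1 - α| * ε / 16) ^ 2) ∧
      (∃ E : Estimator n m, E.EstimatesRenyi α ε δ κ t ∧
        ∀ s, (E.queries s : ℝ) ≤ C * (2 * d + 1) / (B * t * |1 - α| * ε / 16)) := by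
  obtain ⟨C₁, hC₁, H₁⟩ := exists_plain_estimator hδ
  obtain ⟨C₂, hC₂, H₂⟩ := exists_amplitude_estimator hδ
  refine ⟨max C₁ C₂, lt_max_of_lt_left hC₁, ?_⟩
  intro n m κ d α ε t B τ h hα hα1 hε ht hB hd hh hh0 hτ hτh hκτ he1
  have hα' : 0 < |1 - α| := abs_pos.mpr (sub_ne_zero.mpr hα1.symm)
  obtain ⟨ω, θ, φ, hang⟩ := exists_qpp_angles_affine hd hh hh0
  set e := B * t * |1 - α| * ε / 16 with he
  have he0 : 0 < e := by positivity
  obtain ⟨E₁, hplain, hE₁, hq₁⟩ := H₁ n m d ω θ φ e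
    (fun p => 1 / (1 - α) * Real.log (max t (8 * (p - 1 / 4) / B))) he0 he1
  obtain ⟨E₂, hE₂, hq₂⟩ := H₂ n m d ω θ φ e
    (fun p => 1 / (1 - α) * Real.log (max t (8 * (p - 1 / 4) / B))) he0 he1
  have hacc : ∀ (ρ : Matrix (Qubits n) (Qubits n) ℂ) (U : Matrix (RegAB n m) (RegAB n m) ℂ),
      IsDensityMatrix ρ → ρ.rank ≤ κ → t ≤ traceRpow α ρ → IsPurifiedOracle U ρ → ∀ p,
      |p - (Circuit.qppOnPurification n m ω θ φ d).firstQubitProb U 1| ≤ e →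
      |1 / (1 - α) * Real.log (max t (8 * (p - 1 / 4) / B)) - renyiEntropy α ρ| ≤ ε :=
    fun ρ U hρ hκ hT hU p hp => abs_log_max_sub_renyiEntropy_le hα1 ht hB hT
      ((hρ.abs_sum_sub_traceRpow_le hκ hα hτ hτh).trans hκτ) (hang n m U ρ hρ hU).1 hp
  refine ⟨⟨E₁, hplain, fun ρ U hρ hκ hT hU => hE₁ U hU.unitary _ _ (hacc ρ U hρ hκ hT hU),
    fun s => (hq₁ s).trans ?_⟩, ⟨E₂, fun ρ U hρ hκ hT hU => hE₂ U hU.unitary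
    (hang n m U ρ hρ hU).2 _ _ (hacc ρ U hρ hκ hT hU), fun s => (hq₂ s).trans ?_⟩⟩
  · gcongr
    exact le_max_left _ _
  · gcongr
    exact le_max_right _ _

/-- If the entropy is known to within `ε` beforehand, no queries are needed. -/
lemma exists_estimator_of_constant {δ : ℝ} (hδ : 0 < δ) (n m κ : ℕ) {α ε t : ℝ} (c : ℝ)
    (hc : ∀ ρ : Matrix (Qubits n) (Qubits n) ℂ, IsDensityMatrix ρ → ρ.rank ≤ κ →
      t ≤ traceRpow α ρ → |c - renyiEntropy α ρ| ≤ ε) :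
    ∃ E : Estimator n m, E.IsPlain ∧ E.EstimatesRenyi α ε δ κ t ∧ ∀ s, E.queries s = 0 := by
  -- With zero rounds there is a single, empty outcome of probability 1.
  refine ⟨⟨0, 0, fun _ => 0, fun _ => 0, 0, fun _ => 0, fun _ => c⟩, fun _ => rfl,
    fun ρ U hρ hκ hT hU => ?_, fun s => by simp [Estimator.queries]⟩
  have h1 := hc ρ hρ hκ hT
  rw [Estimator.successProb, Finset.filter_true_of_mem fun s _ => h1]
  simp [Estimator.prob]
  exact hδ.le

end Reduction

/-! ### Simplifying the stated query bounds -/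

section Bounds

lemma plainBound_nonneg {α ε t : ℝ} (κ : ℕ) (hα : 0 < α) (hε : 0 < ε) (ht : 0 < t) :
    0 ≤ plainBound α ε κ t := by
  have h1 := fun x => Real.posLog_nonneg (x := x)
  have h2 := h1 (t * κ / (|1 - α| * ε))
  have h3 := h1 (t⁻¹ * κ / (|1 - α| * ε))
  have h4 := h1 (t⁻¹ / (|1 - α| * ε))
  unfold plainBound eta
  split_ifs <;> positivity

lemma amplitudeBound_nonneg {α ε t : ℝ} (κ : ℕ) (hα : 0 < α) (hε : 0 < ε) (ht : 0 < t) :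
    0 ≤ amplitudeBound α ε κ t := by
  have h1 := fun x => Real.posLog_nonneg (x := x)
  have h2 := h1 (t * κ / (|1 - α| * ε))
  have h3 := h1 (t⁻¹ * κ / (|1 - α| * ε))
  have h4 := h1 (t⁻¹ / (|1 - α| * ε))
  unfold amplitudeBound eta
  split_ifs <;> positivity

/-- The logarithm lies below its tangent at e. This allows the constant output up to η/ε = e, beyond
which log(η/ε) ≥ 1. -/
lemma log_le_div_exp_one {x : ℝ} (hx : 0 < x) : Real.log x ≤ x / Real.exp 1 := by
  have h := Real.add_one_le_exp (Real.log x - 1)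
  rw [Real.exp_sub, Real.exp_log hx] at h
  linarith

/-- Both bounds for `α > 1` in terms of `y = η / ε`. -/
lemma le_bounds_of_one_lt {α ε t y : ℝ} {κ : ℕ} (hα : 1 < α) (hε : 0 < ε) (ht : 0 < t)
    (ht1 : t ≤ 1) (hκ : 1 ≤ κ) (hy : y = eta α t / ε) (hy1 : Real.exp 1 ≤ y) :
    y ^ 2 * (α + κ * y) ≤ 2 * plainBound α ε κ t ∧ y * (α + κ * y) ≤ 2 * amplitudeBound α ε κ t := by
  have hα1 : 0 < α - 1 := by linarith
  have habs : |1 - α| = α - 1 := by rw [abs_sub_comm, abs_of_pos hα1]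
  have hκ1 : (1 : ℝ) ≤ κ := by exact_mod_cast hκ
  have hκ0 : (0 : ℝ) < κ := by linarith
  have hy0 : 0 < y := (Real.exp_pos 1).trans_le hy1
  have hη : eta α t = y * ε := by rw [hy]; field_simp
  have hyt : t⁻¹ / (|1 - α| * ε) = y := by rw [hy, eta, div_div]
  have hκy : t⁻¹ * κ / (|1 - α| * ε) = κ * y := by rw [← hyt]; ring
  have hpos : ∀ z, Real.exp 1 ≤ z → 1 ≤ Real.posLog z := fun z hz => by
    rw [Real.posLog_apply]
    exact le_max_of_le_right ((Real.le_log_iff_exp_le ((Real.exp_pos 1).trans_le hz)).mpr hz)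
  have hB := hpos y hy1
  have hA := hpos (κ * y) (hy1.trans (le_mul_of_one_le_left hy0.le hκ1))
  -- yε = η = 1/((α - 1) t) is at least 1/α because t ≤ 1; so the summand α² ε / (2κ) of the bound
  -- pays for the α layers of the exact monomial.
  have hlin : α ≤ y * (α ^ 2 * ε) := by
    have h1 : y * (α ^ 2 * ε) = α * (α / ((α - 1) * t)) := by
      rw [hy, eta, habs]; field_simp
    rw [h1]
    refine le_mul_of_one_le_right (by linarith) ?_
    rw [one_le_div (by positivity)]
    nlinarith
  rw [plainBound, amplitudeBound, if_neg (not_lt.mpr hα.le), if_neg (not_lt.mpr hα.le), hη, hyt, hκy]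
  set A := Real.posLog (κ * y)
  set B := Real.posLog y
  have hAB : 1 ≤ A * B := one_le_mul_of_one_le_of_one_le hA hB
  have hbr : α / (κ * y) + 2 ≤ 2 * (α ^ 2 * ε / (2 * κ) + A * B) := by
    have h1 : α / (κ * y) ≤ 2 * (α ^ 2 * ε / (2 * κ)) := by
      rw [show 2 * (α ^ 2 * ε / (2 * κ)) = y * (α ^ 2 * ε) / (κ * y) by field_simp]
      gcongr
    linarith
  have hbr0 : 0 ≤ α / (κ * y) + 2 := by positivity
  have h2 : (α + κ * y) ≤ κ * y * (α / (κ * y) + 2) := by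
    rw [mul_add, mul_div_cancel₀ _ (by positivity)]
    nlinarith [mul_pos hκ0 hy0]
  have hA2 : 1 ≤ A ^ 2 := one_le_pow₀ hA
  constructor
  · calc y ^ 2 * (α + κ * y) ≤ y ^ 2 * (κ * y * (α / (κ * y) + 2)) := by gcongr
      _ ≤ y ^ 2 * (κ * y * (2 * (α ^ 2 * ε / (2 * κ) + A * B))) := by gcongr
      _ ≤ y ^ 2 * (κ * y * (2 * (α ^ 2 * ε / (2 * κ) + A * B))) * A ^ 2 :=
          le_mul_of_one_le_right (by positivity) hA2
      _ = _ := by field_simp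
  · calc y * (α + κ * y) ≤ y * (κ * y * (α / (κ * y) + 2)) := by gcongr
      _ ≤ y * (κ * y * (2 * (α ^ 2 * ε / (2 * κ) + A * B))) := by gcongr
      _ ≤ y * (κ * y * (2 * (α ^ 2 * ε / (2 * κ) + A * B))) * A :=
          le_mul_of_one_le_right (by positivity) hA
      _ = _ := by field_simp

/-- Both bounds for `α < 1` in terms of `z = 16 κ η / ε`. -/
lemma le_bounds_of_lt_one {α ε t z : ℝ} {κ : ℕ} (hα0 : 0 < α) (hα : α < 1) (hε : 0 < ε)
    (ht : 0 < t) (hκ : 1 ≤ κ) (hz : z = 16 * κ * (eta α t / ε)) :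
    z ^ (3 / α) / (κ : ℝ) ^ 2 ≤ plainBound α ε κ t ∧ z ^ (2 / α) / κ ≤ amplitudeBound α ε κ t := by
  have hκ0 : (0 : ℝ) < κ := by exact_mod_cast hκ
  have hη : 0 < eta α t := by
    have : 0 < |1 - α| := abs_pos.mpr (by linarith)
    unfold eta
    positivity
  have hzr : ∀ r : ℝ, z ^ r = 2 ^ (4 * r) * (κ : ℝ) ^ r * eta α t ^ r / ε ^ r := by
    intro r
    rw [hz, Real.mul_rpow (by positivity) (by positivity), Real.mul_rpow (by norm_num) hκ0.le,
      Real.div_rpow hη.le hε.le, Real.rpow_mul (by norm_num)]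
    norm_num
    ring
  -- The bracket is at least 3 and α < 1, so bracket over α can be multiplied in for free.
  have hbr : 1 ≤ (3 + Real.posLog (t * κ / (|1 - α| * ε))) / α := by
    rw [one_le_div hα0]
    have := Real.posLog_nonneg (x := t * κ / (|1 - α| * ε))
    linarith
  rw [plainBound, amplitudeBound, if_pos hα, if_pos hα, hzr, hzr]
  set b := 3 + Real.posLog (t * κ / (|1 - α| * ε))
  constructor
  · calc _ ≤ (2 ^ (4 * (3 / α)) * (κ : ℝ) ^ (3 / α) * eta α t ^ (3 / α) / ε ^ (3 / α) /
          (κ : ℝ) ^ 2) * (b / α) := le_mul_of_one_le_right (by positivity) hbr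
      _ = _ := by
        rw [Real.rpow_sub hκ0, show (4 : ℝ) * (3 / α) = 12 / α by ring,
          show ((κ : ℝ) ^ (2 : ℝ)) = (κ : ℝ) ^ 2 by exact_mod_cast Real.rpow_natCast (κ : ℝ) 2]
        field_simp
  · calc _ ≤ (2 ^ (4 * (2 / α)) * (κ : ℝ) ^ (2 / α) * eta α t ^ (2 / α) / ε ^ (2 / α) /
          κ) * (b / α) := le_mul_of_one_le_right (by positivity) hbr
      _ = _ := by
        rw [Real.rpow_sub hκ0, show (4 : ℝ) * (2 / α) = 8 / α by ring, Real.rpow_one]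
        field_simp

end Bounds

/-! ### Polynomial approximation of powers -/

section PowerApproximation

open Polynomial

/-- By monotonicity of the power, the left side is at most the difference of x^(1+s) at the two
points, and x^(1+s) is 2-Lipschitz on [0, 1]. -/
lemma mul_abs_rpow_sub_rpow_le {s a b : ℝ} (hs0 : 0 ≤ s) (hs1 : s ≤ 1) (ha : a ∈ Set.Icc (0 : ℝ) 1)
    (hb : b ∈ Set.Icc (0 : ℝ) 1) : a * |b ^ s - a ^ s| ≤ 2 * |a - b| := by
  have key : ∀ a b : ℝ, a ∈ Set.Icc (0 : ℝ) 1 → b ∈ Set.Icc (0 : ℝ) 1 → a ≤ b →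
      b ^ s * b - a ^ s * a ≤ 2 * (b - a) := by
    intro a b ha hb hab
    rcases hb.1.eq_or_lt with h0 | h0
    · rw [← h0] at hab ⊢
      rw [le_antisymm hab ha.1]
      simp
    · have h1 : b ^ s * b - a ^ s * a ≤ 2 * (b - a) := by
        have hb1 : b ^ s ≤ 1 := Real.rpow_le_one hb.1 hb.2 hs0
        have h2 : b ^ s * (a / b) ≤ a ^ s := by
          have h3 : a / b ≤ (a / b) ^ s := by
            simpa using Real.rpow_le_rpow_of_exponent_ge_of_imp (div_nonneg ha.1 hb.1)
              ((div_le_one h0).mpr hab) hs1 (by intros; linarith)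
          calc b ^ s * (a / b) ≤ b ^ s * (a / b) ^ s := by
                gcongr
            _ = a ^ s := by
                rw [← Real.mul_rpow hb.1 (div_nonneg ha.1 hb.1), mul_div_cancel₀ _ h0.ne']
        have h4 := mul_le_mul_of_nonneg_right h2 ha.1
        have h5 : b ^ s * b - b ^ s * (a / b) * a = b ^ s * ((b + a) / b) * (b - a) := by
          field_simp
          ring
        have h6 : b ^ s * ((b + a) / b) ≤ 2 := by
          have : (b + a) / b ≤ 2 := by rw [div_le_iff₀ h0]; linarith
          have h7 : 0 ≤ (b + a) / b := by have := ha.1; positivity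
          nlinarith [Real.rpow_nonneg hb.1 s]
        nlinarith [mul_le_mul_of_nonneg_right h6 (sub_nonneg.mpr hab)]
      exact h1
  rcases le_total a b with hab | hab
  · have h1 : a ^ s ≤ b ^ s := Real.rpow_le_rpow ha.1 hab hs0
    rw [abs_of_nonneg (by linarith), abs_of_nonpos (by linarith : a - b ≤ 0)]
    have h2 := key a b ha hb hab
    nlinarith [mul_le_mul_of_nonneg_left hab (Real.rpow_nonneg hb.1 s)]
  · have h1 : b ^ s ≤ a ^ s := Real.rpow_le_rpow hb.1 hab hs0
    rw [abs_of_nonpos (by linarith), abs_of_nonneg (by linarith : 0 ≤ a - b)]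
    have h2 := key b a hb ha hab
    nlinarith [mul_le_mul_of_nonneg_left hab (Real.rpow_nonneg hb.1 s)]

/-- Approximation of `x ^ (α - 1)` for `α ≥ 1`. -/
lemma exists_approx_of_one_lt {α : ℝ} (hα : 1 < α) (d : ℕ) : ∃ h : ℝ[X],
    h.natDegree ≤ d + ⌊α - 1⌋₊ ∧ (∀ x ∈ Set.Icc (-1 : ℝ) 1, h.eval x ∈ Set.Icc (-1 : ℝ) 1) ∧
      (∀ x ∈ Set.Icc (0 : ℝ) 1, 0 ≤ h.eval x) ∧
      ∀ x, 0 < x → x ≤ 1 → |x * h.eval x - 1 * x ^ α| ≤ 2 * (Real.pi / (d + 2)) := by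
  -- Only the fractional part of the exponent is approximated. The integer part is an exact factor
  -- X^k, so α enters the degree additively.
  set k := ⌊α - 1⌋₊ with hk
  set s := α - 1 - k with hs
  have hs0 : 0 ≤ s := sub_nonneg.mpr (Nat.floor_le (by linarith))
  have hs1 : s ≤ 1 := by linarith [Nat.lt_floor_add_one (α - 1)]
  set F : ℝ → ℝ := fun x => |x| ^ s with hF
  have habs : ∀ x ∈ Set.Icc (-1 : ℝ) 1, |x| ∈ Set.Icc (0 : ℝ) 1 := fun x hx =>
    ⟨abs_nonneg _, abs_le.mpr hx⟩
  have hF01 : ∀ x ∈ Set.Icc (-1 : ℝ) 1, F x ∈ Set.Icc (0 : ℝ) 1 := fun x hx =>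
    ⟨by positivity, Real.rpow_le_one (abs_nonneg _) (habs x hx).2 hs0⟩
  have hq := fun x (hx : x ∈ Set.Icc (-1 : ℝ) 1) => korovkinPoly_mem_Icc d hF01 hx
  refine ⟨X ^ k * korovkinPoly d F, ?_, fun x hx => ?_, fun x hx => ?_, fun x hx0 hx1 => ?_⟩
  · refine natDegree_mul_le.trans ?_
    rw [natDegree_X_pow, add_comm]
    gcongr
    exact natDegree_korovkinPoly_le d F
  · rw [eval_mul, eval_pow, eval_X, Set.mem_Icc, ← abs_le, abs_mul, abs_pow,
      abs_of_nonneg (hq x hx).1]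
    exact mul_le_one₀ (pow_le_one₀ (abs_nonneg _) (habs x hx).2) (hq x hx).1 (hq x hx).2
  · rw [eval_mul, eval_pow, eval_X]
    exact mul_nonneg (pow_nonneg hx.1 _) (hq x ⟨by linarith [hx.1], hx.2⟩).1
  · have hx : x ∈ Set.Icc (-1 : ℝ) 1 := ⟨by linarith, hx1⟩
    have h1 := abs_korovkinPoly_sub_le d (F := F) hx hx0.le (zero_le_two (α := ℝ)) fun y hy => by
      have h2 := mul_abs_rpow_sub_rpow_le hs0 hs1 ⟨hx0.le, hx1⟩ (habs y hy)
      have h3 : |x - abs y| ≤ |x - y| := by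
        conv_lhs => rw [← abs_of_pos hx0]
        exact abs_abs_sub_abs_le_abs_sub x y
      simp only [hF, abs_of_pos hx0]
      linarith
    have h4 : x ^ α = x ^ k * (x * F x) := by
      simp only [hF, abs_of_pos hx0]
      rw [show α = k + (1 + s) by rw [hs]; ring, Real.rpow_add hx0, Real.rpow_add hx0,
        Real.rpow_one, Real.rpow_natCast]
    rw [eval_mul, eval_pow, eval_X, h4, show x * (x ^ k * (korovkinPoly d F).eval x) -
      1 * (x ^ k * (x * F x)) = x ^ k * (x * ((korovkinPoly d F).eval x - F x)) by ring, abs_mul,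
      abs_mul, abs_of_pos hx0, abs_of_pos (pow_pos hx0 k)]
    exact (mul_le_of_le_one_left (by positivity) (pow_le_one₀ hx0.le hx1)).trans h1

/-- Since x^α is increasing, replacing a^α by b^α bounds the left side by b^(α-1) |a - b|, and b ≥
c. -/
lemma mul_abs_rpow_neg_sub_le {α c a b : ℝ} (hα0 : 0 < α) (hα : α < 1) (hc : 0 < c) (ha : c ≤ a)
    (hb : c ≤ b) : a * |b ^ (α - 1) - a ^ (α - 1)| ≤ c ^ (α - 1) * |a - b| := by
  have ha0 := hc.trans_le ha
  have hb0 := hc.trans_le hb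
  have hα' : α - 1 ≤ 0 := by linarith
  have hsplit : ∀ x : ℝ, 0 < x → x ^ (α - 1) * x = x ^ α := fun x hx => by
    rw [Real.rpow_sub_one hx.ne', div_mul_cancel₀ _ hx.ne']
  have hbc : b ^ (α - 1) ≤ c ^ (α - 1) := Real.rpow_le_rpow_of_nonpos hc hb hα'
  rcases le_total a b with hab | hab
  · have h1 : b ^ (α - 1) ≤ a ^ (α - 1) := Real.rpow_le_rpow_of_nonpos ha0 hab hα'
    have h2 : a ^ α ≤ b ^ α := Real.rpow_le_rpow ha0.le hab hα0.le
    rw [← hsplit a ha0, ← hsplit b hb0] at h2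
    rw [abs_of_nonpos (by linarith), abs_of_nonpos (by linarith : a - b ≤ 0)]
    nlinarith [mul_le_mul_of_nonneg_right hbc (sub_nonneg.mpr hab)]
  · have h1 : a ^ (α - 1) ≤ b ^ (α - 1) := Real.rpow_le_rpow_of_nonpos hb0 hab hα'
    have h2 : b ^ α ≤ a ^ α := Real.rpow_le_rpow hb0.le hab hα0.le
    rw [← hsplit a ha0, ← hsplit b hb0] at h2
    rw [abs_of_nonneg (by linarith), abs_of_nonneg (by linarith : 0 ≤ a - b)]
    nlinarith [mul_le_mul_of_nonneg_right hbc (sub_nonneg.mpr hab)]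

/-- Approximation of `x ^ (α - 1)`, cut off at `c` and normalized, for `α < 1`. -/
lemma exists_approx_of_lt_one {α c : ℝ} (hα0 : 0 < α) (hα : α < 1) (hc : 0 < c)
    {d : ℕ} (hd : Real.pi / c ≤ d) : ∃ h : ℝ[X],
    h.natDegree ≤ d ∧ (∀ x ∈ Set.Icc (-1 : ℝ) 1, h.eval x ∈ Set.Icc (-1 : ℝ) 1) ∧
      (∀ x ∈ Set.Icc (0 : ℝ) 1, 0 ≤ h.eval x) ∧
      ∀ x, 0 < x → x ≤ 1 → |x * h.eval x - c ^ (1 - α) * x ^ α| ≤ 2 * c := by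
  have hα' : α - 1 ≤ 0 := by linarith
  have hB : 0 < c ^ (1 - α) := Real.rpow_pos_of_pos hc _
  have hBc : c ^ (1 - α) * c ^ (α - 1) = 1 := by
    rw [← Real.rpow_add hc, show 1 - α + (α - 1) = 0 by ring, Real.rpow_zero]
  -- The factor c^(1-α) scales the maximum of the cut-off power to 1.
  set F : ℝ → ℝ := fun x => c ^ (1 - α) * max |x| c ^ (α - 1) with hF
  have hF01 : ∀ x ∈ Set.Icc (-1 : ℝ) 1, F x ∈ Set.Icc (0 : ℝ) 1 := fun x hx => by
    refine ⟨mul_nonneg hB.le (Real.rpow_nonneg (hc.le.trans (le_max_right _ _)) _), ?_⟩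
    rw [← hBc]
    exact mul_le_mul_of_nonneg_left (Real.rpow_le_rpow_of_nonpos hc (le_max_right _ _) hα') hB.le
  have hq := fun x (hx : x ∈ Set.Icc (-1 : ℝ) 1) => korovkinPoly_mem_Icc d hF01 hx
  refine ⟨korovkinPoly d F, natDegree_korovkinPoly_le d F, fun x hx =>
    ⟨by linarith [(hq x hx).1], (hq x hx).2⟩, fun x hx => (hq x ⟨by linarith [hx.1], hx.2⟩).1,
    fun x hx0 hx1 => ?_⟩
  have hx : x ∈ Set.Icc (-1 : ℝ) 1 := ⟨by linarith, hx1⟩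
  set a := max |x| c with ha
  have hxa : x ≤ a := (le_abs_self x).trans (le_max_left _ _)
  have h1 := abs_korovkinPoly_sub_le d (F := F) hx (hx0.le.trans hxa) zero_le_one fun y hy => by
    have h2 := mul_abs_rpow_neg_sub_le hα0 hα hc (le_max_right |x| c) (le_max_right |y| c)
    have h3 : |max |x| c - max |y| c| ≤ |x - y| :=
      (abs_max_sub_max_le_abs _ _ _).trans (abs_abs_sub_abs_le_abs_sub x y)
    simp only [hF, ← mul_sub, abs_mul, abs_of_pos hB]
    calc _ = c ^ (1 - α) * (a * |max |y| c ^ (α - 1) - max |x| c ^ (α - 1)|) := by ring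
      _ ≤ c ^ (1 - α) * (c ^ (α - 1) * |max |x| c - max |y| c|) := by gcongr
      _ ≤ 1 * |x - y| := by rw [← mul_assoc, hBc]; gcongr
  have h4 : Real.pi / (d + 2) ≤ c := by
    rw [div_le_iff₀ hc] at hd
    rw [div_le_iff₀ (by positivity)]
    nlinarith
  -- The budget 2c is split evenly: c for the polynomial approximation here, c for the cutoff, which
  -- matters only below c, where both functions lie in [0, c].
  have h5 : |x * (korovkinPoly d F).eval x - x * F x| ≤ c := by
    rw [← mul_sub, abs_mul, abs_of_pos hx0]
    exact (mul_le_mul_of_nonneg_right hxa (abs_nonneg _)).trans (h1.trans (by linarith))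
  have h6 : |x * F x - c ^ (1 - α) * x ^ α| ≤ c := by
    have hxα : x ^ α = x * x ^ (α - 1) := by
      rw [Real.rpow_sub_one hx0.ne', mul_div_cancel₀ _ hx0.ne']
    simp only [hF, abs_of_pos hx0]
    rcases le_total c x with hcx | hcx
    · rw [max_eq_left hcx, hxα, mul_left_comm, sub_self, abs_zero]
      exact hc.le
    · rw [max_eq_right hcx, hBc, mul_one]
      have h7 : c ^ (1 - α) * x ^ α ≤ c := by
        calc c ^ (1 - α) * x ^ α ≤ c ^ (1 - α) * c ^ α := by gcongr
          _ = c := by rw [← Real.rpow_add hc]; simp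
      have h8 : 0 ≤ c ^ (1 - α) * x ^ α := by positivity
      rw [abs_le]
      constructor <;> linarith
  calc _ = |(x * (korovkinPoly d F).eval x - x * F x) + (x * F x - c ^ (1 - α) * x ^ α)| := by
        congr 1; ring
    _ ≤ _ := (abs_add_le _ _).trans (by linarith)

end PowerApproximation

/-! ### Choice of parameters and proof of the bounds -/

section Estimation

lemma exists_estimators_of_one_lt {δ : ℝ} (hδ : 0 < δ) : ∃ C : ℝ, 0 < C ∧
    ∀ (n m κ : ℕ) (α ε t : ℝ), 1 ≤ κ → 1 < α → 0 < ε → 0 < t →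
      (∃ E : Estimator n m, E.IsPlain ∧ E.EstimatesRenyi α ε δ κ t ∧
        ∀ s, (E.queries s : ℝ) ≤ C * plainBound α ε κ t) ∧
      (∃ E : Estimator n m, E.EstimatesRenyi α ε δ κ t ∧
        ∀ s, (E.queries s : ℝ) ≤ C * amplitudeBound α ε κ t) := by
  obtain ⟨C, hC, H⟩ := exists_estimators_of_polynomial hδ
  refine ⟨C * 256 * 30 * 2, by positivity, fun n m κ α ε t hκ hα hε ht => ?_⟩
  have hα0 : 0 < α := by linarith
  have hα1 : 0 < α - 1 := by linarith
  have habs : |1 - α| = α - 1 := by rw [abs_sub_comm, abs_of_pos hα1]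
  obtain ⟨y, hy⟩ : ∃ y, y = eta α t / ε := ⟨_, rfl⟩
  have hy0 : 0 < y := by rw [hy, eta, habs]; positivity
  have hinv : t * |1 - α| * ε = 1 / y := by rw [hy, eta, habs]; field_simp
  -- For t > 1 no state qualifies. For y ≤ e the logarithms in the bound may vanish, but then 0 ≤
  -- -log tr(ρ^α) ≤ (α - 1) ε and the output 0 is accurate.
  by_cases htriv : 1 < t ∨ y ≤ Real.exp 1
  · obtain ⟨E, hE1, hE2, hE3⟩ := exists_estimator_of_constant hδ n m κ (α := α) (ε := ε) (t := t) 0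
      fun ρ hρ hrank hT => by
        have hT1 := hρ.traceRpow_le_one hα
        have hT0 : 0 < traceRpow α ρ := ht.trans_le hT
        rcases htriv with h | h
        · linarith
        · have h1 : -Real.log (traceRpow α ρ) ≤ (α - 1) * ε := by
            rw [← Real.log_inv]
            refine (log_le_div_exp_one (by positivity)).trans ?_
            rw [div_le_iff₀ (Real.exp_pos 1)]
            calc (traceRpow α ρ)⁻¹ ≤ t⁻¹ := by gcongr
              _ = (α - 1) * ε * y := by rw [hy, eta, habs]; field_simp
              _ ≤ _ := by gcongr
          have h2 : Real.log (traceRpow α ρ) ≤ 0 := Real.log_nonpos hT0.le hT1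
          rw [renyiEntropy, zero_sub, abs_neg, abs_mul, abs_div, abs_one, habs, abs_of_nonpos h2,
            one_div_mul_eq_div, div_le_iff₀ hα1]
          linarith
    refine ⟨⟨E, hE1, hE2, fun s => ?_⟩, ⟨E, hE2, fun s => ?_⟩⟩
    · rw [hE3, Nat.cast_zero]
      exact mul_nonneg (by positivity) (plainBound_nonneg κ hα0 hε ht)
    · rw [hE3, Nat.cast_zero]
      exact mul_nonneg (by positivity) (amplitudeBound_nonneg κ hα0 hε ht)
  · push Not at htriv
    obtain ⟨ht1, hy1⟩ := htriv
    have hκ1 : (1 : ℝ) ≤ κ := by exact_mod_cast hκ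
    have hyone : 1 ≤ y := (Real.one_le_exp zero_le_one).trans hy1.le
    have hκy : 1 ≤ κ * y := one_le_mul_of_one_le_of_one_le hκ1 hyone
    -- Chosen so that κ · 2π/(d + 2) ≤ 1/(2y), half of the precision required of the trace.
    obtain ⟨d, hd⟩ : ∃ d, d = ⌈4 * Real.pi * (κ * y)⌉₊ := ⟨_, rfl⟩
    have hd1 : 4 * Real.pi * (κ * y) ≤ d := by rw [hd]; exact Nat.le_ceil _
    have hπ := Real.pi_pos
    have hd2 : (d : ℝ) ≤ 4 * Real.pi * (κ * y) + 1 := by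
      rw [hd]
      exact (Nat.ceil_lt_add_one (by positivity)).le
    obtain ⟨h, h1, h2, h3, h4⟩ := exists_approx_of_one_lt hα d
    have hd3 : 2 * ((d + ⌊α - 1⌋₊ : ℕ) : ℝ) + 1 ≤ 30 * (α + κ * y) := by
      have h5 : (⌊α - 1⌋₊ : ℝ) ≤ α - 1 := Nat.floor_le hα1.le
      have h6 := mul_le_mul_of_nonneg_right Real.pi_lt_d2.le (by linarith : 0 ≤ κ * y)
      push_cast
      nlinarith
    obtain ⟨⟨E₁, hE1, hE2, hE3⟩, ⟨E₂, hE4, hE5⟩⟩ := H n m κ (d + ⌊α - 1⌋₊) α ε t 1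
      (2 * (Real.pi / (d + 2))) h hα0 hα.ne' hε ht one_pos h1 h2 h3 (by positivity) h4
      (by
        rw [one_mul, hinv, ← mul_assoc, mul_div_assoc', div_div, div_le_div_iff₀ (by positivity)
          (by positivity)]
        nlinarith)
      (by
        rw [one_mul, hinv, div_div, div_le_one (by positivity)]
        linarith)
    have hb := le_bounds_of_one_lt hα hε ht ht1 hκ hy hy1.le
    rw [one_mul, hinv] at hE3 hE5
    refine ⟨⟨E₁, hE1, hE2, fun s => (hE3 s).trans ?_⟩, ⟨E₂, hE4, fun s => (hE5 s).trans ?_⟩⟩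
    · calc _ ≤ C * (30 * (α + κ * y)) / (1 / y / 16) ^ 2 := by gcongr
        _ = C * 256 * 30 * (y ^ 2 * (α + κ * y)) := by field_simp; ring
        _ ≤ C * 256 * 30 * (2 * plainBound α ε κ t) :=
            mul_le_mul_of_nonneg_left hb.1 (by positivity)
        _ = _ := by ring
    · calc _ ≤ C * (30 * (α + κ * y)) / (1 / y / 16) := by gcongr
        _ = C * 16 * 30 * (y * (α + κ * y)) := by field_simp
        _ ≤ C * 256 * 30 * (y * (α + κ * y)) := by gcongr; norm_num
        _ ≤ C * 256 * 30 * (2 * amplitudeBound α ε κ t) :=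
            mul_le_mul_of_nonneg_left hb.2 (by positivity)
        _ = _ := by ring

lemma exists_estimators_of_lt_one {δ : ℝ} (hδ : 0 < δ) : ∃ C : ℝ, 0 < C ∧
    ∀ (n m κ : ℕ) (α ε t : ℝ), 1 ≤ κ → 0 < α → α < 1 → 0 < ε → 0 < t →
      (∃ E : Estimator n m, E.IsPlain ∧ E.EstimatesRenyi α ε δ κ t ∧
        ∀ s, (E.queries s : ℝ) ≤ C * plainBound α ε κ t) ∧
      (∃ E : Estimator n m, E.EstimatesRenyi α ε δ κ t ∧
        ∀ s, (E.queries s : ℝ) ≤ C * amplitudeBound α ε κ t) := by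
  obtain ⟨C, hC, H⟩ := exists_estimators_of_polynomial hδ
  refine ⟨C * 10, by positivity, fun n m κ α ε t hκ hα0 hα hε ht => ?_⟩
  have hα1 : 0 < 1 - α := by linarith
  have habs : |1 - α| = 1 - α := abs_of_pos hα1
  have hκ0 : (0 : ℝ) < κ := by exact_mod_cast hκ
  -- The entropy lies between log t / (1 - α) and log κ. If this interval has length at most 2ε, its
  -- midpoint is accurate.
  by_cases htriv : (1 - α) * Real.log κ - Real.log t ≤ 2 * ((1 - α) * ε)
  · obtain ⟨E, hE1, hE2, hE3⟩ := exists_estimator_of_constant hδ n m κ (α := α) (ε := ε) (t := t)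
      (((1 - α) * Real.log κ + Real.log t) / 2 / (1 - α)) fun ρ hρ hrank hT => by
        have hT1 := hρ.traceRpow_le_rpow hκ hrank hα0 hα
        have hT0 : 0 < traceRpow α ρ := ht.trans_le hT
        have h1 := Real.log_le_log ht hT
        have h2 := Real.log_le_log hT0 hT1
        rw [Real.log_rpow hκ0] at h2
        rw [renyiEntropy, one_div_mul_eq_div, ← sub_div, abs_div, habs, div_le_iff₀ hα1, abs_le]
        constructor <;> linarith
    refine ⟨⟨E, hE1, hE2, fun s => ?_⟩, ⟨E, hE2, fun s => ?_⟩⟩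
    · rw [hE3, Nat.cast_zero]
      exact mul_nonneg (by positivity) (plainBound_nonneg κ hα0 hε ht)
    · rw [hE3, Nat.cast_zero]
      exact mul_nonneg (by positivity) (amplitudeBound_nonneg κ hα0 hε ht)
  · push Not at htriv
    obtain ⟨y, hy⟩ : ∃ y, y = eta α t / ε := ⟨_, rfl⟩
    have hy0 : 0 < y := by rw [hy, eta, habs]; positivity
    have hinv : t * |1 - α| * ε = 1 / y := by rw [hy, eta, habs]; field_simp
    obtain ⟨z, hz⟩ : ∃ z, z = 16 * κ * y := ⟨_, rfl⟩
    have hz0 : 0 < z := by rw [hz]; positivity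
    -- Nontriviality, exponentiated with exp x ≥ x, gives κ^α ≤ κy/2. It is what makes κc, the
    -- precision asked of the flag probability, at most 1.
    have hzκ : (κ : ℝ) ^ α ≤ z := by
      have h1 : t * (2 * ((1 - α) * ε)) ≤ (κ : ℝ) ^ (1 - α) := by
        have h2 : Real.log t + 2 * ((1 - α) * ε) ≤ Real.log ((κ : ℝ) ^ (1 - α)) := by
          rw [Real.log_rpow hκ0]; linarith
        have h3 := Real.exp_le_exp.mpr h2
        rw [Real.exp_add, Real.exp_log ht, Real.exp_log (by positivity)] at h3
        refine le_trans ?_ h3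
        gcongr
        linarith [Real.add_one_le_exp (2 * ((1 - α) * ε))]
      have h4 : (κ : ℝ) ^ α * (κ : ℝ) ^ (1 - α) = κ := by rw [← Real.rpow_add hκ0]; simp
      have h5 : 2 / y ≤ (κ : ℝ) ^ (1 - α) := by
        rw [habs] at hinv
        calc 2 / y = 2 * (1 / y) := by ring
          _ = t * (2 * ((1 - α) * ε)) := by rw [← hinv]; ring
          _ ≤ _ := h1
      have h6 : (κ : ℝ) ^ α * (2 / y) ≤ κ := by
        calc _ ≤ (κ : ℝ) ^ α * (κ : ℝ) ^ (1 - α) := by gcongr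
          _ = κ := h4
      rw [mul_div_assoc', div_le_iff₀ hy0] at h6
      rw [hz]
      nlinarith [Real.rpow_nonneg hκ0.le α, mul_pos hκ0 hy0]
    -- Then c^(1-α)/(16y) = cz/(16y) = κc, so the precision e equals κc and the approximation error
    -- 2κc is within the allowed 8e.
    obtain ⟨c, hc⟩ : ∃ c, c = z ^ (-(1 / α)) := ⟨_, rfl⟩
    have hc0 : 0 < c := by rw [hc]; positivity
    have hcr : ∀ k : ℕ, 1 / c ^ k = z ^ (k / α) := by
      intro k
      rw [hc, ← Real.rpow_natCast, ← Real.rpow_mul hz0.le, one_div, ← Real.rpow_neg hz0.le]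
      congr 1
      ring
    have hcα : c ^ α = 1 / z := by
      rw [hc, ← Real.rpow_mul hz0.le, neg_mul, one_div_mul_cancel hα0.ne', Real.rpow_neg_one,
        one_div]
    have hκc : κ * c ≤ 1 := by
      have h1 : (κ : ℝ) ≤ 1 / c := by
        have := hcr 1
        rw [pow_one] at this
        rw [this, Nat.cast_one]
        calc (κ : ℝ) = ((κ : ℝ) ^ α) ^ (1 / α) := by
              rw [← Real.rpow_mul hκ0.le, mul_one_div_cancel hα0.ne', Real.rpow_one]
          _ ≤ z ^ (1 / α) := by gcongr
      rwa [le_div_iff₀ hc0] at h1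
    have hc1 : c ≤ 1 := by
      have h1 : (1 : ℝ) ≤ κ := by exact_mod_cast hκ
      nlinarith
    have he : c ^ (1 - α) * t * |1 - α| * ε / 16 = κ * c := by
      rw [mul_assoc, mul_assoc, ← mul_assoc t, hinv, Real.rpow_sub hc0, Real.rpow_one, hcα, hz]
      field_simp
    have hπ := Real.pi_pos
    obtain ⟨d, hd⟩ : ∃ d, d = ⌈Real.pi / c⌉₊ := ⟨_, rfl⟩
    have hd1 : Real.pi / c ≤ d := by rw [hd]; exact Nat.le_ceil _
    have hd2 : 2 * (d : ℝ) + 1 ≤ 10 / c := by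
      have h1 : (d : ℝ) ≤ Real.pi / c + 1 := by
        rw [hd]
        exact (Nat.ceil_lt_add_one (by positivity)).le
      have h2 : 1 ≤ 1 / c := by rw [one_le_div hc0]; exact hc1
      have h3 : Real.pi / c ≤ 3.15 * (1 / c) := by
        rw [div_eq_mul_one_div]
        gcongr
        exact Real.pi_lt_d2.le
      have h4 : 10 / c = 10 * (1 / c) := by ring
      linarith
    obtain ⟨h, h1, h2, h3, h4⟩ := exists_approx_of_lt_one hα0 hα hc0 hd1
    obtain ⟨⟨E₁, hE1, hE2, hE3⟩, ⟨E₂, hE4, hE5⟩⟩ := H n m κ d α ε t (c ^ (1 - α)) (2 * c) h hα0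
      hα.ne hε ht (by positivity) h1 h2 h3 (by positivity) h4 (by nlinarith [mul_pos hκ0 hc0])
      (by rw [he]; exact hκc)
    have hb := le_bounds_of_lt_one hα0 hα hε ht hκ (z := z) (by rw [hz, hy])
    rw [he] at hE3 hE5
    have hc2 := hcr 2
    have hc3 := hcr 3
    push_cast at hc2 hc3
    refine ⟨⟨E₁, hE1, hE2, fun s => (hE3 s).trans ?_⟩, ⟨E₂, hE4, fun s => (hE5 s).trans ?_⟩⟩
    · calc _ ≤ C * (10 / c) / (κ * c) ^ 2 := by gcongr
        _ = C * 10 * (1 / c ^ 3 / (κ : ℝ) ^ 2) := by field_simp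
        _ ≤ _ := by
            rw [hc3]
            exact mul_le_mul_of_nonneg_left hb.1 (by positivity)
    · calc _ ≤ C * (10 / c) / (κ * c) := by gcongr
        _ = C * 10 * (1 / c ^ 2 / κ) := by field_simp
        _ ≤ _ := by
            rw [hc2]
            exact mul_le_mul_of_nonneg_left hb.2 (by positivity)

end Estimation

end QPP

theorem mainTheorem12 (δ : ℝ) (hδ : 0 < δ) (hδ' : δ < 1) :
    ∃ C : ℝ, 0 < C ∧
      ∀ (n m κ : ℕ) (α ε t : ℝ), 1 ≤ κ → κ ≤ 2 ^ n → 0 < α → α ≠ 1 → 0 < ε → 0 < t →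
        (∃ E : QPP.Estimator n m,
          E.IsPlain ∧ E.EstimatesRenyi α ε δ κ t ∧
            ∀ s, (E.queries s : ℝ) ≤ C * QPP.plainBound α ε κ t) ∧
        (∃ E : QPP.Estimator n m,
          E.EstimatesRenyi α ε δ κ t ∧
            ∀ s, (E.queries s : ℝ) ≤ C * QPP.amplitudeBound α ε κ t) := by
  obtain ⟨C₁, hC₁, H₁⟩ := QPP.exists_estimators_of_lt_one hδ
  obtain ⟨C₂, -, H₂⟩ := QPP.exists_estimators_of_one_lt hδ
  refine ⟨max C₁ C₂, lt_max_of_lt_left hC₁, fun n m κ α ε t hκ _ hα0 hα1 hε ht => ?_⟩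
  have hp := QPP.plainBound_nonneg κ hα0 hε ht
  have ha := QPP.amplitudeBound_nonneg κ hα0 hε ht
  rcases lt_or_gt_of_ne hα1 with hα | hα
  · obtain ⟨⟨E₁, h1, h2, h3⟩, ⟨E₂, h4, h5⟩⟩ := H₁ n m κ α ε t hκ hα0 hα hε ht
    exact ⟨⟨E₁, h1, h2, fun s => (h3 s).trans (mul_le_mul_of_nonneg_right (le_max_left _ _) hp)⟩,
      ⟨E₂, h4, fun s => (h5 s).trans (mul_le_mul_of_nonneg_right (le_max_left _ _) ha)⟩⟩
  · obtain ⟨⟨E₁, h1, h2, h3⟩, ⟨E₂, h4, h5⟩⟩ := H₂ n m κ α ε t hκ hα hε ht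
    exact ⟨⟨E₁, h1, h2, fun s => (h3 s).trans (mul_le_mul_of_nonneg_right (le_max_right _ _) hp)⟩,
      ⟨E₂, h4, fun s => (h5 s).trans (mul_le_mul_of_nonneg_right (le_max_right _ _) ha)⟩⟩
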